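/- **Setting.** Fix $\mu\in\mathbb R^d$ and let $n$ training points have true labels $y_i\in\{\pm1\}$, observed labels $\tilde y_i\in\{\pm1\}$ and inputs $x_i$ made of two patches of $\mathbb R^d$, one equal to $y_i\mu$ and the other to $\xi_i$ (in either order), where $\xi_1,\dots,\xi_n$ are i.i.d. $N(0,\sigma_\xi^2 I_d)$. The set is balanced and $\tau_+$, $\tau_-$ are the fractions of flipped labels in the two classes: the numbers of $i$ with $(y_i,\tilde y_i)=(1,1),(1,-1),(-1,-1),(-1,1)$ are $\frac{(1-\tau_+)n}2,\frac{\tau_+n}2,\frac{(1-\tau_-)n}2,\frac{\tau_-n}2$. Sample $i$ is clean if $\tilde y_i=y_i$ and noisy otherwise. The network is $$f(W,x)=F_{+1}(W,x)-F_{-1}(W,x),\qquad F_j(W,x)=\frac1m\sum_{r=1}^m\big(\sigma(\langle w_{j,r},x^{(1)}\rangle)+\sigma(\langle w_{j,r},x^{(2)}\rangle)\big),$$ with $\sigma(z)=\max\{0,z\}$, and $L_S(W)=\frac1n\sum_i\log(1+\exp(-\tilde y_if(W,x_i)))$. Let $W^{(0)}$ have independent rows $w^{(0)}_{j,r}\sim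 N(0,\sigma_0^2I_d)$ ($j=\pm1$, $r\in[m]$), independent of the $\xi_i$, and let $W^{(t)}$ be the iterates of gradient descent on $L_S$ with learning rate $\eta>0$ (with $\sigma'(0)=1$). The test error $L_D^{0-1}(W)$ is the probability, given $\xi_1,\dots,\xi_n$, that $y f(W,[y\mu,\xi_I+\zeta])<0$, where $y$ is uniform on $\{\pm1\}$, $I$ uniform on $[n]$ and $\zeta\sim N(0,\sigma_\xi^2I_d)$, all independent. The signal and noise coefficients $\gamma^{(t)}_{j,r},\rho^{(t)}_{j,r,i}$ are defined by $$w^{(t)}_{j,r}=w^{(0)}_{j,r}+j\,\gamma^{(t)}_{j,r}\frac{\mu}{\|\mu\|^2}+\sum_{i=1}^n\rho^{(t)}_{j,r,i}\frac{\xi_i}{\|\xi_i\|^2},\qquad \overline\rho^{(t)}_{j,r,i}=\rho^{(t)}_{j,r,i}\mathbf 1(\rho^{(t)}_{j,r,i}\ge0).$$ Put $\mathrm{SNR}=\|\mu\|/(\sigma_\xi\sqrt d)$ and, for $\kappa,\epsilon>0$ and $\epsilon_1=\min\{\epsilon,1\}$, $$T^*=\kappa\,\eta^{-1}\epsilon_1^{-1}nm\,\sigma_\xi^{-2}d^{-1}\log(2/\epsilon_1)^2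 .$$ **Theorem.** Let $0<c_1\le c_2$, $0<\tau_{lo}\le\tau_{hi}<\frac12$ and $\kappa_1>0$. There are constants $C,\kappa,\tau_0>0$, depending only on these five numbers, such that the following holds for all $\epsilon>0$, all $\delta\in(0,1)$ and all $n,m,d,\mu,\sigma_\xi>0,\sigma_0>0,\eta>0,\tau_\pm$ and labels as above with 1. $c_1\le n\,\mathrm{SNR}^2\le c_2$ and $\tau_+,\tau_-\in[\tau_{lo},\tau_{hi}]$; 2. $d\ge C\max\{n^2\log(nm/\delta)\log(T^*)^2,\ n\|\mu\|\sigma_\xi^{-1}\sqrt{\log(n/\delta)}\}$; 3. $m\ge C\log(n/\delta)$ and $n\ge C\log(m/\delta)$; 4. $\|\mu\|^2\ge C\sigma_\xi^2\log(n/\delta)$; 5. $\sigma_0\le C^{-1}\min\{\sqrt n\,\sigma_\xi^{-1}d^{-1},\ \|\mu\|^{-1}\log(m/\delta)^{-1/2}\}$; 6. $\eta\le C^{-1}\min\{\sigma_\xi^{-2}d^{-3/2}n^2m\sqrt{\log(n/\delta)},\ \sigma_\xi^{-2}d^{-1}n\}$. With probability at least $1-\delta$ over $W^{(0)}$ and $\xi_1,\dots,\xi_n$: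 for every integer $T_1\ge 0$ with $T_1\le\kappa_1\eta^{-1}nm\sigma_\xi^{-2}d^{-1}$ there is an integer $t^*\in[T_1,T^*]$ such that $L_S(W^{(t^*)})\le\epsilon$ and * every clean sample satisfies $\tilde y_if(W^{(t^*)},x_i)\ge0$; * the coefficients $\gamma^{(t^*)},\rho^{(t^*)}$ exist and are unique, and for some $\tau'\in[\tau_0,\frac{\tau_++\tau_-}2]$ there are $\tau'n$ noisy samples $i$ with $\frac1m\sum_{r}\overline\rho^{(t^*)}_{\tilde y_i,r,i}>\frac1m\sum_{r}\gamma^{(t^*)}_{-\tilde y_i,r}$ and $\tilde y_if(W^{(t^*)},x_i)\ge0$; * $L_D^{0-1}(W^{(t^*)})\ge\frac12\min\{\tau_+,\tau_-\}$ if $\tau_+\ne\tau_-$, and $L_D^{0-1}(W^{(t^*)})\ge\frac12(1-e^{-n})\min\{\tau_+,\tau_-\}$ in every case. -/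

import Mathlib

open MeasureTheory ProbabilityTheory

noncomputable section

namespace LabelNoise

/-- A single data patch, a vector of `ℝ^d` with the Euclidean norm. -/
abbrev Patch (d : ℕ) := EuclideanSpace ℝ (Fin d)

/-- A data point `x = [x⁽¹⁾, x⁽²⁾]`. -/
abbrev Input (d : ℕ) := Patch d × Patch d

/-- First-layer weights `w_{j,r}`, `j = ±1`, `r ∈ [m]`. Labels and the index `j` are elements of
`ℤˣ = {1, -1}`. -/
abbrev Weights (m d : ℕ) := ℤˣ → Fin m → Patch d

/-- A label as a real number. -/
def lab (y : ℤˣ) : ℝ := ((y : ℤ) : ℝ)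

/-! ### The network, the loss and gradient descent -/

def relu (z : ℝ) : ℝ := max 0 z

/-- The derivative of the ReLU, with the convention `σ'(0) = 1`. -/
def reluDeriv (z : ℝ) : ℝ := if 0 ≤ z then 1 else 0

/-- `F_j(W_j, x)`. -/
def branch {m d : ℕ} (W : Weights m d) (j : ℤˣ) (x : Input d) : ℝ :=
  (1 / (m : ℝ)) * ∑ r : Fin m, (relu (inner ℝ (W j r) x.1) + relu (inner ℝ (W j r) x.2))

/-- The network output `f(W, x) = F_{+1}(W_{+1}, x) - F_{-1}(W_{-1}, x)`. -/
def net {m d : ℕ} (W : Weights m d) (x : Input d) : ℝ :=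
  branch W 1 x - branch W (-1) x

/-- The logistic loss `ℓ(f, y) = log (1 + exp (-f y))`. -/
def logisticLoss (f y : ℝ) : ℝ := Real.log (1 + Real.exp (-(f * y)))

/-- `ℓ'(f, y) = -1 / (1 + exp (y f))`. -/
def lossDeriv (f y : ℝ) : ℝ := -(1 / (1 + Real.exp (y * f)))

/-- The empirical risk `L_S(W)`. -/
def trainLoss {n m d : ℕ} (x : Fin n → Input d) (yt : Fin n → ℤˣ) (W : Weights m d) : ℝ :=
  (1 / (n : ℝ)) * ∑ i : Fin n, logisticLoss (net W (x i)) (lab (yt i))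

/-- The gradient of `L_S` with respect to `w_{j,r}`, computed by the chain rule. -/
def gradLoss {n m d : ℕ} (x : Fin n → Input d) (yt : Fin n → ℤˣ) (W : Weights m d)
    (j : ℤˣ) (r : Fin m) : Patch d :=
  (1 / ((n : ℝ) * m)) • ∑ i : Fin n, (lossDeriv (net W (x i)) (lab (yt i)) * lab j * lab (yt i)) •
    (reluDeriv (inner ℝ (W j r) (x i).1) • (x i).1 + reluDeriv (inner ℝ (W j r) (x i).2) • (x i).2)

/-- One step of full-batch gradient descent with learning rate `η`. -/
def gdStep {n m d : ℕ} (η : ℝ) (x : Fin n → Input d) (yt : Fin n → ℤˣ) (W : Weights m d) :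
    Weights m d :=
  fun j r => W j r - η • gradLoss x yt W j r

/-- The iterate `W^{(t)}` of gradient descent started at `W₀`. -/
def gd {n m d : ℕ} (η : ℝ) (x : Fin n → Input d) (yt : Fin n → ℤˣ) (W₀ : Weights m d) (t : ℕ) :
    Weights m d :=
  (gdStep η x yt)^[t] W₀

/-! ### Data -/

/-- The training inputs: one patch is the signal `y_i μ`, the other one the noise `ξ_i`; `pos i`
tells which one comes first. -/
def trainInput {n d : ℕ} (μ : Patch d) (y : Fin n → ℤˣ) (pos : Fin n → Bool)
    (ξ : Fin n → Patch d) (i : Fin n) : Input d :=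
  if pos i then (lab (y i) • μ, ξ i) else (ξ i, lab (y i) • μ)

/-- The training set is balanced and the fractions of flipped labels in the classes `+1` and `-1`
are `τp` and `τm`. -/
structure LabelCounts {n : ℕ} (y yt : Fin n → ℤˣ) (τp τm : ℝ) : Prop where
  pos_clean : (({i | y i = 1 ∧ yt i = y i} : Finset (Fin n)).card : ℝ) = (1 - τp) * n / 2
  pos_noisy : (({i | y i = 1 ∧ yt i ≠ y i} : Finset (Fin n)).card : ℝ) = τp * n / 2
  neg_clean : (({i | y i = -1 ∧ yt i = y i} : Finset (Fin n)).card : ℝ) = (1 - τm) * n / 2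
  neg_noisy : (({i | y i = -1 ∧ yt i ≠ y i} : Finset (Fin n)).card : ℝ) = τm * n / 2

/-- The Gaussian distribution `N(0, σ² I_d)`. -/
def gaussianPatch (d : ℕ) (σ : ℝ) : Measure (Patch d) :=
  (stdGaussian (Patch d)).map (fun v => σ • v)

/-- The joint law of the initialization `W^{(0)}`, whose rows are i.i.d. `N(0, σ0² I_d)`, and of
the training noise patches `ξ_1, …, ξ_n`, which are i.i.d. `N(0, σξ² I_d)`. -/
def trainLaw (n m d : ℕ) (σ0 σξ : ℝ) : Measure (Weights m d × (Fin n → Patch d)) :=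
  (Measure.pi fun _ : ℤˣ => Measure.pi fun _ : Fin m => gaussianPatch d σ0).prod
    (Measure.pi fun _ : Fin n => gaussianPatch d σξ)

/-- The randomness of a test point: a Rademacher label `y`, a uniform index `i ∈ [n]` and a
Gaussian vector `ζ ~ N(0, σξ² I_d)`, independent. -/
def testLaw (n d : ℕ) (σξ : ℝ) : Measure (ℤˣ × Fin n × Patch d) :=
  (uniformOn Set.univ).prod ((uniformOn Set.univ).prod (gaussianPatch d σξ))

/-- The test 0-1 error `L_D^{0-1}(W)`: the probability of `y f(W, x) < 0` for
`x = [y μ, ξ_i + ζ]`. -/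
def testError {n m d : ℕ} (μ : Patch d) (σξ : ℝ) (ξ : Fin n → Patch d) (W : Weights m d) : ℝ :=
  (testLaw n d σξ).real
    {p | lab p.1 * net W (lab p.1 • μ, ξ p.2.1 + p.2.2) < 0}

/-! ### Signal-noise decomposition -/

/-- `γ` and `ρ` are the signal and noise coefficients of `W` relative to the initialization `W₀`:
`w_{j,r} = w_{j,r}^{(0)} + j γ_{j,r} ‖μ‖⁻² μ + ∑ i, ρ_{j,r,i} ‖ξ_i‖⁻² ξ_i`. -/
def IsDecomposition {n m d : ℕ} (μ : Patch d) (ξ : Fin n → Patch d) (W₀ W : Weights m d)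
    (γ : ℤˣ → Fin m → ℝ) (ρ : ℤˣ → Fin m → Fin n → ℝ) : Prop :=
  ∀ j r, W j r = W₀ j r + (lab j * γ j r * (‖μ‖ ^ 2)⁻¹) • μ +
    ∑ i : Fin n, (ρ j r i * (‖ξ i‖ ^ 2)⁻¹) • ξ i

/-- The decomposition, together with its uniqueness. -/
def IsUniqueDecomposition {n m d : ℕ} (μ : Patch d) (ξ : Fin n → Patch d) (W₀ W : Weights m d)
    (γ : ℤˣ → Fin m → ℝ) (ρ : ℤˣ → Fin m → Fin n → ℝ) : Prop :=
  IsDecomposition μ ξ W₀ W γ ρ ∧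
    ∀ γ' ρ', IsDecomposition μ ξ W₀ W γ' ρ' → γ' = γ ∧ ρ' = ρ

/-- The positive part `ρ̄ = ρ 𝟙(ρ ≥ 0)` of a noise coefficient. -/
def rhoBar (ρ : ℝ) : ℝ := if 0 ≤ ρ then ρ else 0

/-! ### Time scales and the standing condition -/

/-- The signal-to-noise ratio `‖μ‖ / (σξ √d)`. -/
def snr {d : ℕ} (μ : Patch d) (σξ : ℝ) : ℝ := ‖μ‖ / (σξ * √(d : ℝ))

/-- The time scale `η⁻¹ n m σξ⁻² d⁻¹` of the first stage. -/
def stageOneScale (n m d : ℕ) (σξ η : ℝ) : ℝ :=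
  η⁻¹ * n * m * (σξ ^ 2)⁻¹ * (d : ℝ)⁻¹

/-- The maximal number of iterations
`T* = κ η⁻¹ ε₁⁻¹ n m σξ⁻² d⁻¹ log(2/ε₁)²`, where `ε₁ = min ε 1`. -/
def maxIter (κ ε : ℝ) (n m d : ℕ) (σξ η : ℝ) : ℝ :=
  κ * ((min ε 1)⁻¹ * stageOneScale n m d σξ η) * Real.log (2 / min ε 1) ^ 2

/-- The standing condition. Here `C` is the large constant, `c₁, c₂` and `τlo, τhi` are the
constants in `n · SNR² = Θ(1)` and `τ₊, τ₋ = Θ(1)`, and `Tstar` is the maximal number of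
iterations. -/
structure Condition (C c₁ c₂ τlo τhi Tstar : ℝ) (n m d : ℕ) (μ : Patch d)
    (σξ σ0 η τp τm δ : ℝ) : Prop where
  σξ_pos : 0 < σξ
  σ0_pos : 0 < σ0
  η_pos : 0 < η
  δ_pos : 0 < δ
  δ_lt : δ < 1
  snr_mem : n * snr μ σξ ^ 2 ∈ Set.Icc c₁ c₂
  τp_mem : τp ∈ Set.Icc τlo τhi
  τm_mem : τm ∈ Set.Icc τlo τhi
  dim_large : C * max ((n : ℝ) ^ 2 * Real.log (n * m / δ) * Real.log Tstar ^ 2)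
    (n * ‖μ‖ * σξ⁻¹ * √(Real.log (n / δ))) ≤ d
  width_large : C * Real.log (n / δ) ≤ m
  sample_large : C * Real.log (m / δ) ≤ n
  signal_large : C * σξ ^ 2 * Real.log (n / δ) ≤ ‖μ‖ ^ 2
  init_small : σ0 ≤ C⁻¹ * min (√(n : ℝ) * σξ⁻¹ * (d : ℝ)⁻¹)
    (‖μ‖⁻¹ * (√(Real.log (m / δ)))⁻¹)
  step_small : η ≤ C⁻¹ * min
    ((σξ ^ 2)⁻¹ * (d : ℝ) ^ (-(3 / 2) : ℝ) * (n : ℝ) ^ 2 * m * √(Real.log (n / δ)))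
    ((σξ ^ 2)⁻¹ * (d : ℝ)⁻¹ * n)

/-! ### The outcome of the second stage -/

/-- The noisy samples whose averaged noise coefficient exceeds the averaged signal coefficient and
which are fitted to their wrong observed label. -/
def memorized {n m d : ℕ} (x : Fin n → Input d) (y yt : Fin n → ℤˣ) (W : Weights m d)
    (γ : ℤˣ → Fin m → ℝ) (ρ : ℤˣ → Fin m → Fin n → ℝ) : Set (Fin n) :=
  {i | yt i ≠ y i ∧
    (1 / (m : ℝ)) * ∑ r : Fin m, γ (-yt i) r < (1 / (m : ℝ)) * ∑ r : Fin m, rhoBar (ρ (yt i) r i) ∧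
    0 ≤ lab (yt i) * net W (x i)}

end LabelNoise

end

/-!
Up to small errors, gradient descent is a scalar flow for the margins: the margin of a sample is its
own noise coefficient, plus the signal coefficient of its class if it is clean and minus it if it is
noisy. The noise part of a sample grows at the rate of its logistic weight, the signal part of a
class at the signed mean of the weights of the class. Since both kinds of samples occupy a positive
fraction of each class and `n * SNR ^ 2` is bounded, a margin that is ahead of another one by a
constant grows more slowly. Hence all margins stay within a constant of each other, all weights are
of order `1 / t`, and at time `T*` all samples are fitted, the noisy ones by their noise.

For a noisy sample and a noisy sample of the other class to be fitted together, their noise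
coefficients must outweigh the signal coefficients of both classes, so that in one of the classes
all noisy samples are memorized. The same noise defeats the test: a test point built on a noisy
training sample with the same true label differs from it by a perturbation `ζ`, which changes the
output by less than the margin with probability at least `1 - exp (-n)`.
-/

open MeasureTheory ProbabilityTheory

noncomputable section

namespace LabelNoise

open Real (exp log)

/-! ### Labels and logistic weights -/

lemma lab_one : lab 1 = 1 := by simp [lab]

lemma lab_neg (s : ℤˣ) : lab (-s) = -lab s := by simp [lab]

lemma lab_mul (s u : ℤˣ) : lab (s * u) = lab s * lab u := by simp [lab]

lemma lab_mul_self (s : ℤˣ) : lab s * lab s = 1 := by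
  rw [← lab_mul, Int.units_mul_self, lab_one]

lemma abs_lab (s : ℤˣ) : |lab s| = 1 := by
  rcases Int.units_eq_one_or s with rfl | rfl <;> simp [lab]

/-- The absolute value of the derivative of the logistic loss at margin `z`. -/
def logisticWeight (z : ℝ) : ℝ := Real.sigmoid (-z)

lemma logisticWeight_eq (z : ℝ) : logisticWeight z = 1 / (1 + exp z) := by
  rw [logisticWeight, Real.sigmoid_def, neg_neg, one_div]

lemma logisticWeight_pos (z : ℝ) : 0 < logisticWeight z := Real.sigmoid_pos _

lemma logisticWeight_le_one (z : ℝ) : logisticWeight z ≤ 1 := Real.sigmoid_le_one _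

lemma logisticWeight_antitone : Antitone logisticWeight := fun _ _ h =>
  Real.sigmoid_le (neg_le_neg h)

lemma half_le_logisticWeight {z : ℝ} (hz : z ≤ 0) : 1 / 2 ≤ logisticWeight z := by
  rw [one_div, ← Real.sigmoid_zero, logisticWeight]
  exact Real.sigmoid_le (neg_nonneg.2 hz)

lemma logisticWeight_le_exp_neg (z : ℝ) : logisticWeight z ≤ exp (-z) := by
  rw [logisticWeight, ← Real.sigmoid_mul_rexp_neg]
  exact mul_le_of_le_one_left (Real.exp_pos _).le (Real.sigmoid_le_one z)

lemma exp_neg_le_mul_logisticWeight {z b : ℝ} (h : -b ≤ z) :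
    exp (-z) ≤ (1 + exp b) * logisticWeight z := by
  have hexp : exp (-z) ≤ exp b := Real.exp_le_exp.2 (by linarith)
  calc exp (-z) = (1 + exp (-z)) * logisticWeight z := by
        rw [logisticWeight_eq, Real.exp_neg]
        field_simp
        ring
    _ ≤ (1 + exp b) * logisticWeight z := by
        gcongr
        exact (logisticWeight_pos z).le

lemma logisticWeight_le_exp_mul {z w b : ℝ} (hb : 0 ≤ b) (h : w - z ≤ b) :
    logisticWeight z ≤ exp b * logisticWeight w := by
  rw [logisticWeight_eq, logisticWeight_eq, mul_one_div,
    div_le_div_iff₀ (by positivity) (by positivity), one_mul, mul_one_add, ← Real.exp_add]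
  exact add_le_add (Real.one_le_exp hb) (Real.exp_le_exp.2 (by linarith))

lemma logisticWeight_le_of_gap {z w b g : ℝ} (hw : -b ≤ w) (h : g ≤ z - w) :
    logisticWeight z ≤ exp (-g) * (1 + exp b) * logisticWeight w := by
  calc logisticWeight z ≤ exp (-z) := logisticWeight_le_exp_neg z
    _ ≤ exp (-g) * exp (-w) := by
        rw [← Real.exp_add]
        exact Real.exp_le_exp.2 (by linarith)
    _ ≤ exp (-g) * ((1 + exp b) * logisticWeight w) := by
        gcongr
        exact exp_neg_le_mul_logisticWeight hw
    _ = exp (-g) * (1 + exp b) * logisticWeight w := by ring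

/-! ### Sequences with feedback -/

lemma le_add_of_barrier {G : Type*} [AddCommGroup G] [LinearOrder G] [IsOrderedAddMonoid G]
    {X : ℕ → G} {b c : G} {T : ℕ} (h0 : X 0 ≤ b + c)
    (hstep : ∀ t < T, X (t + 1) ≤ X t + c) (hdec : ∀ t < T, b ≤ X t → X (t + 1) ≤ X t) {t : ℕ}
    (ht : t ≤ T) : X t ≤ b + c := by
  induction t with
  | zero => exact h0
  | succ t ih =>
    rcases le_total b (X t) with h | h
    · exact (hdec t ht h).trans (ih (Nat.le_of_succ_le ht))
    · exact (hstep t ht).trans (by gcongr)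

lemma one_add_mul_le_exp_of_step {Q : ℕ → ℝ} {a : ℝ} {T : ℕ} (h0 : 0 ≤ Q 0)
    (hstep : ∀ t < T, a * exp (-Q t) ≤ Q (t + 1) - Q t) {t : ℕ} (ht : t ≤ T) :
    1 + a * t ≤ exp (Q t) := by
  induction t with
  | zero => simpa using Real.one_le_exp h0
  | succ t ih =>
    have hgrow : a ≤ exp (Q t) * (Q (t + 1) - Q t) := by
      calc a = exp (Q t) * (a * exp (-Q t)) := by
            rw [mul_left_comm, ← Real.exp_add, add_neg_cancel, Real.exp_zero, mul_one]
        _ ≤ exp (Q t) * (Q (t + 1) - Q t) := by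
            gcongr
            exact hstep t ht
    calc 1 + a * ((t + 1 : ℕ) : ℝ) = (1 + a * t) + a := by push_cast; ring
      _ ≤ exp (Q t) + exp (Q t) * (Q (t + 1) - Q t) :=
          add_le_add (ih (Nat.le_of_succ_le ht)) hgrow
      _ = exp (Q t) * (Q (t + 1) - Q t + 1) := by ring
      _ ≤ exp (Q t) * exp (Q (t + 1) - Q t) := by gcongr; exact Real.add_one_le_exp _
      _ = exp (Q (t + 1)) := by rw [← Real.exp_add, add_sub_cancel]

lemma exp_le_one_add_mul_of_step {Q : ℕ → ℝ} {b : ℝ} {T : ℕ} (h0 : Q 0 ≤ 0)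
    (hmono : ∀ t < T, Q t ≤ Q (t + 1)) (hone : ∀ t < T, Q (t + 1) - Q t ≤ 1)
    (hstep : ∀ t < T, Q (t + 1) - Q t ≤ b * exp (-Q t)) {t : ℕ} (ht : t ≤ T) :
    exp (Q t) ≤ 1 + 2 * b * t := by
  induction t with
  | zero => simpa using h0
  | succ t ih =>
    have hnonneg : 0 ≤ Q (t + 1) - Q t := sub_nonneg.2 (hmono t ht)
    have hlin : exp (Q (t + 1) - Q t) ≤ 1 + 2 * (Q (t + 1) - Q t) := by
      have hexp := Real.abs_exp_sub_one_le (x := Q (t + 1) - Q t)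
        (by simpa only [abs_of_nonneg hnonneg] using hone t ht)
      rw [abs_of_nonneg hnonneg] at hexp
      linarith [le_abs_self (exp (Q (t + 1) - Q t) - 1)]
    calc exp (Q (t + 1)) = exp (Q t) * exp (Q (t + 1) - Q t) := by
          rw [← Real.exp_add, add_sub_cancel]
      _ ≤ exp (Q t) * (1 + 2 * (b * exp (-Q t))) := by
          gcongr
          linarith [hstep t ht]
      _ = exp (Q t) + 2 * b * (exp (Q t) * exp (-Q t)) := by ring
      _ = exp (Q t) + 2 * b := by
          rw [← Real.exp_add, add_neg_cancel, Real.exp_zero, mul_one]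
      _ ≤ 1 + 2 * b * t + 2 * b := by gcongr; exact ih (Nat.le_of_succ_le ht)
      _ = 1 + 2 * b * ((t + 1 : ℕ) : ℝ) := by push_cast; ring

/-! ### Margin flows -/

/-- The average over all samples of the logistic weights of a class, signed by `s`; up to a factor
it is the velocity of the signal part of that class. -/
def drift {ι : Type*} [Fintype ι] (cls s : ι → ℤˣ) (M : ι → ℝ) (c : ℤˣ) : ℝ :=
  (∑ i with cls i = c, lab (s i) * logisticWeight (M i)) / Fintype.card ι

/-- A scalar caricature of gradient descent. Sample `i` has class `cls i` and is clean or noisy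
according to `s i = 1` or `s i = -1`. Its margin `M t i` is, up to a bounded error, the noise part
`A t i` plus `s i` times the signal part `P t (cls i)` of its class. The noise part grows at a rate
proportional to the logistic weight, the signal part moves in the direction of the drift of the
class. The factor `lab σ` in `signal_step` treats the two signs of the drift at once. -/
structure MarginFlow {ι : Type*} [Fintype ι] (cls s : ι → ℤˣ) (h α β K : ℝ) (T : ℕ)
    (A : ℕ → ι → ℝ) (P : ℕ → ℤˣ → ℝ) (M : ℕ → ι → ℝ) : Prop where
  h_nonneg : 0 ≤ h
  α_pos : 0 < α
  β_pos : 0 < β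
  K_nonneg : 0 ≤ K
  step_small : h * (β + 2 * K) ≤ 1 / 4
  noise_zero : ∀ i, A 0 i = 0
  signal_zero : ∀ c, P 0 c = 0
  le_noise_step : ∀ t < T, ∀ i, α * h * logisticWeight (M t i) ≤ A (t + 1) i - A t i
  noise_step_le : ∀ t < T, ∀ i, A (t + 1) i - A t i ≤ β * h * logisticWeight (M t i)
  signal_step : ∀ t < T, ∀ c σ, 0 ≤ lab σ * drift cls s (M t) c →
    0 ≤ lab σ * (P (t + 1) c - P t c) ∧
      lab σ * (P (t + 1) c - P t c) ≤ h * K * (lab σ * drift cls s (M t) c)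
  approx : ∀ t < T, ∀ i, |M t i - (A t i + lab (s i) * P t (cls i))| ≤ 1 / 2

/-- Each of the four kinds of samples, clean or noisy in either class, makes up at least the
positive fraction `p` of all samples. -/
structure Populated {ι : Type*} [Fintype ι] (cls s : ι → ℤˣ) (p : ℝ) : Prop where
  pos : 0 < p
  le_card : ∀ c σ : ℤˣ, p * Fintype.card ι ≤ ({i | cls i = c ∧ s i = σ} : Finset ι).card

section Drift

variable {ι : Type*} [Fintype ι] [Nonempty ι] {cls s : ι → ℤˣ} {p : ℝ}

namespace Populated

lemma exists_mem (hpop : Populated cls s p) (c σ : ℤˣ) : ∃ i, cls i = c ∧ s i = σ := by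
  have hcard : (0 : ℝ) < ({i | cls i = c ∧ s i = σ} : Finset ι).card :=
    (mul_pos hpop.pos (Nat.cast_pos.2 Fintype.card_pos)).trans_le (hpop.le_card c σ)
  obtain ⟨i, hi⟩ := Finset.card_pos.1 (Nat.cast_pos.1 hcard)
  exact ⟨i, by simpa using hi⟩

lemma le_one (hpop : Populated cls s p) : p ≤ 1 := by
  have hcard : p * Fintype.card ι ≤ Fintype.card ι :=
    (hpop.le_card 1 1).trans (by exact_mod_cast Finset.card_le_univ _)
  exact (mul_le_iff_le_one_left (Nat.cast_pos.2 Fintype.card_pos)).1 hcard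

end Populated

omit [Nonempty ι] in
lemma lab_mul_drift (M : ι → ℝ) (c σ : ℤˣ) :
    lab σ * drift cls s M c = (∑ i with cls i = c ∧ s i = σ, logisticWeight (M i) -
      ∑ i with cls i = c ∧ s i = -σ, logisticWeight (M i)) / Fintype.card ι := by
  rw [drift, mul_div_assoc', Finset.mul_sum]
  congr 1
  simp only [Finset.sum_filter, ← Finset.sum_sub_distrib]
  refine Finset.sum_congr rfl fun i _ => ?_
  rcases Int.units_eq_one_or (s i) with h | h <;> rcases Int.units_eq_one_or σ with rfl | rfl <;>
    by_cases hc : cls i = c <;> simp [h, hc, lab]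

lemma neg_le_lab_mul_drift {M : ι → ℝ} {c σ : ℤˣ} {q : ℝ} (hq : 0 ≤ q)
    (h : ∀ k, cls k = c → s k = -σ → logisticWeight (M k) ≤ q) :
    -q ≤ lab σ * drift cls s M c := by
  have hn : (0 : ℝ) < Fintype.card ι := Nat.cast_pos.2 Fintype.card_pos
  rw [lab_mul_drift, le_div_iff₀ hn]
  have hsame : 0 ≤ ∑ i with cls i = c ∧ s i = σ, logisticWeight (M i) :=
    Finset.sum_nonneg fun i _ => (logisticWeight_pos _).le
  have hopposite :
      ∑ i with cls i = c ∧ s i = -σ, logisticWeight (M i) ≤ Fintype.card ι * q := by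
    calc ∑ i with cls i = c ∧ s i = -σ, logisticWeight (M i)
        ≤ ∑ i with cls i = c ∧ s i = -σ, q := Finset.sum_le_sum fun i hi => by
          rw [Finset.mem_filter] at hi
          exact h i hi.2.1 hi.2.2
      _ ≤ Fintype.card ι * q := by
        rw [Finset.sum_const, nsmul_eq_mul]
        gcongr
        exact Finset.card_le_univ _
  linarith

lemma lab_mul_drift_nonneg (hpop : Populated cls s p) {M : ι → ℝ} {c σ : ℤˣ}
    (h : ∀ i k, cls i = c → s i = σ → cls k = c → s k = -σ →
      logisticWeight (M k) ≤ p * logisticWeight (M i)) :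
    0 ≤ lab σ * drift cls s M c := by
  have hn : (0 : ℝ) < Fintype.card ι := Nat.cast_pos.2 Fintype.card_pos
  rw [lab_mul_drift]
  refine div_nonneg (sub_nonneg.2 ?_) hn.le
  set S : Finset ι := {i | cls i = c ∧ s i = σ}
  set O : Finset ι := {i | cls i = c ∧ s i = -σ}
  have hsum : 0 ≤ ∑ i ∈ S, logisticWeight (M i) :=
    Finset.sum_nonneg fun i _ => (logisticWeight_pos _).le
  have hone : ∀ k ∈ O, Fintype.card ι * logisticWeight (M k) ≤ ∑ i ∈ S, logisticWeight (M i) := by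
    intro k hk
    refine le_of_mul_le_mul_left ?_ hpop.pos
    calc p * (Fintype.card ι * logisticWeight (M k))
        = (p * Fintype.card ι) * logisticWeight (M k) := (mul_assoc _ _ _).symm
      _ ≤ S.card * logisticWeight (M k) := by
          gcongr
          · exact (logisticWeight_pos _).le
          · exact hpop.le_card c σ
      _ = ∑ _i ∈ S, logisticWeight (M k) := by rw [Finset.sum_const, nsmul_eq_mul]
      _ ≤ ∑ i ∈ S, p * logisticWeight (M i) := Finset.sum_le_sum fun i hi => by
          simp only [S, O, Finset.mem_filter, Finset.mem_univ, true_and] at hk hi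
          exact h i k hi.1 hi.2 hk.1 hk.2
      _ = p * ∑ i ∈ S, logisticWeight (M i) := (Finset.mul_sum _ _ _).symm
  refine le_of_mul_le_mul_left ?_ hn
  calc Fintype.card ι * ∑ k ∈ O, logisticWeight (M k)
      ≤ O.card • ∑ i ∈ S, logisticWeight (M i) := by
        rw [Finset.mul_sum]
        exact Finset.sum_le_card_nsmul _ _ _ hone
    _ ≤ Fintype.card ι * ∑ i ∈ S, logisticWeight (M i) := by
        rw [nsmul_eq_mul]
        gcongr
        exact Finset.card_le_univ _

end Drift

/-- The gap of two proxies beyond which the larger margin grows more slowly: `2 + 2 K / α` bounds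
the margins of a flow from below, and the weights of the two samples then differ by the factor
`min p (α / β)`. -/
def feedbackGap (α β K p : ℝ) : ℝ :=
  log ((1 + exp (2 + 2 * K / α)) / min p (α / β)) + 1

/-- A bound on the difference of any two margins of a flow. -/
def marginGap (α β K p : ℝ) : ℝ := 13 * feedbackGap α β K p + 13

lemma feedbackGap_nonneg {α β K p : ℝ} (hα : 0 < α) (hβ : 0 < β) (hp : 0 < p) (hp1 : p ≤ 1) :
    0 ≤ feedbackGap α β K p := by
  have hmin : 0 < min p (α / β) := lt_min hp (by positivity)
  have hlog : 0 ≤ log ((1 + exp (2 + 2 * K / α)) / min p (α / β)) := by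
    refine Real.log_nonneg ((one_le_div₀ hmin).2 ?_)
    linarith [Real.exp_pos (2 + 2 * K / α), min_le_left p (α / β)]
  unfold feedbackGap
  linarith

lemma marginGap_nonneg {α β K p : ℝ} (hα : 0 < α) (hβ : 0 < β) (hp : 0 < p) (hp1 : p ≤ 1) :
    0 ≤ marginGap α β K p := by
  unfold marginGap
  linarith [feedbackGap_nonneg (K := K) hα hβ hp hp1]

namespace MarginFlow

variable {ι : Type*} [Fintype ι] {cls s : ι → ℤˣ} {h α β K p : ℝ} {T : ℕ}
  {A : ℕ → ι → ℝ} {P : ℕ → ℤˣ → ℝ} {M : ℕ → ι → ℝ}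

/-- The approximation of the margin of sample `i` at time `t` by its noise and signal parts. -/
def proxy (cls s : ι → ℤˣ) (A : ℕ → ι → ℝ) (P : ℕ → ℤˣ → ℝ) (t : ℕ) (i : ι) : ℝ :=
  A t i + lab (s i) * P t (cls i)

/-- The mean noise part of two samples. If they are the clean and the noisy one of a class, then
the signal cancels and this is the mean of their proxies as well. -/
def pairMean (A : ℕ → ι → ℝ) (i k : ι) (t : ℕ) : ℝ := (A t i + A t k) / 2

omit [Fintype ι] in
lemma proxy_add_proxy {i k : ι} (hc : cls k = cls i) (hs : s k = -s i) (t : ℕ) :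
    proxy cls s A P t i + proxy cls s A P t k = A t i + A t k := by
  simp only [proxy, hc, hs, lab_neg]
  ring

lemma step_bounds (F : MarginFlow cls s h α β K T A P M) :
    β * h ≤ 1 / 4 ∧ h * K ≤ 1 / 8 := by
  have hβ := mul_nonneg F.h_nonneg F.β_pos.le
  have hK := mul_nonneg F.h_nonneg F.K_nonneg
  constructor <;> linarith [F.step_small]

lemma neg_le_signal_step (F : MarginFlow cls s h α β K T A P M) {t : ℕ} (ht : t < T) {c σ : ℤˣ}
    {q : ℝ} (hq : 0 ≤ q) (hd : -q ≤ lab σ * drift cls s (M t) c) :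
    -(h * K * q) ≤ lab σ * (P (t + 1) c - P t c) := by
  have hhK : 0 ≤ h * K := mul_nonneg F.h_nonneg F.K_nonneg
  rcases le_total 0 (lab σ * drift cls s (M t) c) with h0 | h0
  · linarith [(F.signal_step t ht c σ h0).1, mul_nonneg hhK hq]
  · have hneg := (F.signal_step t ht c (-σ) (by rw [lab_neg]; linarith)).2
    rw [lab_neg] at hneg
    linarith [mul_le_mul_of_nonneg_left hd hhK]

lemma noise_mono (F : MarginFlow cls s h α β K T A P M) {t : ℕ} (ht : t < T) (i : ι) :
    A t i ≤ A (t + 1) i := by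
  have hstep : 0 ≤ α * h * logisticWeight (M t i) :=
    mul_nonneg (mul_nonneg F.α_pos.le F.h_nonneg) (logisticWeight_pos _).le
  linarith [F.le_noise_step t ht i]

lemma noise_nonneg (F : MarginFlow cls s h α β K T A P M) {t : ℕ} (ht : t ≤ T) (i : ι) :
    0 ≤ A t i := by
  induction t with
  | zero => rw [F.noise_zero]
  | succ t ih => exact (ih (Nat.le_of_succ_le ht)).trans (F.noise_mono ht i)

lemma noise_step_le_quarter (F : MarginFlow cls s h α β K T A P M) {t : ℕ} (ht : t < T) (i : ι) :
    A (t + 1) i - A t i ≤ 1 / 4 := by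
  have hβh : 0 ≤ β * h := mul_nonneg F.β_pos.le F.h_nonneg
  linarith [F.noise_step_le t ht i, F.step_bounds.1,
    mul_le_of_le_one_right hβh (logisticWeight_le_one (M t i))]

variable [Nonempty ι]

lemma abs_signal_step_le (F : MarginFlow cls s h α β K T A P M) {t : ℕ} (ht : t < T) (c σ : ℤˣ) :
    |lab σ * (P (t + 1) c - P t c)| ≤ 1 / 8 := by
  have hlower : ∀ σ : ℤˣ, -(h * K * 1) ≤ lab σ * (P (t + 1) c - P t c) := fun σ =>
    F.neg_le_signal_step ht zero_le_one
      (neg_le_lab_mul_drift zero_le_one fun k _ _ => logisticWeight_le_one _)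
  have hupper := hlower (-σ)
  rw [lab_neg] at hupper
  rw [abs_le]
  constructor <;> linarith [hlower σ, F.step_bounds.2]

/-- A sample with a very negative proxy has noise growth at rate at least `α / 2`, while the samples
of its class that pull the signal down have exponentially small weight. -/
lemma proxy_mono_of_le (F : MarginFlow cls s h α β K T A P M) {t : ℕ} (ht : t < T) {i : ι}
    (hlow : proxy cls s A P t i ≤ -(1 / 2 + 2 * K / α)) :
    proxy cls s A P t i ≤ proxy cls s A P (t + 1) i := by
  have hα := F.α_pos
  have hh := F.h_nonneg
  have hKα : 0 ≤ 2 * K / α := div_nonneg (mul_nonneg zero_le_two F.K_nonneg) hα.le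
  simp only [proxy] at hlow ⊢
  have hsignal : -(h * K * exp (-(2 * K / α))) ≤
      lab (s i) * (P (t + 1) (cls i) - P t (cls i)) := by
    refine F.neg_le_signal_step ht (Real.exp_pos _).le
      (neg_le_lab_mul_drift (Real.exp_pos _).le fun k hk hs => ?_)
    refine (logisticWeight_le_exp_neg _).trans (Real.exp_le_exp.2 ?_)
    have happrox := (abs_le.1 (F.approx t ht k)).1
    rw [hk, hs, lab_neg] at happrox
    linarith [F.noise_nonneg ht.le k, F.noise_nonneg ht.le i]
  have hnoise : α * h * (1 / 2) ≤ A (t + 1) i - A t i := by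
    refine le_trans ?_ (F.le_noise_step t ht i)
    gcongr
    exact half_le_logisticWeight (by linarith [(abs_le.1 (F.approx t ht i)).2])
  have hrate : K * exp (-(2 * K / α)) ≤ α * (1 / 2) := by
    rw [Real.exp_neg, ← div_eq_mul_inv, div_le_iff₀ (Real.exp_pos _)]
    calc K = α * (1 / 2) * (2 * K / α) := by field_simp
      _ ≤ α * (1 / 2) * exp (2 * K / α) := by
        gcongr
        linarith [Real.add_one_le_exp (2 * K / α)]
  linarith [mul_le_mul_of_nonneg_left hrate hh]

lemma neg_le_proxy (F : MarginFlow cls s h α β K T A P M) {t : ℕ} (ht : t ≤ T) (i : ι) :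
    -(1 / 2 + 2 * K / α + 1) ≤ proxy cls s A P t i := by
  have hKα : 0 ≤ 2 * K / α := div_nonneg (mul_nonneg zero_le_two F.K_nonneg) F.α_pos.le
  suffices -proxy cls s A P t i ≤ (1 / 2 + 2 * K / α) + 1 by linarith
  refine le_add_of_barrier (X := fun t => -proxy cls s A P t i) ?_ (fun t ht => ?_)
    (fun t ht hb => neg_le_neg (F.proxy_mono_of_le ht (le_neg_of_le_neg hb))) ht
  · simp only [proxy, F.noise_zero, F.signal_zero]
    linarith
  · simp only [proxy]
    linarith [F.noise_mono ht i, (abs_le.1 (F.abs_signal_step_le ht (cls i) (s i))).1]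

lemma weight_le_of_gap (F : MarginFlow cls s h α β K T A P M) (hp : 0 < p) {t : ℕ}
    (ht : t < T) {i k : ι}
    (hgap : feedbackGap α β K p ≤ proxy cls s A P t i - proxy cls s A P t k) :
    logisticWeight (M t i) ≤ min p (α / β) * logisticWeight (M t k) := by
  have hlow := F.neg_le_proxy ht.le k
  have hi := abs_le.1 (F.approx t ht i)
  have hk := abs_le.1 (F.approx t ht k)
  have hmin : 0 < min p (α / β) := lt_min hp (div_pos F.α_pos F.β_pos)
  simp only [proxy] at hlow hgap
  have hcomp := logisticWeight_le_of_gap (z := M t i) (w := M t k) (b := 2 + 2 * K / α)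
    (g := feedbackGap α β K p - 1) (by linarith) (by linarith)
  have hfactor : exp (-(feedbackGap α β K p - 1)) * (1 + exp (2 + 2 * K / α)) =
      min p (α / β) := by
    rw [feedbackGap, add_sub_cancel_right, Real.exp_neg, Real.exp_log (by positivity)]
    field_simp
  rwa [hfactor] at hcomp

lemma noise_step_le_of_gap (F : MarginFlow cls s h α β K T A P M) (hp : 0 < p) {t : ℕ}
    (ht : t < T) {i k : ι}
    (hgap : feedbackGap α β K p ≤ proxy cls s A P t i - proxy cls s A P t k) :
    A (t + 1) i - A t i ≤ A (t + 1) k - A t k := by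
  have hβ := F.β_pos
  have hh := F.h_nonneg
  calc A (t + 1) i - A t i ≤ β * h * logisticWeight (M t i) := F.noise_step_le t ht i
    _ ≤ β * h * (α / β * logisticWeight (M t k)) := by
        gcongr
        refine (F.weight_le_of_gap hp ht hgap).trans ?_
        gcongr
        · exact (logisticWeight_pos _).le
        · exact min_le_right _ _
    _ = α * h * logisticWeight (M t k) := by field_simp
    _ ≤ A (t + 1) k - A t k := F.le_noise_step t ht k

lemma feedbackGap_nonneg (F : MarginFlow cls s h α β K T A P M) (hpop : Populated cls s p) :
    0 ≤ feedbackGap α β K p :=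
  LabelNoise.feedbackGap_nonneg F.α_pos F.β_pos hpop.pos hpop.le_one

lemma proxy_sub_le_of_same_kind (F : MarginFlow cls s h α β K T A P M) (hpop : Populated cls s p)
    {t : ℕ} (ht : t ≤ T) {i k : ι} (hc : cls i = cls k) (hs : s i = s k) :
    proxy cls s A P t i - proxy cls s A P t k ≤ feedbackGap α β K p + 1 := by
  have hdiff : ∀ t, proxy cls s A P t i - proxy cls s A P t k = A t i - A t k := fun t => by
    simp [proxy, hc, hs]
  refine le_add_of_barrier (X := fun t => proxy cls s A P t i - proxy cls s A P t k) ?_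
    (fun t ht => ?_) (fun t ht hb => ?_) ht
  · simp only [hdiff, F.noise_zero]
    linarith [F.feedbackGap_nonneg hpop]
  · simp only [hdiff]
    linarith [F.noise_step_le_quarter ht i, F.noise_mono ht k]
  · have hstep := F.noise_step_le_of_gap hpop.pos ht hb
    simp only [hdiff]
    linarith

lemma lab_neg_mul_drift_nonneg_of_gap (F : MarginFlow cls s h α β K T A P M)
    (hpop : Populated cls s p) {t : ℕ} (ht : t < T) {i k : ι} (hc : cls k = cls i)
    (hs : s k = -s i)
    (hgap : 3 * feedbackGap α β K p + 2 ≤ proxy cls s A P t i - proxy cls s A P t k) :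
    0 ≤ lab (-s i) * drift cls s (M t) (cls i) := by
  refine lab_mul_drift_nonneg hpop fun k' i' hk' hsk' hi' hsi' => ?_
  rw [neg_neg] at hsi'
  have hii' := F.proxy_sub_le_of_same_kind hpop ht.le hi'.symm hsi'.symm
  have hkk' := F.proxy_sub_le_of_same_kind hpop ht.le (hk'.trans hc.symm) (hsk'.trans hs.symm)
  exact (F.weight_le_of_gap hpop.pos ht (by linarith)).trans
    (mul_le_mul_of_nonneg_right (min_le_left _ _) (logisticWeight_pos _).le)

lemma proxy_sub_le_of_opposite_kind (F : MarginFlow cls s h α β K T A P M)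
    (hpop : Populated cls s p) {t : ℕ} (ht : t ≤ T) {i k : ι} (hc : cls k = cls i)
    (hs : s k = -s i) :
    proxy cls s A P t i - proxy cls s A P t k ≤ 3 * feedbackGap α β K p + 3 := by
  have hG := F.feedbackGap_nonneg hpop
  have hdiff : ∀ t, proxy cls s A P t i - proxy cls s A P t k =
      A t i - A t k + 2 * (lab (s i) * P t (cls i)) := fun t => by
    simp only [proxy, hc, hs, lab_neg]
    ring
  suffices proxy cls s A P t i - proxy cls s A P t k ≤ (3 * feedbackGap α β K p + 2) + 1 by
    linarith
  refine le_add_of_barrier (X := fun t => proxy cls s A P t i - proxy cls s A P t k) ?_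
    (fun t ht => ?_) (fun t ht hb => ?_) ht
  · simp only [hdiff, F.noise_zero, F.signal_zero]
    linarith
  · simp only [hdiff]
    linarith [F.noise_step_le_quarter ht i, F.noise_mono ht k,
      (abs_le.1 (F.abs_signal_step_le ht (cls i) (s i))).2]
  · have hnoise := F.noise_step_le_of_gap hpop.pos ht (i := i) (k := k) (by linarith)
    have hsignal :=
      (F.signal_step t ht _ _ (F.lab_neg_mul_drift_nonneg_of_gap hpop ht hc hs hb)).1
    rw [lab_neg] at hsignal
    simp only [hdiff]
    linarith

lemma proxy_sub_le_of_same_class (F : MarginFlow cls s h α β K T A P M) (hpop : Populated cls s p)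
    {t : ℕ} (ht : t ≤ T) {i k : ι} (hc : cls i = cls k) :
    proxy cls s A P t i - proxy cls s A P t k ≤ 3 * feedbackGap α β K p + 3 := by
  rcases eq_or_ne (s i) (s k) with hs | hs
  · linarith [F.proxy_sub_le_of_same_kind hpop ht hc hs, F.feedbackGap_nonneg hpop]
  · exact F.proxy_sub_le_of_opposite_kind hpop ht hc.symm (Int.units_ne_iff_eq_neg.1 hs.symm)

/-- Across the classes, one compares the sum of the proxies of a clean and a noisy sample, from
which the signal cancels. -/
theorem proxy_sub_le (F : MarginFlow cls s h α β K T A P M) (hpop : Populated cls s p) {t : ℕ}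
    (ht : t ≤ T) (i k : ι) :
    proxy cls s A P t i - proxy cls s A P t k ≤ marginGap α β K p := by
  have hG := F.feedbackGap_nonneg hpop
  obtain ⟨i', hi, hsi⟩ := hpop.exists_mem (cls i) (-s i)
  obtain ⟨k', hk, hsk⟩ := hpop.exists_mem (cls k) (-s k)
  have hii' := fun t ht => F.proxy_sub_le_of_same_class (t := t) hpop ht hi.symm
  have hi'i := fun t ht => F.proxy_sub_le_of_same_class (t := t) hpop ht hi
  have hkk' := fun t ht => F.proxy_sub_le_of_same_class (t := t) hpop ht hk.symm
  have hk'k := fun t ht => F.proxy_sub_le_of_same_class (t := t) hpop ht hk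
  have hpair : (A t i + A t i') - (A t k + A t k') ≤ (14 * feedbackGap α β K p + 12) + 1 := by
    refine le_add_of_barrier (X := fun t => (A t i + A t i') - (A t k + A t k')) ?_
      (fun t ht => ?_) (fun t ht hb => ?_) ht
    · simp only [F.noise_zero]
      linarith
    · linarith [F.noise_step_le_quarter ht i, F.noise_step_le_quarter ht i', F.noise_mono ht k,
        F.noise_mono ht k']
    · rw [← proxy_add_proxy (P := P) hi hsi, ← proxy_add_proxy (P := P) hk hsk] at hb
      have hik := F.noise_step_le_of_gap hpop.pos ht (i := i) (k := k)
        (by linarith [hi'i t ht.le, hkk' t ht.le])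
      have hi'k' := F.noise_step_le_of_gap hpop.pos ht (i := i') (k := k')
        (by linarith [hii' t ht.le, hk'k t ht.le])
      linarith
  rw [← proxy_add_proxy (P := P) hi hsi, ← proxy_add_proxy (P := P) hk hsk] at hpair
  rw [marginGap]
  linarith [hii' t ht, hk'k t ht]

theorem weight_le (F : MarginFlow cls s h α β K T A P M) (hpop : Populated cls s p) {t : ℕ}
    (ht : t < T) (i k : ι) :
    logisticWeight (M t i) ≤ exp (marginGap α β K p + 1) * logisticWeight (M t k) := by
  have hproxy := F.proxy_sub_le hpop ht.le k i
  have hgap := marginGap_nonneg (K := K) F.α_pos F.β_pos hpop.pos hpop.le_one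
  unfold proxy at hproxy
  exact logisticWeight_le_exp_mul (by linarith)
    (by linarith [(abs_le.1 (F.approx t ht i)).1, (abs_le.1 (F.approx t ht k)).2])

lemma abs_proxy_sub_pairMean_le (F : MarginFlow cls s h α β K T A P M) (hpop : Populated cls s p)
    {t : ℕ} (ht : t ≤ T) {i k : ι} (hc : cls k = cls i) (hs : s k = -s i) (l : ι) :
    |proxy cls s A P t l - pairMean A i k t| ≤ marginGap α β K p := by
  rw [pairMean, ← proxy_add_proxy (P := P) hc hs, abs_le]
  constructor <;> linarith [F.proxy_sub_le hpop ht l i, F.proxy_sub_le hpop ht l k,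
    F.proxy_sub_le hpop ht i l, F.proxy_sub_le hpop ht k l]

lemma abs_margin_sub_pairMean_le (F : MarginFlow cls s h α β K T A P M) (hpop : Populated cls s p)
    {t : ℕ} (ht : t < T) {i k : ι} (hc : cls k = cls i) (hs : s k = -s i) (l : ι) :
    |M t l - pairMean A i k t| ≤ marginGap α β K p + 1 / 2 := by
  calc |M t l - pairMean A i k t|
      ≤ |M t l - proxy cls s A P t l| + |proxy cls s A P t l - pairMean A i k t| :=
        abs_sub_le _ _ _
    _ ≤ 1 / 2 + marginGap α β K p :=
        add_le_add (F.approx t ht l) (F.abs_proxy_sub_pairMean_le hpop ht.le hc hs l)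
    _ = marginGap α β K p + 1 / 2 := add_comm _ _

lemma one_add_mul_le_exp_pairMean (F : MarginFlow cls s h α β K T A P M)
    (hpop : Populated cls s p) {t : ℕ} (ht : t ≤ T) {i k : ι} (hc : cls k = cls i)
    (hs : s k = -s i) :
    1 + α * h / 2 * exp (-(marginGap α β K p + 1 / 2)) * t ≤ exp (pairMean A i k t) := by
  set B := marginGap α β K p
  have hαh : 0 ≤ α * h := mul_nonneg F.α_pos.le F.h_nonneg
  have hB : 0 ≤ B := marginGap_nonneg F.α_pos F.β_pos hpop.pos hpop.le_one
  refine one_add_mul_le_exp_of_step (by simp [pairMean, F.noise_zero]) (fun t ht => ?_) ht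
  have hnonneg : 0 ≤ pairMean A i k t :=
    div_nonneg (add_nonneg (F.noise_nonneg ht.le i) (F.noise_nonneg ht.le k)) zero_le_two
  have hweight : ∀ l, exp (-(pairMean A i k t + (B + 1 / 2))) / 2 ≤ logisticWeight (M t l) := by
    intro l
    have hexp := exp_neg_le_mul_logisticWeight (z := pairMean A i k t + (B + 1 / 2)) (b := 0)
      (by linarith)
    rw [Real.exp_zero] at hexp
    have hanti := logisticWeight_antitone (show M t l ≤ pairMean A i k t + (B + 1 / 2) by
      linarith [(abs_le.1 (F.abs_margin_sub_pairMean_le hpop ht hc hs l)).2])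
    linarith
  have hstep : ∀ l, α * h * (exp (-(pairMean A i k t + (B + 1 / 2))) / 2) ≤
      A (t + 1) l - A t l := fun l =>
    (mul_le_mul_of_nonneg_left (hweight l) hαh).trans (F.le_noise_step t ht l)
  calc α * h / 2 * exp (-(B + 1 / 2)) * exp (-pairMean A i k t)
      = α * h * (exp (-(pairMean A i k t + (B + 1 / 2))) / 2) := by
        rw [neg_add (pairMean A i k t), Real.exp_add (-pairMean A i k t)]
        ring
    _ ≤ pairMean A i k (t + 1) - pairMean A i k t := by
        simp only [pairMean] at hstep ⊢
        linarith [hstep i, hstep k]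

lemma exp_pairMean_le (F : MarginFlow cls s h α β K T A P M) (hpop : Populated cls s p) {t : ℕ}
    (ht : t ≤ T) {i k : ι} (hc : cls k = cls i) (hs : s k = -s i) :
    exp (pairMean A i k t) ≤ 1 + 2 * (β * h * exp (marginGap α β K p + 1 / 2)) * t := by
  set B := marginGap α β K p
  have hβh : 0 ≤ β * h := mul_nonneg F.β_pos.le F.h_nonneg
  refine exp_le_one_add_mul_of_step (by simp [pairMean, F.noise_zero]) (fun t ht => ?_)
    (fun t ht => ?_) (fun t ht => ?_) ht
  · simp only [pairMean]
    linarith [F.noise_mono ht i, F.noise_mono ht k]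
  · simp only [pairMean]
    linarith [F.noise_step_le_quarter ht i, F.noise_step_le_quarter ht k]
  have hstep : ∀ l, A (t + 1) l - A t l ≤ β * h * exp (B + 1 / 2 + -pairMean A i k t) := by
    intro l
    refine (F.noise_step_le t ht l).trans (mul_le_mul_of_nonneg_left ?_ hβh)
    refine (logisticWeight_le_exp_neg _).trans (Real.exp_le_exp.2 ?_)
    linarith [(abs_le.1 (F.abs_margin_sub_pairMean_le hpop ht hc hs l)).1]
  calc pairMean A i k (t + 1) - pairMean A i k t
      ≤ β * h * exp (B + 1 / 2 + -pairMean A i k t) := by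
        simp only [pairMean] at hstep ⊢
        linarith [hstep i, hstep k]
    _ = β * h * exp (B + 1 / 2) * exp (-pairMean A i k t) := by
        rw [Real.exp_add (B + 1 / 2), ← mul_assoc]

theorem mul_le_exp_proxy (F : MarginFlow cls s h α β K T A P M) (hpop : Populated cls s p) {t : ℕ}
    (ht : t ≤ T) (i : ι) :
    α * h / 2 * exp (-(2 * marginGap α β K p + 1 / 2)) * t ≤ exp (proxy cls s A P t i) := by
  set B := marginGap α β K p
  obtain ⟨k, hc, hs⟩ := hpop.exists_mem (cls i) (-s i)
  have hmean := F.one_add_mul_le_exp_pairMean hpop ht hc hs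
  have hclose := (abs_le.1 (F.abs_proxy_sub_pairMean_le hpop ht hc hs i)).1
  calc α * h / 2 * exp (-(2 * B + 1 / 2)) * t
      = exp (-B) * (α * h / 2 * exp (-(B + 1 / 2)) * t) := by
        rw [show -(2 * B + 1 / 2) = -B + -(B + 1 / 2) by ring, Real.exp_add]
        ring
    _ ≤ exp (-B) * exp (pairMean A i k t) := by
        gcongr
        linarith
    _ ≤ exp (proxy cls s A P t i) := by
        rw [← Real.exp_add]
        exact Real.exp_le_exp.2 (by linarith)

theorem noise_le_log (F : MarginFlow cls s h α β K T A P M) (hpop : Populated cls s p) {t : ℕ}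
    (ht : t ≤ T) (i : ι) :
    A t i ≤ 2 * log (1 + 2 * (β * h * exp (marginGap α β K p + 1 / 2)) * t) := by
  obtain ⟨k, hc, hs⟩ := hpop.exists_mem (cls i) (-s i)
  have hexp := F.exp_pairMean_le hpop ht hc hs
  have hlog := (Real.le_log_iff_exp_le ((Real.exp_pos _).trans_le hexp)).2 hexp
  rw [pairMean] at hlog
  linarith [F.noise_nonneg ht k]

end MarginFlow

/-! ### Runs of gradient descent -/

lemma abs_relu_sub_relu_le (z w : ℝ) : |relu z - relu w| ≤ |z - w| := by
  simpa [relu, max_comm] using abs_max_sub_max_le_abs z w 0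

lemma relu_of_nonneg {z : ℝ} (h : 0 ≤ z) : relu z = z := max_eq_right h

lemma relu_of_nonpos {z : ℝ} (h : z ≤ 0) : relu z = 0 := max_eq_left h

lemma reluDeriv_nonneg (z : ℝ) : 0 ≤ reluDeriv z := by unfold reluDeriv; split_ifs <;> norm_num

lemma reluDeriv_le_one (z : ℝ) : reluDeriv z ≤ 1 := by unfold reluDeriv; split_ifs <;> norm_num

lemma abs_reluDeriv_mul_le (z a : ℝ) : |reluDeriv z * a| ≤ |a| := by
  rw [abs_mul, abs_of_nonneg (reluDeriv_nonneg z)]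
  exact mul_le_of_le_one_left (abs_nonneg a) (reluDeriv_le_one z)

lemma lab_mul_net {m d : ℕ} (W : Weights m d) (x : Input d) (j : ℤˣ) :
    lab j * net W x = branch W j x - branch W (-j) x := by
  rcases Int.units_eq_one_or j with rfl | rfl <;> simp [net, lab_neg, lab_one]

lemma logisticLoss_le_exp_neg (f y : ℝ) : logisticLoss f y ≤ exp (-(y * f)) := by
  rw [logisticLoss, mul_comm f y]
  linarith [Real.log_le_sub_one_of_pos (show 0 < 1 + exp (-(y * f)) by positivity)]

/-- The data that determine a run of gradient descent. -/
structure Run (n m d : ℕ) where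
  μ : Patch d
  y : Fin n → ℤˣ
  yt : Fin n → ℤˣ
  pos : Fin n → Bool
  ξ : Fin n → Patch d
  η : ℝ
  W₀ : Weights m d

namespace Run

variable {n m d : ℕ}

/-- The training inputs of a run. -/
def x (R : Run n m d) : Fin n → Input d := trainInput R.μ R.y R.pos R.ξ

/-- The iterates of a run. -/
def W (R : Run n m d) (t : ℕ) : Weights m d := gd R.η R.x R.yt R.W₀ t

/-- The margin with respect to the observed label. -/
def margin (R : Run n m d) (t : ℕ) (i : Fin n) : ℝ := lab (R.yt i) * net (R.W t) (R.x i)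

/-- The sign that tells clean from noisy samples. -/
def clean (R : Run n m d) (i : Fin n) : ℤˣ := R.yt i * R.y i

/-- The signal coefficients, as accumulated along the run. -/
def γ (R : Run n m d) (t : ℕ) (j : ℤˣ) (r : Fin m) : ℝ :=
  ∑ s ∈ Finset.range t, R.η * ‖R.μ‖ ^ 2 / (n * m) * ∑ i, lab (R.clean i) *
    logisticWeight (R.margin s i) * reluDeriv (inner ℝ (R.W s j r) (lab (R.y i) • R.μ))

/-- The noise coefficients, as accumulated along the run. -/
def ρ (R : Run n m d) (t : ℕ) (j : ℤˣ) (r : Fin m) (i : Fin n) : ℝ :=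
  ∑ s ∈ Finset.range t, R.η * ‖R.ξ i‖ ^ 2 / (n * m) * (lab j * lab (R.yt i) *
    logisticWeight (R.margin s i) * reluDeriv (inner ℝ (R.W s j r) (R.ξ i)))

/-- The averaged noise coefficient of a sample for its observed label. -/
def noisePart (R : Run n m d) (t : ℕ) (i : Fin n) : ℝ := 1 / m * ∑ r, R.ρ t (R.yt i) r i

lemma clean_of_eq (R : Run n m d) {i : Fin n} (h : R.yt i = R.y i) : R.clean i = 1 := by
  rw [clean, h, Int.units_mul_self]

lemma yt_eq_neg_of_ne (R : Run n m d) {i : Fin n} (h : R.yt i ≠ R.y i) : R.yt i = -R.y i :=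
  Int.units_ne_iff_eq_neg.1 h

lemma clean_of_ne (R : Run n m d) {i : Fin n} (h : R.yt i ≠ R.y i) : R.clean i = -1 := by
  rw [clean, R.yt_eq_neg_of_ne h, neg_mul, Int.units_mul_self]

lemma branch_x (R : Run n m d) (W : Weights m d) (j : ℤˣ) (i : Fin n) : branch W j (R.x i) =
    1 / m * ∑ r, relu (inner ℝ (W j r) (lab (R.y i) • R.μ)) +
      1 / m * ∑ r, relu (inner ℝ (W j r) (R.ξ i)) := by
  unfold branch x trainInput
  rw [← mul_add, ← Finset.sum_add_distrib]
  split_ifs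
  · rfl
  · simp only [add_comm]

lemma γ_zero (R : Run n m d) (j : ℤˣ) (r : Fin m) : R.γ 0 j r = 0 := by simp [γ]

lemma ρ_zero (R : Run n m d) (j : ℤˣ) (r : Fin m) (i : Fin n) : R.ρ 0 j r i = 0 := by simp [ρ]

lemma noisePart_zero (R : Run n m d) (i : Fin n) : R.noisePart 0 i = 0 := by
  simp [noisePart, ρ_zero]

lemma γ_succ (R : Run n m d) (t : ℕ) (j : ℤˣ) (r : Fin m) : R.γ (t + 1) j r = R.γ t j r +
    R.η * ‖R.μ‖ ^ 2 / (n * m) * ∑ i, lab (R.clean i) *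
    logisticWeight (R.margin t i) * reluDeriv (inner ℝ (R.W t j r) (lab (R.y i) • R.μ)) := by
  simp [γ, Finset.sum_range_succ]

lemma ρ_succ (R : Run n m d) (t : ℕ) (j : ℤˣ) (r : Fin m) (i : Fin n) :
    R.ρ (t + 1) j r i = R.ρ t j r i + R.η * ‖R.ξ i‖ ^ 2 / (n * m) * (lab j * lab (R.yt i) *
    logisticWeight (R.margin t i) * reluDeriv (inner ℝ (R.W t j r) (R.ξ i))) := by
  simp [ρ, Finset.sum_range_succ]

lemma noisePart_succ_sub (R : Run n m d) (t : ℕ) (i : Fin n) :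
    R.noisePart (t + 1) i - R.noisePart t i = R.η * ‖R.ξ i‖ ^ 2 / (n * m) *
      logisticWeight (R.margin t i) *
      (1 / m * ∑ r, reluDeriv (inner ℝ (R.W t (R.yt i) r) (R.ξ i))) := by
  simp only [noisePart, ρ_succ, lab_mul_self, Finset.sum_add_distrib, one_mul, ← Finset.mul_sum]
  ring

lemma W_succ (R : Run n m d) (t : ℕ) (j : ℤˣ) (r : Fin m) : R.W (t + 1) j r = R.W t j r +
    (R.η / (n * m)) • ∑ i, (lab j * lab (R.yt i) * logisticWeight (R.margin t i)) •
      (reluDeriv (inner ℝ (R.W t j r) (lab (R.y i) • R.μ)) • lab (R.y i) • R.μ +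
        reluDeriv (inner ℝ (R.W t j r) (R.ξ i)) • R.ξ i) := by
  have hgd : R.W (t + 1) = gdStep R.η R.x R.yt (R.W t) := by
    simp only [W, gd, Function.iterate_succ_apply']
  have hloss : ∀ i, -(lossDeriv (net (R.W t) (R.x i)) (lab (R.yt i)) * lab j * lab (R.yt i)) =
      lab j * lab (R.yt i) * logisticWeight (R.margin t i) := fun i => by
    rw [lossDeriv, logisticWeight_eq, margin]
    ring
  rw [hgd]
  unfold gdStep gradLoss
  rw [sub_eq_add_neg, ← smul_neg, ← smul_neg, ← Finset.sum_neg_distrib, smul_smul, mul_one_div]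
  congr 2
  refine Finset.sum_congr rfl fun i _ => ?_
  rw [← neg_smul, hloss]
  congr 1
  unfold x trainInput
  split_ifs
  · rfl
  · rw [add_comm]

lemma W_succ_eq_add_increments (R : Run n m d) (hμ : R.μ ≠ 0) (hξ : ∀ i, R.ξ i ≠ 0) (t : ℕ)
    (j : ℤˣ) (r : Fin m) : R.W (t + 1) j r = R.W t j r +
      ((lab j * (R.γ (t + 1) j r - R.γ t j r) * (‖R.μ‖ ^ 2)⁻¹) • R.μ +
        ∑ i, ((R.ρ (t + 1) j r i - R.ρ t j r i) * (‖R.ξ i‖ ^ 2)⁻¹) • R.ξ i) := by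
  have hμ' : ‖R.μ‖ ≠ 0 := norm_ne_zero_iff.2 hμ
  rw [W_succ, Finset.smul_sum, γ_succ, add_sub_cancel_left]
  simp only [ρ_succ, add_sub_cancel_left, smul_add, Finset.sum_add_distrib]
  congr 2
  · simp only [smul_smul, ← Finset.sum_smul]
    congr 1
    simp only [Finset.mul_sum, Finset.sum_mul, clean, lab_mul]
    refine Finset.sum_congr rfl fun i _ => ?_
    field_simp
  · refine Finset.sum_congr rfl fun i _ => ?_
    have hξ' : ‖R.ξ i‖ ≠ 0 := norm_ne_zero_iff.2 (hξ i)
    rw [smul_smul, smul_smul]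
    congr 1
    field_simp

theorem isDecomposition (R : Run n m d) (hμ : R.μ ≠ 0) (hξ : ∀ i, R.ξ i ≠ 0) (t : ℕ) :
    IsDecomposition R.μ R.ξ R.W₀ (R.W t) (R.γ t) (R.ρ t) := by
  intro j r
  induction t with
  | zero => simp [W, gd, γ_zero, ρ_zero]
  | succ t ih =>
    rw [R.W_succ_eq_add_increments hμ hξ, ih]
    simp only [sub_mul, mul_sub, sub_smul, Finset.sum_sub_distrib]
    abel

lemma ρ_label_nonneg (R : Run n m d) (hη : 0 ≤ R.η) (t : ℕ) (r : Fin m) (i : Fin n) :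
    0 ≤ R.ρ t (R.yt i) r i := by
  refine Finset.sum_nonneg fun s _ => ?_
  rw [lab_mul_self, one_mul]
  exact mul_nonneg (by positivity) (mul_nonneg (logisticWeight_pos _).le (reluDeriv_nonneg _))

lemma ρ_neg_label_nonpos (R : Run n m d) (hη : 0 ≤ R.η) (t : ℕ) (r : Fin m) (i : Fin n) :
    R.ρ t (-R.yt i) r i ≤ 0 := by
  refine Finset.sum_nonpos fun s _ => ?_
  rw [lab_neg, neg_mul, lab_mul_self, neg_mul, neg_mul, one_mul, mul_neg, neg_nonpos]
  exact mul_nonneg (by positivity) (mul_nonneg (logisticWeight_pos _).le (reluDeriv_nonneg _))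

lemma avg_rhoBar_eq_noisePart (R : Run n m d) (hη : 0 ≤ R.η) (t : ℕ) (i : Fin n) :
    1 / (m : ℝ) * ∑ r, rhoBar (R.ρ t (R.yt i) r i) = R.noisePart t i := by
  unfold noisePart
  congr 1
  exact Finset.sum_congr rfl fun r _ => if_pos (R.ρ_label_nonneg hη t r i)

lemma trainLoss_le (R : Run n m d) {t : ℕ} {ε : ℝ} (hn : 0 < n)
    (h : ∀ i, exp (-R.margin t i) ≤ ε) : trainLoss R.x R.yt (R.W t) ≤ ε := by
  calc trainLoss R.x R.yt (R.W t) ≤ 1 / (n : ℝ) * ∑ _i : Fin n, ε := by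
        unfold trainLoss
        gcongr
        exact (logisticLoss_le_exp_neg _ _).trans (h _)
    _ = ε := by simp [hn.ne']

end Run

/-! ### Near-orthogonality of the training patches -/

lemma linearIndependent_of_sum_abs_inner_lt {ι E : Type*} [Fintype ι] [DecidableEq ι]
    [NormedAddCommGroup E] [InnerProductSpace ℝ E] (u v : ι → E)
    (h : ∀ k, ∑ i ∈ Finset.univ.erase k, |inner ℝ (u i) (v k)| < |inner ℝ (u k) (v k)|) :
    LinearIndependent ℝ v := by
  have hdet : (Matrix.of fun i k => inner ℝ (u i) (v k)).det ≠ 0 :=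
    det_ne_zero_of_sum_col_lt_diag (by simpa using h)
  refine Fintype.linearIndependent_iff.2 fun g hg =>
    congrFun (Matrix.eq_zero_of_mulVec_eq_zero hdet ?_)
  ext i
  have hinner : inner ℝ (u i) (∑ k, g k • v k) = 0 := by rw [hg, inner_zero_right]
  simpa [inner_sum, real_inner_smul_right, Matrix.mulVec, dotProduct, mul_comm] using hinner

lemma isUniqueDecomposition_of_linearIndependent {n m d : ℕ} {μ : Patch d} {ξ : Fin n → Patch d}
    {W₀ W : Weights m d} {γ : ℤˣ → Fin m → ℝ} {ρ : ℤˣ → Fin m → Fin n → ℝ}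
    (hli : LinearIndependent ℝ (fun o : Option (Fin n) => o.elim μ ξ))
    (h : IsDecomposition μ ξ W₀ W γ ρ) : IsUniqueDecomposition μ ξ W₀ W γ ρ := by
  refine ⟨h, fun γ' ρ' h' => ?_⟩
  have hμ : ‖μ‖ ≠ 0 := norm_ne_zero_iff.2 (hli.ne_zero none)
  have hξ : ∀ i, ‖ξ i‖ ≠ 0 := fun i => norm_ne_zero_iff.2 (hli.ne_zero (some i))
  have hlab : ∀ j, lab j ≠ 0 := fun j => left_ne_zero_of_mul_eq_one (lab_mul_self j)
  have hzero : ∀ j r (o : Option (Fin n)), (o.elim (lab j * (γ' j r - γ j r) * (‖μ‖ ^ 2)⁻¹)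
      fun i => (ρ' j r i - ρ j r i) * (‖ξ i‖ ^ 2)⁻¹) = 0 := fun j r => by
    refine Fintype.linearIndependent_iff.1 hli _ ?_
    have heq := (h' j r).symm.trans (h j r)
    rw [add_assoc, add_assoc, add_right_inj, ← sub_eq_zero] at heq
    simp only [Fintype.sum_option, Option.elim, mul_sub, sub_mul, sub_smul,
      Finset.sum_sub_distrib]
    rw [← heq]
    abel
  constructor
  · ext j r
    simpa [hμ, hlab, sub_eq_zero] using hzero j r none
  · ext j r i
    simpa [hξ, sub_eq_zero] using hzero j r (some i)

lemma abs_avg_sub_avg_le {m : ℕ} (hm : 0 < m) {f g : Fin m → ℝ} {ε : ℝ}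
    (h : ∀ r, |f r - g r| ≤ ε) : |1 / m * ∑ r, f r - 1 / m * ∑ r, g r| ≤ ε := by
  rw [← mul_sub, ← Finset.sum_sub_distrib, abs_mul, abs_of_nonneg (by positivity)]
  calc 1 / (m : ℝ) * |∑ r, (f r - g r)| ≤ 1 / (m : ℝ) * ∑ _r : Fin m, ε := by
        gcongr
        exact (Finset.abs_sum_le_sum_abs _ _).trans (Finset.sum_le_sum fun r _ => h r)
    _ = ε := by simp [hm.ne']

/-- The ReLU shifted by `2 * ε`. It vanishes on `z ≤ 2 * ε`, so it does not move under the small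
steps that start where the sign of a pre-activation `ε`-close to `z` is unknown. -/
def cutoff (ε z : ℝ) : ℝ := relu (z - 2 * ε)

lemma cutoff_of_le {ε z : ℝ} (h : z ≤ 2 * ε) : cutoff ε z = 0 := relu_of_nonpos (by linarith)

lemma abs_relu_sub_cutoff_le {ε u z : ℝ} (h : |u - z| ≤ ε) : |relu u - cutoff ε z| ≤ 3 * ε := by
  refine (abs_relu_sub_relu_le _ _).trans ?_
  have hε := (abs_nonneg _).trans h
  rw [abs_le] at h ⊢
  constructor <;> linarith

lemma le_cutoff_sub_cutoff {ε : ℝ} (hε : 0 ≤ ε) (z : ℝ) :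
    z ≤ cutoff ε z - cutoff ε (-z) + 2 * ε := by
  rcases le_total 0 z with h | h
  · rw [cutoff_of_le (by linarith : -z ≤ 2 * ε), cutoff, relu]
    linarith [le_max_right 0 (z - 2 * ε)]
  · rw [cutoff_of_le (by linarith : z ≤ 2 * ε), cutoff, relu]
    have : max 0 (-z - 2 * ε) ≤ -z := max_le (by linarith) (by linarith)
    linarith

lemma cutoff_add_sub_mem {ε z Δ : ℝ} (hΔ : 0 ≤ Δ) :
    cutoff ε (z + Δ) - cutoff ε z ∈ Set.Icc 0 Δ := by
  have hmono : cutoff ε z ≤ cutoff ε (z + Δ) := max_le_max le_rfl (by linarith)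
  have hlip := abs_le.1 (abs_relu_sub_relu_le (z + Δ - 2 * ε) (z - 2 * ε))
  rw [show z + Δ - 2 * ε - (z - 2 * ε) = Δ by ring, abs_of_nonneg hΔ] at hlip
  exact ⟨sub_nonneg.2 hmono, hlip.2⟩

lemma cutoff_step {ε z z' Δ : ℝ} {σ : ℤˣ} (hz : ε < z → z' = z + Δ) (hstep : |z' - z| ≤ ε)
    (hΔ : 0 ≤ lab σ * Δ) : lab σ * (cutoff ε z' - cutoff ε z) ∈ Set.Icc 0 (lab σ * Δ) := by
  rcases le_or_gt z ε with h | h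
  · have hz' := (abs_le.1 hstep).2
    have hε := (abs_nonneg _).trans hstep
    rw [cutoff_of_le (by linarith : z ≤ 2 * ε), cutoff_of_le (by linarith : z' ≤ 2 * ε), sub_zero,
      mul_zero]
    exact ⟨le_rfl, hΔ⟩
  · rw [hz h]
    rcases Int.units_eq_one_or σ with rfl | rfl
    · rw [lab_one, one_mul] at hΔ ⊢
      rw [one_mul]
      exact cutoff_add_sub_mem hΔ
    · rw [lab_neg, lab_one, neg_one_mul] at hΔ ⊢
      have hmem := cutoff_add_sub_mem (ε := ε) (z := z + Δ) hΔ
      rwa [add_neg_cancel_right, ← neg_sub, ← neg_one_mul (cutoff _ _ - _)] at hmem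

namespace Run

variable {n m d : ℕ}

/-- The contribution of the signal patch of class `c` to the margins of the clean samples of this
class, up to a small error. -/
def signalPart (R : Run n m d) (ε : ℝ) (t : ℕ) (c : ℤˣ) : ℝ :=
  1 / m * ∑ r, (cutoff ε (R.γ t c r) - cutoff ε (-R.γ t (-c) r))

/-- The error made when a pre-activation is replaced by its signal or noise coefficient. -/
def patchError (ν c₁ : ℝ) : ℝ := ν * (3 + 1 / c₁)

/-- The properties of the training noise and of the initialization that drive the analysis: `D`
is the scale `σξ² d` of the squared noise norms, `Λ` the bound that the coefficients must not
exceed for the cross terms to be negligible, and `ν` the size of the negligible terms. -/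
structure Regular (R : Run n m d) (D ν Λ c₁ c₂ : ℝ) : Prop where
  n_pos : 0 < n
  m_pos : 0 < m
  η_pos : 0 < R.η
  D_pos : 0 < D
  ν_nonneg : 0 ≤ ν
  Λ_ge : 1 ≤ Λ
  c₁_pos : 0 < c₁
  patchError_le : patchError ν c₁ ≤ 1 / 16
  signal_lower : c₁ * D ≤ n * ‖R.μ‖ ^ 2
  signal_upper : n * ‖R.μ‖ ^ 2 ≤ c₂ * D
  noise_lower : ∀ i, D / 2 ≤ ‖R.ξ i‖ ^ 2
  noise_upper : ∀ i, ‖R.ξ i‖ ^ 2 ≤ 2 * D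
  noise_noise : ∀ i k, i ≠ k → |inner ℝ (R.ξ i) (R.ξ k)| ≤ ν * D / (n * Λ)
  signal_noise : ∀ i, |inner ℝ R.μ (R.ξ i)| ≤ ν * D / (n * Λ)
  init_noise : ∀ j r i, |inner ℝ (R.W₀ j r) (R.ξ i)| ≤ ν
  init_signal : ∀ j r, |inner ℝ (R.W₀ j r) R.μ| ≤ ν
  active : ∀ i, (m : ℝ) / 4 ≤
    ({r | 0 ≤ inner ℝ (R.W₀ (R.yt i) r) (R.ξ i)} : Finset (Fin m)).card

namespace Regular

variable {R : Run n m d} {D ν Λ c₁ c₂ : ℝ}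

lemma n_pos' (H : R.Regular D ν Λ c₁ c₂) : (0 : ℝ) < n := Nat.cast_pos.2 H.n_pos

lemma m_pos' (H : R.Regular D ν Λ c₁ c₂) : (0 : ℝ) < m := Nat.cast_pos.2 H.m_pos

lemma ν_div_nonneg (H : R.Regular D ν Λ c₁ c₂) : 0 ≤ ν * (1 / c₁) :=
  mul_nonneg H.ν_nonneg (one_div_nonneg.2 H.c₁_pos.le)

lemma ν_le_patchError (H : R.Regular D ν Λ c₁ c₂) : ν ≤ patchError ν c₁ := by
  unfold patchError
  linarith [H.ν_div_nonneg, H.ν_nonneg]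

lemma patchError_nonneg (H : R.Regular D ν Λ c₁ c₂) : 0 ≤ patchError ν c₁ :=
  H.ν_nonneg.trans H.ν_le_patchError

lemma norm_μ_sq_pos (H : R.Regular D ν Λ c₁ c₂) : 0 < ‖R.μ‖ ^ 2 :=
  pos_of_mul_pos_right ((mul_pos H.c₁_pos H.D_pos).trans_le H.signal_lower) H.n_pos'.le

lemma norm_ξ_sq_pos (H : R.Regular D ν Λ c₁ c₂) (i : Fin n) : 0 < ‖R.ξ i‖ ^ 2 :=
  (half_pos H.D_pos).trans_le (H.noise_lower i)

lemma c₂_pos (H : R.Regular D ν Λ c₁ c₂) : 0 < c₂ :=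
  pos_of_mul_pos_left ((mul_pos H.c₁_pos H.D_pos).trans_le (H.signal_lower.trans H.signal_upper))
    H.D_pos.le

lemma inv_norm_μ_sq_le (H : R.Regular D ν Λ c₁ c₂) : (‖R.μ‖ ^ 2)⁻¹ ≤ n / (c₁ * D) := by
  rw [inv_le_comm₀ H.norm_μ_sq_pos (div_pos H.n_pos' (mul_pos H.c₁_pos H.D_pos)), inv_div,
    div_le_iff₀' H.n_pos']
  exact H.signal_lower

lemma inv_norm_ξ_sq_le (H : R.Regular D ν Λ c₁ c₂) (i : Fin n) : (‖R.ξ i‖ ^ 2)⁻¹ ≤ 2 / D := by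
  rw [inv_le_comm₀ (H.norm_ξ_sq_pos i) (div_pos two_pos H.D_pos), inv_div]
  exact H.noise_lower i

lemma crossBound_le (H : R.Regular D ν Λ c₁ c₂) : ν * D / (n * Λ) ≤ ν * D / n :=
  div_le_div_of_nonneg_left (mul_nonneg H.ν_nonneg H.D_pos.le) H.n_pos'
    (le_mul_of_one_le_right H.n_pos'.le H.Λ_ge)

lemma isDecomposition (H : R.Regular D ν Λ c₁ c₂) (t : ℕ) :
    IsDecomposition R.μ R.ξ R.W₀ (R.W t) (R.γ t) (R.ρ t) :=
  R.isDecomposition (fun h => by simpa [h] using H.norm_μ_sq_pos)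
    (fun i h => by simpa [h] using H.norm_ξ_sq_pos i) t

lemma sum_erase_abs_inner_le (H : R.Regular D ν Λ c₁ c₂) (k : Fin n) :
    ∑ i ∈ Finset.univ.erase k, |inner ℝ (R.ξ i) (R.ξ k)| ≤ ν * D := by
  have hD := mul_nonneg H.ν_nonneg H.D_pos.le
  have hn := H.n_pos'
  calc ∑ i ∈ Finset.univ.erase k, |inner ℝ (R.ξ i) (R.ξ k)|
      ≤ ∑ _i ∈ Finset.univ.erase k, ν * D / n := Finset.sum_le_sum fun i hi =>
        (H.noise_noise i k (Finset.ne_of_mem_erase hi)).trans H.crossBound_le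
    _ ≤ ∑ _i : Fin n, ν * D / n :=
        Finset.sum_le_univ_sum_of_nonneg fun _ => by positivity
    _ = ν * D := by simp [mul_div_cancel₀ _ hn.ne']

lemma sum_abs_inner_signal_le (H : R.Regular D ν Λ c₁ c₂) :
    ∑ i, |inner ℝ (R.ξ i) R.μ| ≤ ν * D := by
  calc ∑ i, |inner ℝ (R.ξ i) R.μ| ≤ ∑ _i : Fin n, ν * D / n := Finset.sum_le_sum fun i _ => by
        rw [real_inner_comm]
        exact (H.signal_noise i).trans H.crossBound_le
    _ = ν * D := by simp [mul_div_cancel₀ _ H.n_pos'.ne']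

/-- The Gram matrix is diagonally dominant once the row of `μ` is multiplied by `n`, as
`n ‖μ‖²` is of the order of `‖ξ i‖²`. -/
lemma linearIndependent (H : R.Regular D ν Λ c₁ c₂) :
    LinearIndependent ℝ (fun o : Option (Fin n) => o.elim R.μ R.ξ) := by
  have hn := H.n_pos'
  have hD := H.D_pos
  have hsmall := H.patchError_le
  have hνc := H.ν_div_nonneg
  rw [patchError] at hsmall
  refine linearIndependent_of_sum_abs_inner_lt (fun o => o.elim ((n : ℝ) • R.μ) R.ξ) _ ?_
  rintro (_ | k)
  · have hν : ν < c₁ := by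
      have := (mul_one_div ν c₁) ▸ (by linarith [H.ν_nonneg] : ν * (1 / c₁) < 1)
      exact (div_lt_one H.c₁_pos).1 this
    rw [show Finset.univ.erase (none : Option (Fin n)) = Finset.univ.map Function.Embedding.some by
      ext o; cases o <;> simp, Finset.sum_map]
    calc ∑ i, |inner ℝ (R.ξ i) R.μ| ≤ ν * D := H.sum_abs_inner_signal_le
      _ < c₁ * D := by gcongr
      _ ≤ n * ‖R.μ‖ ^ 2 := H.signal_lower
      _ = |inner ℝ ((n : ℝ) • R.μ) R.μ| := by
        rw [real_inner_smul_left, real_inner_self_eq_norm_sq, abs_of_nonneg (by positivity)]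
  · rw [show Finset.univ.erase (some k) =
        insert none ((Finset.univ.erase k).map Function.Embedding.some) by
      ext o; cases o <;> simp, Finset.sum_insert (by simp), Finset.sum_map]
    have hsignal : |inner ℝ ((n : ℝ) • R.μ) (R.ξ k)| ≤ ν * D := by
      rw [real_inner_smul_left, abs_mul, abs_of_pos hn, ← le_div_iff₀' hn]
      exact (H.signal_noise k).trans H.crossBound_le
    calc |inner ℝ ((n : ℝ) • R.μ) (R.ξ k)| + ∑ i ∈ Finset.univ.erase k, |inner ℝ (R.ξ i) (R.ξ k)|
        ≤ ν * D + ν * D := add_le_add hsignal (H.sum_erase_abs_inner_le k)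
      _ < D / 2 := by
        have : ν * D ≤ 1 / 16 * D := by
          gcongr
          linarith [H.ν_nonneg]
        linarith
      _ ≤ ‖R.ξ k‖ ^ 2 := H.noise_lower k
      _ = |inner ℝ (R.ξ k) (R.ξ k)| := by
        rw [real_inner_self_eq_norm_sq, abs_of_nonneg (by positivity)]

theorem isUniqueDecomposition (H : R.Regular D ν Λ c₁ c₂) (t : ℕ) :
    IsUniqueDecomposition R.μ R.ξ R.W₀ (R.W t) (R.γ t) (R.ρ t) :=
  isUniqueDecomposition_of_linearIndependent H.linearIndependent (H.isDecomposition t)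

end Regular
end Run

/-! ### Margins of a regular run -/

namespace Run

variable {n m d : ℕ}

/-- The state at time `t` in which the increments of the coefficients are understood: the
coefficients are bounded and the neurons that were initially active on a sample still are. -/
structure Controlled (R : Run n m d) (Λ : ℝ) (t : ℕ) : Prop where
  abs_γ_le : ∀ j r, |R.γ t j r| ≤ Λ
  abs_ρ_le : ∀ j r i, |R.ρ t j r i| ≤ Λ
  active : ∀ i r, 0 ≤ inner ℝ (R.W₀ (R.yt i) r) (R.ξ i) →
    0 ≤ inner ℝ (R.W t (R.yt i) r) (R.ξ i)

namespace Regular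

variable {R : Run n m d} {D ν Λ c₁ c₂ : ℝ}

lemma inner_W (H : R.Regular D ν Λ c₁ c₂) (t : ℕ) (j : ℤˣ) (r : Fin m) (v : Patch d) :
    inner ℝ (R.W t j r) v = inner ℝ (R.W₀ j r) v +
      lab j * R.γ t j r * (‖R.μ‖ ^ 2)⁻¹ * inner ℝ R.μ v +
      ∑ k, R.ρ t j r k * (‖R.ξ k‖ ^ 2)⁻¹ * inner ℝ (R.ξ k) v := by
  rw [H.isDecomposition t j r, inner_add_left, inner_add_left, real_inner_smul_left, sum_inner]
  simp only [real_inner_smul_left]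

lemma abs_sum_cross_le (H : R.Regular D ν Λ c₁ c₂) {b : Fin n → ℝ} (hb : ∀ k, |b k| ≤ Λ)
    {v : Patch d} (s : Finset (Fin n))
    (hv : ∀ k ∈ s, |inner ℝ (R.ξ k) v| ≤ ν * D / (n * Λ)) :
    |∑ k ∈ s, b k * (‖R.ξ k‖ ^ 2)⁻¹ * inner ℝ (R.ξ k) v| ≤ 2 * ν := by
  have hn := H.n_pos'
  have hD := H.D_pos
  have hν := H.ν_nonneg
  have hΛ := one_pos.trans_le H.Λ_ge
  calc |∑ k ∈ s, b k * (‖R.ξ k‖ ^ 2)⁻¹ * inner ℝ (R.ξ k) v|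
      ≤ ∑ k ∈ s, |b k| * (‖R.ξ k‖ ^ 2)⁻¹ * |inner ℝ (R.ξ k) v| :=
        (Finset.abs_sum_le_sum_abs _ _).trans_eq <| Finset.sum_congr rfl fun k _ => by
          rw [abs_mul, abs_mul, abs_of_pos (inv_pos.2 (H.norm_ξ_sq_pos k))]
    _ ≤ ∑ _k ∈ s, Λ * (2 / D) * (ν * D / (n * Λ)) := by
        gcongr with k hk
        exacts [hb k, H.inv_norm_ξ_sq_le k, hv k hk]
    _ ≤ ∑ _k : Fin n, Λ * (2 / D) * (ν * D / (n * Λ)) :=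
        Finset.sum_le_univ_sum_of_nonneg fun _ => by positivity
    _ = 2 * ν := by
        rw [Finset.sum_const, Finset.card_univ, Fintype.card_fin, nsmul_eq_mul]
        field_simp

lemma abs_inner_noise_sub_le (H : R.Regular D ν Λ c₁ c₂) {t : ℕ} (hC : R.Controlled Λ t)
    (j : ℤˣ) (r : Fin m) (i : Fin n) :
    |inner ℝ (R.W t j r) (R.ξ i) - R.ρ t j r i| ≤ patchError ν c₁ := by
  have hn := H.n_pos'
  have hD := H.D_pos
  have hc := H.c₁_pos
  have hΛ := one_pos.trans_le H.Λ_ge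
  have hinit := H.init_noise j r i
  have hsignal : |lab j * R.γ t j r * (‖R.μ‖ ^ 2)⁻¹ * inner ℝ R.μ (R.ξ i)| ≤ ν * (1 / c₁) := by
    rw [abs_mul, abs_mul, abs_mul, abs_lab, one_mul, abs_of_pos (inv_pos.2 H.norm_μ_sq_pos)]
    calc |R.γ t j r| * (‖R.μ‖ ^ 2)⁻¹ * |inner ℝ R.μ (R.ξ i)|
        ≤ Λ * (n / (c₁ * D)) * (ν * D / (n * Λ)) := by
          gcongr
          exacts [hC.abs_γ_le j r, H.inv_norm_μ_sq_le, H.signal_noise i]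
      _ = ν * (1 / c₁) := by field_simp
  have hcross := H.abs_sum_cross_le (hC.abs_ρ_le j r) (Finset.univ.erase i)
    fun k hk => H.noise_noise k i (Finset.ne_of_mem_erase hk)
  rw [H.inner_W, ← Finset.add_sum_erase _ _ (Finset.mem_univ i), real_inner_self_eq_norm_sq,
    inv_mul_cancel_right₀ (H.norm_ξ_sq_pos i).ne', patchError]
  rw [abs_le] at hinit hsignal hcross ⊢
  constructor <;> linarith

lemma abs_inner_signal_sub_le (H : R.Regular D ν Λ c₁ c₂) {t : ℕ} (hC : R.Controlled Λ t)
    (j : ℤˣ) (r : Fin m) :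
    |inner ℝ (R.W t j r) (lab j • R.μ) - R.γ t j r| ≤ patchError ν c₁ := by
  have hinner : inner ℝ (R.W t j r) (lab j • R.μ) - R.γ t j r = lab j * (inner ℝ (R.W₀ j r) R.μ +
      ∑ k, R.ρ t j r k * (‖R.ξ k‖ ^ 2)⁻¹ * inner ℝ (R.ξ k) R.μ) := by
    rw [real_inner_smul_right, H.inner_W, real_inner_self_eq_norm_sq,
      inv_mul_cancel_right₀ H.norm_μ_sq_pos.ne']
    linear_combination R.γ t j r * lab_mul_self j
  have hcross := H.abs_sum_cross_le (hC.abs_ρ_le j r) Finset.univ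
    fun k _ => real_inner_comm R.μ (R.ξ k) ▸ H.signal_noise k
  rw [hinner, abs_mul, abs_lab, one_mul, patchError]
  refine (abs_add_le _ _).trans ?_
  linarith [H.init_signal j r, H.ν_div_nonneg]

lemma abs_inner_signal_add_le (H : R.Regular D ν Λ c₁ c₂) {t : ℕ} (hC : R.Controlled Λ t)
    (c : ℤˣ) (r : Fin m) :
    |inner ℝ (R.W t (-c) r) (lab c • R.μ) - -R.γ t (-c) r| ≤ patchError ν c₁ := by
  have hsub := H.abs_inner_signal_sub_le hC (-c) r
  rwa [lab_neg, neg_smul, inner_neg_right, ← neg_add', abs_neg, ← sub_neg_eq_add] at hsub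

lemma abs_noise_response_sub_le (H : R.Regular D ν Λ c₁ c₂) {t : ℕ} (hC : R.Controlled Λ t)
    (i : Fin n) :
    |1 / m * ∑ r, relu (inner ℝ (R.W t (R.yt i) r) (R.ξ i)) - R.noisePart t i| ≤
      patchError ν c₁ :=
  abs_avg_sub_avg_le H.m_pos fun r => by
    have hlip := abs_relu_sub_relu_le (inner ℝ (R.W t (R.yt i) r) (R.ξ i)) (R.ρ t (R.yt i) r i)
    rw [relu_of_nonneg (R.ρ_label_nonneg H.η_pos.le t r i)] at hlip
    exact hlip.trans (H.abs_inner_noise_sub_le hC _ r i)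

lemma abs_noise_response_neg_le (H : R.Regular D ν Λ c₁ c₂) {t : ℕ} (hC : R.Controlled Λ t)
    (i : Fin n) :
    |1 / m * ∑ r, relu (inner ℝ (R.W t (-R.yt i) r) (R.ξ i))| ≤ patchError ν c₁ := by
  have hzero : ∀ r, |relu (inner ℝ (R.W t (-R.yt i) r) (R.ξ i)) - 0| ≤ patchError ν c₁ :=
      fun r => by
    have hlip := abs_relu_sub_relu_le (inner ℝ (R.W t (-R.yt i) r) (R.ξ i))
      (R.ρ t (-R.yt i) r i)
    rw [relu_of_nonpos (R.ρ_neg_label_nonpos H.η_pos.le t r i)] at hlip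
    exact hlip.trans (H.abs_inner_noise_sub_le hC _ r i)
  simpa using abs_avg_sub_avg_le H.m_pos hzero

lemma abs_signal_response_sub_le (H : R.Regular D ν Λ c₁ c₂) {t : ℕ} (hC : R.Controlled Λ t)
    (c : ℤˣ) :
    |(1 / m * ∑ r, relu (inner ℝ (R.W t c r) (lab c • R.μ)) -
      1 / m * ∑ r, relu (inner ℝ (R.W t (-c) r) (lab c • R.μ))) -
        R.signalPart (patchError ν c₁) t c| ≤ 6 * patchError ν c₁ := by
  have hpos := abs_avg_sub_avg_le H.m_pos fun r =>
    abs_relu_sub_cutoff_le (H.abs_inner_signal_sub_le hC c r)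
  have hneg := abs_avg_sub_avg_le H.m_pos fun r =>
    abs_relu_sub_cutoff_le (H.abs_inner_signal_add_le hC c r)
  rw [signalPart, Finset.sum_sub_distrib, mul_sub]
  rw [abs_le] at hpos hneg ⊢
  constructor <;> linarith

theorem abs_margin_sub_le (H : R.Regular D ν Λ c₁ c₂) {t : ℕ} (hC : R.Controlled Λ t)
    (i : Fin n) :
    |R.margin t i - (R.noisePart t i +
      lab (R.clean i) * R.signalPart (patchError ν c₁) t (R.y i))| ≤ 8 * patchError ν c₁ := by
  have hsignal := H.abs_signal_response_sub_le hC (R.y i)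
  have hnoise := H.abs_noise_response_sub_le hC i
  have hnoise' := H.abs_noise_response_neg_le hC i
  rw [margin, lab_mul_net, branch_x, branch_x]
  rw [abs_le] at hsignal hnoise hnoise' ⊢
  rcases eq_or_ne (R.yt i) (R.y i) with h | h
  · rw [R.clean_of_eq h, lab_one, one_mul]
    rw [h] at hnoise hnoise' ⊢
    constructor <;> linarith
  · rw [R.clean_of_ne h, lab_neg, lab_one, neg_one_mul]
    rw [R.yt_eq_neg_of_ne h] at hnoise hnoise' ⊢
    rw [neg_neg] at hnoise' ⊢
    constructor <;> linarith

end Regular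
end Run

/-! ### The dynamics of a regular run -/

lemma abs_le_mul_of_abs_step_le {a b : ℕ → ℝ} {C : ℝ} (ha : a 0 = 0) (hb : b 0 = 0) {t : ℕ}
    (h : ∀ s < t, |a (s + 1) - a s| ≤ C * (b (s + 1) - b s)) : |a t| ≤ C * b t := by
  induction t with
  | zero => simp [ha, hb]
  | succ t ih =>
    have hstep := h t t.lt_succ_self
    have hprev := ih fun s hs => h s (hs.trans t.lt_succ_self)
    linarith [abs_sub_abs_le_abs_sub (a (t + 1)) (a t)]

namespace Run

variable {n m d : ℕ}

/-- The effective step size of the noise coefficients. -/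
def rate (R : Run n m d) (D : ℝ) : ℝ := R.η * D / (n * m)

lemma γ_succ_sub_of_active (R : Run n m d) (hn : 0 < n) {t : ℕ} {j σ : ℤˣ} {r : Fin m}
    (h : 0 < lab σ * inner ℝ (R.W t j r) (lab j • R.μ)) :
    R.γ (t + 1) j r - R.γ t j r =
      R.η * ‖R.μ‖ ^ 2 / m * drift R.y R.clean (R.margin t) (σ * j) := by
  have hn' : (0 : ℝ) < n := Nat.cast_pos.2 hn
  have hterm : ∀ i, lab (R.clean i) * logisticWeight (R.margin t i) *
      reluDeriv (inner ℝ (R.W t j r) (lab (R.y i) • R.μ)) =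
      if R.y i = σ * j then lab (R.clean i) * logisticWeight (R.margin t i) else 0 := fun i => by
    rw [real_inner_smul_right, ← mul_assoc, ← lab_mul] at h
    rw [real_inner_smul_right]
    split_ifs with hi
    · rw [hi, reluDeriv, if_pos h.le, mul_one]
    · rw [Int.units_ne_iff_eq_neg.1 hi, lab_neg, reluDeriv, if_neg (by linarith), mul_zero]
  rw [γ_succ, add_sub_cancel_left, drift, Finset.sum_filter, Fintype.card_fin]
  simp only [hterm]
  field_simp

/-- The part of sample `k` in the growth of the pre-activation of neuron `(yt i, r)` on `ξ i`. -/
def interaction (R : Run n m d) (t : ℕ) (r : Fin m) (i k : Fin n) : ℝ :=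
  lab (R.yt i) * lab (R.yt k) * logisticWeight (R.margin t k) *
    (reluDeriv (inner ℝ (R.W t (R.yt i) r) (lab (R.y k) • R.μ)) *
      (lab (R.y k) * inner ℝ R.μ (R.ξ i)) +
      reluDeriv (inner ℝ (R.W t (R.yt i) r) (R.ξ k)) * inner ℝ (R.ξ k) (R.ξ i))

lemma inner_W_succ_noise (R : Run n m d) (t : ℕ) (r : Fin m) (i : Fin n) :
    inner ℝ (R.W (t + 1) (R.yt i) r) (R.ξ i) = inner ℝ (R.W t (R.yt i) r) (R.ξ i) +
      R.η / (n * m) * ∑ k, R.interaction t r i k := by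
  rw [W_succ, inner_add_left, real_inner_smul_left, sum_inner]
  simp only [real_inner_smul_left, inner_add_left, interaction]

namespace Regular

variable {R : Run n m d} {D ν Λ c₁ c₂ : ℝ}

lemma rate_pos (H : R.Regular D ν Λ c₁ c₂) : 0 < R.rate D :=
  div_pos (mul_pos H.η_pos H.D_pos) (mul_pos H.n_pos' H.m_pos')

lemma signal_rate_le (H : R.Regular D ν Λ c₁ c₂) : R.η * ‖R.μ‖ ^ 2 / m ≤ R.rate D * c₂ := by
  have hn := H.n_pos'
  have hm := H.m_pos'
  have hη := H.η_pos
  calc R.η * ‖R.μ‖ ^ 2 / m = R.η / (n * m) * (n * ‖R.μ‖ ^ 2) := by field_simp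
    _ ≤ R.η / (n * m) * (c₂ * D) := mul_le_mul_of_nonneg_left H.signal_upper (by positivity)
    _ = R.rate D * c₂ := by unfold rate; ring

lemma abs_γ_step_le (H : R.Regular D ν Λ c₁ c₂) {t : ℕ} {q : ℝ}
    (hq : ∀ i, logisticWeight (R.margin t i) ≤ q) (j : ℤˣ) (r : Fin m) :
    |R.γ (t + 1) j r - R.γ t j r| ≤ R.rate D * c₂ * q := by
  have hn := H.n_pos'
  have hm := H.m_pos'
  have hη := H.η_pos
  have hq0 : 0 ≤ q := (logisticWeight_pos _).le.trans (hq ⟨0, H.n_pos⟩)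
  rw [γ_succ, add_sub_cancel_left, abs_mul, abs_of_nonneg (by positivity)]
  calc R.η * ‖R.μ‖ ^ 2 / (n * m) * |∑ i, lab (R.clean i) * logisticWeight (R.margin t i) *
        reluDeriv (inner ℝ (R.W t j r) (lab (R.y i) • R.μ))|
      ≤ R.η * ‖R.μ‖ ^ 2 / (n * m) * ∑ _i : Fin n, q := by
        gcongr
        refine (Finset.abs_sum_le_sum_abs _ _).trans (Finset.sum_le_sum fun i _ => ?_)
        rw [mul_comm _ (reluDeriv _)]
        refine (abs_reluDeriv_mul_le _ _).trans ?_
        rw [abs_mul, abs_lab, one_mul, abs_of_pos (logisticWeight_pos _)]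
        exact hq i
    _ = R.η * ‖R.μ‖ ^ 2 / m * q := by
        rw [Finset.sum_const, Finset.card_univ, Fintype.card_fin, nsmul_eq_mul]
        field_simp
    _ ≤ R.rate D * c₂ * q := by gcongr; exact H.signal_rate_le

lemma noise_rate_mem (H : R.Regular D ν Λ c₁ c₂) (i : Fin n) :
    R.η * ‖R.ξ i‖ ^ 2 / (n * m) ∈ Set.Icc (R.rate D / 2) (2 * R.rate D) := by
  have hη := H.η_pos
  constructor
  · calc R.rate D / 2 = R.η * (D / 2) / (n * m) := by unfold rate; ring
      _ ≤ R.η * ‖R.ξ i‖ ^ 2 / (n * m) := by gcongr; exact H.noise_lower i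
  · calc R.η * ‖R.ξ i‖ ^ 2 / (n * m) ≤ R.η * (2 * D) / (n * m) := by
          gcongr
          exact H.noise_upper i
      _ = 2 * R.rate D := by unfold rate; ring

lemma abs_ρ_step_le (H : R.Regular D ν Λ c₁ c₂) (t : ℕ) (j : ℤˣ) (r : Fin m) (i : Fin n) :
    |R.ρ (t + 1) j r i - R.ρ t j r i| ≤ 2 * R.rate D * logisticWeight (R.margin t i) := by
  have hη := H.η_pos
  rw [ρ_succ, add_sub_cancel_left, abs_mul, abs_of_nonneg (by positivity)]
  gcongr
  · linarith [H.rate_pos]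
  · exact (H.noise_rate_mem i).2
  · rw [mul_comm _ (reluDeriv _)]
    refine (abs_reluDeriv_mul_le _ _).trans_eq ?_
    rw [abs_mul, abs_mul, abs_lab, abs_lab, one_mul, one_mul, abs_of_pos (logisticWeight_pos _)]

lemma active_fraction_mem (H : R.Regular D ν Λ c₁ c₂) {t : ℕ} (hC : R.Controlled Λ t)
    (i : Fin n) :
    1 / m * ∑ r, reluDeriv (inner ℝ (R.W t (R.yt i) r) (R.ξ i)) ∈ Set.Icc (1 / 4 : ℝ) 1 := by
  have hm := H.m_pos'
  rw [one_div_mul_eq_div]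
  constructor
  · have hcard : (({r | 0 ≤ inner ℝ (R.W₀ (R.yt i) r) (R.ξ i)} : Finset (Fin m)).card : ℝ) ≤
        ∑ r, reluDeriv (inner ℝ (R.W t (R.yt i) r) (R.ξ i)) := by
      rw [Finset.card_filter, Nat.cast_sum]
      refine Finset.sum_le_sum fun r _ => ?_
      split_ifs with h
      · rw [reluDeriv, if_pos (hC.active i r h), Nat.cast_one]
      · exact Nat.cast_zero.trans_le (reluDeriv_nonneg _)
    rw [le_div_iff₀ hm]
    linarith [H.active i]
  · rw [div_le_one hm]
    exact (Finset.sum_le_sum fun r _ => reluDeriv_le_one _).trans_eq (by simp)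

lemma noisePart_step_mem (H : R.Regular D ν Λ c₁ c₂) {t : ℕ} (hC : R.Controlled Λ t)
    (i : Fin n) :
    R.noisePart (t + 1) i - R.noisePart t i ∈ Set.Icc
      (1 / 8 * R.rate D * logisticWeight (R.margin t i))
      (2 * R.rate D * logisticWeight (R.margin t i)) := by
  have hh := H.rate_pos
  have hη := H.η_pos
  have hw := logisticWeight_pos (R.margin t i)
  obtain ⟨hlow, hup⟩ := H.active_fraction_mem hC i
  obtain ⟨hrlow, hrup⟩ := H.noise_rate_mem i
  rw [noisePart_succ_sub]
  constructor
  · calc 1 / 8 * R.rate D * logisticWeight (R.margin t i)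
        = R.rate D / 2 * logisticWeight (R.margin t i) * (1 / 4) := by ring
      _ ≤ _ := by gcongr
  · calc R.η * ‖R.ξ i‖ ^ 2 / (n * m) * logisticWeight (R.margin t i) *
          (1 / m * ∑ r, reluDeriv (inner ℝ (R.W t (R.yt i) r) (R.ξ i)))
        ≤ 2 * R.rate D * logisticWeight (R.margin t i) * 1 := by gcongr
      _ = _ := mul_one _

lemma abs_γ_step_le_patchError (H : R.Regular D ν Λ c₁ c₂)
    (hstep : R.rate D * c₂ ≤ patchError ν c₁) (t : ℕ) (j : ℤˣ) (r : Fin m) :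
    |R.γ (t + 1) j r - R.γ t j r| ≤ patchError ν c₁ :=
  (H.abs_γ_step_le (fun _ => logisticWeight_le_one _) j r).trans ((mul_one _).trans_le hstep)

lemma cutoff_γ_step_mem (H : R.Regular D ν Λ c₁ c₂) {t : ℕ} (hC : R.Controlled Λ t)
    (hstep : R.rate D * c₂ ≤ patchError ν c₁) {c σ : ℤˣ}
    (hσ : 0 ≤ lab σ * drift R.y R.clean (R.margin t) c) (r : Fin m) :
    lab σ * (cutoff (patchError ν c₁) (R.γ (t + 1) c r) - cutoff (patchError ν c₁) (R.γ t c r)) ∈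
      Set.Icc 0 (lab σ * (R.η * ‖R.μ‖ ^ 2 / m * drift R.y R.clean (R.margin t) c)) := by
  have hη := H.η_pos
  refine cutoff_step (fun hγ => ?_) (H.abs_γ_step_le_patchError hstep t c r) ?_
  · have hactive := (abs_le.1 (H.abs_inner_signal_sub_le hC c r)).1
    have hinc := R.γ_succ_sub_of_active H.n_pos (σ := 1) (j := c) (r := r) (t := t)
      (by rw [lab_one, one_mul]; linarith)
    rw [one_mul] at hinc
    linarith
  · rw [mul_left_comm]
    exact mul_nonneg (by positivity) hσ

lemma cutoff_neg_γ_step_mem (H : R.Regular D ν Λ c₁ c₂) {t : ℕ} (hC : R.Controlled Λ t)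
    (hstep : R.rate D * c₂ ≤ patchError ν c₁) {c σ : ℤˣ}
    (hσ : 0 ≤ lab σ * drift R.y R.clean (R.margin t) c) (r : Fin m) :
    lab (-σ) * (cutoff (patchError ν c₁) (-R.γ (t + 1) (-c) r) -
        cutoff (patchError ν c₁) (-R.γ t (-c) r)) ∈
      Set.Icc 0 (lab σ * (R.η * ‖R.μ‖ ^ 2 / m * drift R.y R.clean (R.margin t) c)) := by
  have hη := H.η_pos
  have hstep' : |-R.γ (t + 1) (-c) r - -R.γ t (-c) r| ≤ patchError ν c₁ := by
    rw [← neg_sub', abs_neg]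
    exact H.abs_γ_step_le_patchError hstep t (-c) r
  rw [← neg_mul_neg, ← lab_neg]
  refine cutoff_step (fun hγ => ?_) hstep' ?_
  · have hactive := (abs_le.1 (H.abs_inner_signal_sub_le hC (-c) r)).2
    have hinc := R.γ_succ_sub_of_active H.n_pos (σ := -1) (j := -c) (r := r) (t := t)
      (by rw [lab_neg, lab_one]; linarith)
    rw [neg_mul_neg, one_mul] at hinc
    linarith
  · rw [lab_neg, neg_mul_neg, mul_left_comm]
    exact mul_nonneg (by positivity) hσ

lemma signalPart_step_mem (H : R.Regular D ν Λ c₁ c₂) {t : ℕ} (hC : R.Controlled Λ t)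
    (hstep : R.rate D * c₂ ≤ patchError ν c₁) {c σ : ℤˣ}
    (hσ : 0 ≤ lab σ * drift R.y R.clean (R.margin t) c) :
    lab σ * (R.signalPart (patchError ν c₁) (t + 1) c - R.signalPart (patchError ν c₁) t c) ∈
      Set.Icc 0 (R.rate D * (2 * c₂) * (lab σ * drift R.y R.clean (R.margin t) c)) := by
  set ε := patchError ν c₁
  set Δ := R.η * ‖R.μ‖ ^ 2 / m * drift R.y R.clean (R.margin t) c with hΔ
  have hm := H.m_pos'
  have hsplit : lab σ * (R.signalPart ε (t + 1) c - R.signalPart ε t c) = 1 / m * ∑ r,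
      (lab σ * (cutoff ε (R.γ (t + 1) c r) - cutoff ε (R.γ t c r)) +
        lab (-σ) * (cutoff ε (-R.γ (t + 1) (-c) r) - cutoff ε (-R.γ t (-c) r))) := by
    simp only [signalPart, ← mul_sub, ← Finset.sum_sub_distrib, Finset.mul_sum, lab_neg]
    exact Finset.sum_congr rfl fun r _ => by ring
  have hmem := fun r => And.intro (H.cutoff_γ_step_mem hC hstep hσ r)
    (H.cutoff_neg_γ_step_mem hC hstep hσ r)
  rw [hsplit]
  constructor
  · exact mul_nonneg (by positivity) (Finset.sum_nonneg fun r _ =>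
      add_nonneg (hmem r).1.1 (hmem r).2.1)
  · calc _ ≤ 1 / (m : ℝ) * ∑ _r : Fin m, (lab σ * Δ + lab σ * Δ) :=
          mul_le_mul_of_nonneg_left (Finset.sum_le_sum fun r _ =>
            add_le_add (hmem r).1.2 (hmem r).2.2) (by positivity)
      _ = 2 * (R.η * ‖R.μ‖ ^ 2 / m) * (lab σ * drift R.y R.clean (R.margin t) c) := by
          rw [Finset.sum_const, Finset.card_univ, Fintype.card_fin, nsmul_eq_mul, hΔ]
          field_simp
          ring
      _ ≤ R.rate D * (2 * c₂) * (lab σ * drift R.y R.clean (R.margin t) c) :=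
          mul_le_mul_of_nonneg_right (by linarith [H.signal_rate_le]) hσ

lemma abs_signal_interaction_le (H : R.Regular D ν Λ c₁ c₂) (z : ℝ) (i k : Fin n) :
    |reluDeriv z * (lab (R.y k) * inner ℝ R.μ (R.ξ i))| ≤ ν * D / n := by
  refine (abs_reluDeriv_mul_le _ _).trans ?_
  rw [abs_mul, abs_lab, one_mul]
  exact (H.signal_noise i).trans H.crossBound_le

lemma le_interaction (H : R.Regular D ν Λ c₁ c₂) {t : ℕ} {r : Fin m} {i : Fin n}
    (h : 0 ≤ inner ℝ (R.W t (R.yt i) r) (R.ξ i)) (k : Fin n) :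
    (if k = i then logisticWeight (R.margin t i) * (D / 2) else 0) -
      2 * (ν * D / n) * logisticWeight (R.margin t k) ≤ R.interaction t r i k := by
  have hw := logisticWeight_pos (R.margin t k)
  have hb : 0 ≤ ν * D / n := (abs_nonneg _).trans (H.abs_signal_interaction_le 0 i i)
  have hsignal := H.abs_signal_interaction_le
    (inner ℝ (R.W t (R.yt i) r) (lab (R.y k) • R.μ)) i k
  unfold interaction
  split_ifs with hk
  · subst hk
    rw [lab_mul_self, one_mul, real_inner_self_eq_norm_sq, reluDeriv.eq_def (inner ℝ _ (R.ξ k)),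
      if_pos h, one_mul]
    have hlow : D / 2 - 2 * (ν * D / n) ≤ reluDeriv (inner ℝ (R.W t (R.yt k) r)
        (lab (R.y k) • R.μ)) * (lab (R.y k) * inner ℝ R.μ (R.ξ k)) + ‖R.ξ k‖ ^ 2 := by
      linarith [(abs_le.1 hsignal).1, H.noise_lower k]
    linarith [mul_le_mul_of_nonneg_left hlow hw.le]
  · have hnoise := (abs_reluDeriv_mul_le (inner ℝ (R.W t (R.yt i) r) (R.ξ k)) _).trans
      ((H.noise_noise k i hk).trans H.crossBound_le)
    rw [zero_sub]
    refine neg_le_of_abs_le ?_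
    rw [abs_mul, abs_mul, abs_mul, abs_lab, abs_lab, one_mul, one_mul, abs_of_pos hw, mul_comm]
    gcongr
    linarith [(abs_add_le _ _).trans (add_le_add hsignal hnoise)]

/-- A neuron with the observed label of a sample that is active on its noise stays active: the
sample's own contribution to the pre-activation outweighs those of all other samples. -/
lemma active_succ (H : R.Regular D ν Λ c₁ c₂) {t : ℕ} {q : ℝ} (hqν : 4 * q * ν ≤ 1)
    {i : Fin n} (hw : ∀ k, logisticWeight (R.margin t k) ≤ q * logisticWeight (R.margin t i))
    {r : Fin m} (h : 0 ≤ inner ℝ (R.W t (R.yt i) r) (R.ξ i)) :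
    0 ≤ inner ℝ (R.W (t + 1) (R.yt i) r) (R.ξ i) := by
  have hη := H.η_pos
  have hn := H.n_pos'
  have hD := H.D_pos
  have hν := H.ν_nonneg
  set w := logisticWeight (R.margin t i)
  have hwD : 0 ≤ w * D := mul_nonneg (logisticWeight_pos _).le hD.le
  have hsum : ∑ k, logisticWeight (R.margin t k) ≤ n * (q * w) :=
    (Finset.sum_le_sum fun k _ => hw k).trans_eq (by simp)
  rw [inner_W_succ_noise]
  refine add_nonneg h (mul_nonneg (by positivity) ?_)
  calc (0 : ℝ) ≤ w * (D / 2) - 2 * (ν * D / n) * (n * (q * w)) := by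
        rw [show 2 * (ν * D / n) * (n * (q * w)) = 4 * q * ν * (w * D) / 2 by field_simp; ring]
        linarith [mul_le_mul_of_nonneg_right hqν hwD]
    _ ≤ w * (D / 2) - 2 * (ν * D / n) * ∑ k, logisticWeight (R.margin t k) := by gcongr
    _ = ∑ k, ((if k = i then w * (D / 2) else 0) -
          2 * (ν * D / n) * logisticWeight (R.margin t k)) := by
        rw [Finset.sum_sub_distrib, Finset.sum_ite_eq' Finset.univ i, if_pos (Finset.mem_univ i),
          Finset.mul_sum]
    _ ≤ ∑ k, R.interaction t r i k := Finset.sum_le_sum fun k _ => H.le_interaction h k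

lemma abs_ρ_le_noisePart (H : R.Regular D ν Λ c₁ c₂) {t : ℕ} (hC : ∀ s < t, R.Controlled Λ s)
    (j : ℤˣ) (r : Fin m) (i : Fin n) : |R.ρ t j r i| ≤ 16 * R.noisePart t i :=
  abs_le_mul_of_abs_step_le (a := fun s => R.ρ s j r i) (b := fun s => R.noisePart s i)
    (R.ρ_zero j r i) (R.noisePart_zero i)
    fun s hs => by linarith [H.abs_ρ_step_le s j r i, (H.noisePart_step_mem (hC s hs) i).1]

lemma abs_γ_le_noisePart (H : R.Regular D ν Λ c₁ c₂) {t : ℕ} (hC : ∀ s < t, R.Controlled Λ s)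
    {q : ℝ} (hq : 0 ≤ q) {i : Fin n} (hw : ∀ s < t, ∀ k,
      logisticWeight (R.margin s k) ≤ q * logisticWeight (R.margin s i))
    (j : ℤˣ) (r : Fin m) : |R.γ t j r| ≤ 8 * c₂ * q * R.noisePart t i :=
  abs_le_mul_of_abs_step_le (a := fun s => R.γ s j r) (b := fun s => R.noisePart s i)
    (R.γ_zero j r) (R.noisePart_zero i)
    fun s hs => by
      have hnoise := mul_le_mul_of_nonneg_left (H.noisePart_step_mem (hC s hs) i).1
        (show 0 ≤ 8 * c₂ * q from mul_nonneg (by linarith [H.c₂_pos]) hq)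
      linarith [H.abs_γ_step_le (hw s hs) j r]

end Regular

/-- The bound on the difference of any two margins of a run. -/
def gap (c₂ p : ℝ) : ℝ := marginGap (1 / 8) 2 (2 * c₂) p

/-- A regular run with all kinds of samples and small steps, for which `Λ` exceeds the size that
the coefficients reach up to time `T`. -/
structure Admissible (R : Run n m d) (D ν Λ c₁ c₂ p : ℝ) (T : ℕ) : Prop
    extends R.Regular D ν Λ c₁ c₂ where
  populated : Populated R.y R.clean p
  signal_step_le : R.rate D * c₂ ≤ patchError ν c₁
  step_small : R.rate D * (2 + 4 * c₂) ≤ 1 / 4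
  activity : 4 * exp (gap c₂ p + 1) * ν ≤ 1
  coeff_le : (16 + 8 * c₂ * exp (gap c₂ p + 1)) *
    (2 * log (1 + 4 * exp (gap c₂ p + 1 / 2) * (R.rate D * T))) ≤ Λ

namespace Admissible

variable {R : Run n m d} {D ν Λ c₁ c₂ p : ℝ} {T : ℕ}

lemma nonempty (H : R.Admissible D ν Λ c₁ c₂ p T) : Nonempty (Fin n) := ⟨⟨0, H.n_pos⟩⟩

lemma marginFlow_of_controlled (H : R.Admissible D ν Λ c₁ c₂ p T) {t : ℕ}
    (hC : ∀ s < t, R.Controlled Λ s) :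
    MarginFlow R.y R.clean (R.rate D) (1 / 8) 2 (2 * c₂) t R.noisePart
      (R.signalPart (patchError ν c₁)) R.margin where
  h_nonneg := H.rate_pos.le
  α_pos := by norm_num
  β_pos := two_pos
  K_nonneg := by linarith [H.c₂_pos]
  step_small := by linarith [H.step_small]
  noise_zero := R.noisePart_zero
  signal_zero c := by simp [signalPart, γ_zero]
  le_noise_step s hs i := (H.noisePart_step_mem (hC s hs) i).1
  noise_step_le s hs i := (H.noisePart_step_mem (hC s hs) i).2
  signal_step s hs _ _ := H.signalPart_step_mem (hC s hs) H.signal_step_le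
  approx s hs i := by linarith [H.abs_margin_sub_le (hC s hs) i, H.patchError_le]

lemma noisePart_le (H : R.Admissible D ν Λ c₁ c₂ p T) {t : ℕ} (ht : t ≤ T)
    (hC : ∀ s < t, R.Controlled Λ s) (i : Fin n) :
    (16 + 8 * c₂ * exp (gap c₂ p + 1)) * R.noisePart t i ≤ Λ := by
  have := H.nonempty
  have hh := H.rate_pos
  have hc₂ := H.c₂_pos
  refine le_trans ?_ H.coeff_le
  gcongr
  calc R.noisePart t i
      ≤ 2 * log (1 + 2 * (2 * R.rate D * exp (gap c₂ p + 1 / 2)) * t) :=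
        (H.marginFlow_of_controlled hC).noise_le_log H.populated le_rfl i
    _ ≤ 2 * log (1 + 4 * exp (gap c₂ p + 1 / 2) * (R.rate D * T)) := by
        rw [show 2 * (2 * R.rate D * exp (gap c₂ p + 1 / 2)) * (t : ℝ) =
          4 * exp (gap c₂ p + 1 / 2) * (R.rate D * t) by ring]
        gcongr

lemma controlled_of_forall_lt (H : R.Admissible D ν Λ c₁ c₂ p T) {t : ℕ} (ht : t ≤ T)
    (hC : ∀ s < t, R.Controlled Λ s) : R.Controlled Λ t := by
  have := H.nonempty
  have F := H.marginFlow_of_controlled hC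
  have hγ_coeff : 0 ≤ 8 * c₂ * exp (gap c₂ p + 1) := by
    have := H.c₂_pos
    positivity
  have hweight : ∀ i, ∀ s < t, ∀ k, logisticWeight (R.margin s k) ≤
      exp (gap c₂ p + 1) * logisticWeight (R.margin s i) := fun i s hs k =>
    F.weight_le H.populated hs k i
  have hnonneg := fun i => F.noise_nonneg le_rfl i
  refine ⟨fun j r => ?_, fun j r i => ?_, fun i r h => ?_⟩
  · let i : Fin n := ⟨0, H.n_pos⟩
    linarith [H.abs_γ_le_noisePart hC (Real.exp_pos _).le (hweight i) j r, H.noisePart_le ht hC i,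
      hnonneg i]
  · linarith [H.abs_ρ_le_noisePart hC j r i, H.noisePart_le ht hC i,
      mul_nonneg hγ_coeff (hnonneg i)]
  · cases t with
    | zero => exact h
    | succ t =>
      have ht' := t.lt_succ_self
      exact H.active_succ H.activity (hweight i t ht') ((hC t ht').active i r h)

theorem controlled (H : R.Admissible D ν Λ c₁ c₂ p T) (t : ℕ) (ht : t ≤ T) :
    R.Controlled Λ t := by
  induction t using Nat.strong_induction_on with
  | _ t ih => exact H.controlled_of_forall_lt ht fun s hs => ih s hs (hs.le.trans ht)

theorem marginFlow (H : R.Admissible D ν Λ c₁ c₂ p T) :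
    MarginFlow R.y R.clean (R.rate D) (1 / 8) 2 (2 * c₂) (T + 1) R.noisePart
      (R.signalPart (patchError ν c₁)) R.margin :=
  H.marginFlow_of_controlled fun t ht => H.controlled t (Nat.lt_succ_iff.1 ht)

end Admissible
end Run

/-! ### Weight norms, memorization and growth of the margins -/

lemma norm_add_sq_le {E : Type*} [SeminormedAddCommGroup E] (u v : E) :
    ‖u + v‖ ^ 2 ≤ 2 * ‖u‖ ^ 2 + 2 * ‖v‖ ^ 2 :=
  calc ‖u + v‖ ^ 2 ≤ (‖u‖ + ‖v‖) ^ 2 := by gcongr; exact norm_add_le u v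
    _ ≤ 2 * ‖u‖ ^ 2 + 2 * ‖v‖ ^ 2 := by linarith [add_sq_le (a := ‖u‖) (b := ‖v‖)]

namespace Run

variable {n m d : ℕ}

namespace Regular

variable {R : Run n m d} {D ν Λ c₁ c₂ : ℝ}

lemma ν_le (H : R.Regular D ν Λ c₁ c₂) : ν ≤ 1 / 16 := H.ν_le_patchError.trans H.patchError_le

lemma abs_inner_noise_displacement_le (H : R.Regular D ν Λ c₁ c₂) {t : ℕ}
    (hC : R.Controlled Λ t) (j : ℤˣ) (r : Fin m) (i : Fin n) :
    |inner ℝ (R.ξ i) (R.W t j r - R.W₀ j r)| ≤ 2 * Λ := by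
  have hcoeff := hC.abs_ρ_le j r i
  have happrox := H.abs_inner_noise_sub_le hC j r i
  have hinit := H.init_noise j r i
  rw [real_inner_comm, inner_sub_left]
  rw [abs_le] at hcoeff happrox hinit ⊢
  constructor <;> linarith [H.patchError_le, H.ν_le, H.Λ_ge]

lemma abs_inner_signal_displacement_le (H : R.Regular D ν Λ c₁ c₂) {t : ℕ}
    (hC : R.Controlled Λ t) (j : ℤˣ) (r : Fin m) :
    |inner ℝ R.μ (R.W t j r - R.W₀ j r)| ≤ 2 * Λ := by
  have hcoeff := hC.abs_γ_le j r
  have happrox := H.abs_inner_signal_sub_le hC j r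
  have hinit : |inner ℝ (R.W₀ j r) (lab j • R.μ)| ≤ ν := by
    rw [real_inner_smul_right, abs_mul, abs_lab, one_mul]
    exact H.init_signal j r
  rw [← one_mul |_|, ← abs_lab j, ← abs_mul, ← real_inner_smul_left, real_inner_comm,
    inner_sub_left]
  rw [abs_le] at hcoeff happrox hinit ⊢
  constructor <;> linarith [H.patchError_le, H.ν_le, H.Λ_ge]

lemma sq_norm_displacement_le (H : R.Regular D ν Λ c₁ c₂) {t : ℕ} (hC : R.Controlled Λ t)
    (j : ℤˣ) (r : Fin m) :
    ‖R.W t j r - R.W₀ j r‖ ^ 2 ≤ (2 / c₁ + 4) * (n * Λ ^ 2 / D) := by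
  have hn := H.n_pos'
  have hD := H.D_pos
  have hc := H.c₁_pos
  have hΛ := one_pos.trans_le H.Λ_ge
  set V := R.W t j r - R.W₀ j r
  have hsignal : lab j * R.γ t j r * (‖R.μ‖ ^ 2)⁻¹ * inner ℝ R.μ V ≤
      2 / c₁ * (n * Λ ^ 2 / D) := by
    refine (le_abs_self _).trans ?_
    rw [abs_mul, abs_mul, abs_mul, abs_lab, one_mul, abs_of_pos (inv_pos.2 H.norm_μ_sq_pos)]
    calc |R.γ t j r| * (‖R.μ‖ ^ 2)⁻¹ * |inner ℝ R.μ V|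
        ≤ Λ * (n / (c₁ * D)) * (2 * Λ) := by
          gcongr
          exacts [hC.abs_γ_le j r, H.inv_norm_μ_sq_le, H.abs_inner_signal_displacement_le hC j r]
      _ = 2 / c₁ * (n * Λ ^ 2 / D) := by field_simp
  have hnoise : ∀ i, R.ρ t j r i * (‖R.ξ i‖ ^ 2)⁻¹ * inner ℝ (R.ξ i) V ≤ 4 * (Λ ^ 2 / D) :=
      fun i => by
    refine (le_abs_self _).trans ?_
    rw [abs_mul, abs_mul, abs_of_pos (inv_pos.2 (H.norm_ξ_sq_pos i))]
    calc |R.ρ t j r i| * (‖R.ξ i‖ ^ 2)⁻¹ * |inner ℝ (R.ξ i) V| ≤ Λ * (2 / D) * (2 * Λ) := by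
          gcongr
          exacts [hC.abs_ρ_le j r i, H.inv_norm_ξ_sq_le i,
            H.abs_inner_noise_displacement_le hC j r i]
      _ = 4 * (Λ ^ 2 / D) := by ring
  calc ‖V‖ ^ 2 = lab j * R.γ t j r * (‖R.μ‖ ^ 2)⁻¹ * inner ℝ R.μ V +
        ∑ i, R.ρ t j r i * (‖R.ξ i‖ ^ 2)⁻¹ * inner ℝ (R.ξ i) V := by
        rw [← real_inner_self_eq_norm_sq V, inner_sub_left, H.inner_W]
        ring
    _ ≤ 2 / c₁ * (n * Λ ^ 2 / D) + ∑ _i : Fin n, 4 * (Λ ^ 2 / D) :=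
        add_le_add hsignal (Finset.sum_le_sum fun i _ => hnoise i)
    _ = (2 / c₁ + 4) * (n * Λ ^ 2 / D) := by
        rw [Finset.sum_const, Finset.card_univ, Fintype.card_fin, nsmul_eq_mul]
        ring

theorem sq_norm_W_le (H : R.Regular D ν Λ c₁ c₂) {t : ℕ} (hC : R.Controlled Λ t)
    (j : ℤˣ) (r : Fin m) :
    ‖R.W t j r‖ ^ 2 ≤ 2 * ‖R.W₀ j r‖ ^ 2 + (4 / c₁ + 8) * (n * Λ ^ 2 / D) := by
  have hsplit := norm_add_sq_le (R.W₀ j r) (R.W t j r - R.W₀ j r)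
  rw [add_sub_cancel] at hsplit
  refine hsplit.trans ((add_le_add_right (mul_le_mul_of_nonneg_left
    (H.sq_norm_displacement_le hC j r) zero_le_two) _).trans_eq ?_)
  ring

lemma avg_γ_add_avg_γ_neg_le (H : R.Regular D ν Λ c₁ c₂) (t : ℕ) (c : ℤˣ) :
    1 / m * ∑ r, R.γ t c r + 1 / m * ∑ r, R.γ t (-c) r ≤
      R.signalPart (patchError ν c₁) t c + R.signalPart (patchError ν c₁) t (-c) +
        4 * patchError ν c₁ := by
  have hm := H.m_pos'
  set ε := patchError ν c₁
  have hle := fun j r => le_cutoff_sub_cutoff H.patchError_nonneg (R.γ t j r)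
  calc 1 / m * ∑ r, R.γ t c r + 1 / m * ∑ r, R.γ t (-c) r
      = 1 / m * ∑ r, (R.γ t c r + R.γ t (-c) r) := by rw [← mul_add, Finset.sum_add_distrib]
    _ ≤ 1 / m * ∑ r, ((cutoff ε (R.γ t c r) - cutoff ε (-R.γ t (-c) r)) +
          (cutoff ε (R.γ t (-c) r) - cutoff ε (-R.γ t c r)) + 4 * ε) :=
        mul_le_mul_of_nonneg_left
          (Finset.sum_le_sum fun r _ => by linarith [hle c r, hle (-c) r]) (by positivity)
    _ = R.signalPart ε t c + R.signalPart ε t (-c) + 4 * ε := by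
        simp only [signalPart, neg_neg, Finset.sum_add_distrib, Finset.sum_const,
          Finset.card_univ, Fintype.card_fin, nsmul_eq_mul]
        field_simp

/-- The noise contributions to the two margins must make up for both signal contributions, and
hence for the signal coefficients of both classes, so they cannot both be dominated. -/
theorem noise_dominates_or (H : R.Regular D ν Λ c₁ c₂) {t : ℕ} (hC : R.Controlled Λ t)
    {i k : Fin n} (hi : R.yt i ≠ R.y i) (hk : R.yt k ≠ R.y k) (hik : R.y k = -R.y i)
    (hMi : 1 ≤ R.margin t i) (hMk : 1 ≤ R.margin t k) :
    1 / (m : ℝ) * ∑ r, R.γ t (-R.yt i) r < 1 / (m : ℝ) * ∑ r, rhoBar (R.ρ t (R.yt i) r i) ∨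
    1 / (m : ℝ) * ∑ r, R.γ t (-R.yt k) r < 1 / (m : ℝ) * ∑ r, rhoBar (R.ρ t (R.yt k) r k) := by
  have happrox_i := (abs_le.1 (H.abs_margin_sub_le hC i)).2
  have happrox_k := (abs_le.1 (H.abs_margin_sub_le hC k)).2
  rw [R.clean_of_ne hi, lab_neg, lab_one] at happrox_i
  rw [R.clean_of_ne hk, lab_neg, lab_one] at happrox_k
  rw [hik] at happrox_k
  rw [R.avg_rhoBar_eq_noisePart H.η_pos.le, R.avg_rhoBar_eq_noisePart H.η_pos.le,
    R.yt_eq_neg_of_ne hi, R.yt_eq_neg_of_ne hk, hik, neg_neg]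
  by_contra! hdom
  linarith [H.avg_γ_add_avg_γ_neg_le t (R.y i), H.patchError_le]

end Regular

theorem Admissible.exp_neg_margin_le {R : Run n m d} {D ν Λ c₁ c₂ p : ℝ} {T : ℕ}
    (H : R.Admissible D ν Λ c₁ c₂ p T) {t : ℕ} (ht : t ≤ T) (i : Fin n) :
    R.rate D * t * exp (-R.margin t i) ≤ 16 * exp (2 * gap c₂ p + 1) := by
  have := H.nonempty
  have F := H.marginFlow
  have happrox := (abs_le.1 (F.approx t (Nat.lt_succ_of_le ht) i)).1
  have hlower : 1 / 8 * R.rate D / 2 * exp (-(2 * gap c₂ p + 1 / 2)) * t ≤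
      exp (R.margin t i + 1 / 2) :=
    (F.mul_le_exp_proxy H.populated (ht.trans T.le_succ) i).trans
      (Real.exp_le_exp.2 (by unfold MarginFlow.proxy; linarith))
  calc R.rate D * t * exp (-R.margin t i)
      = 16 * (1 / 8 * R.rate D / 2 * exp (-(2 * gap c₂ p + 1 / 2)) * t) *
          (exp (2 * gap c₂ p + 1 / 2) * exp (-R.margin t i)) := by
        rw [Real.exp_neg (2 * gap c₂ p + 1 / 2)]
        field
    _ ≤ 16 * exp (R.margin t i + 1 / 2) * (exp (2 * gap c₂ p + 1 / 2) * exp (-R.margin t i)) := by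
        gcongr
    _ = 16 * exp (2 * gap c₂ p + 1) := by
        rw [mul_assoc, ← Real.exp_add, ← Real.exp_add]
        ring_nf

end Run

/-! ### Gaussian concentration -/

section Gaussian

variable {d : ℕ}

instance isProbabilityMeasure_gaussianPatch (d : ℕ) (σ : ℝ) :
    IsProbabilityMeasure (gaussianPatch d σ) :=
  Measure.isProbabilityMeasure_map (by fun_prop)

lemma map_inner_gaussianPatch (σ : ℝ) (v : Patch d) :
    (gaussianPatch d σ).map (fun x => inner ℝ x v) =
      gaussianReal 0 (σ ^ 2 * ‖v‖ ^ 2).toNNReal := by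
  have hmap := IsGaussian.map_eq_gaussianReal (μ := stdGaussian (Patch d)) (innerSL ℝ (σ • v))
  rw [integral_strongDual_stdGaussian, variance_dual_stdGaussian, innerSL_apply_norm, norm_smul,
    mul_pow, Real.norm_eq_abs, sq_abs] at hmap
  rw [gaussianPatch, Measure.map_map (by fun_prop) (by fun_prop), ← hmap]
  congr 1
  ext x
  simp [real_inner_smul_right, real_inner_comm]

lemma hasSubgaussianMGF_inner_gaussianPatch {σ V : ℝ} {v : Patch d}
    (hV : σ ^ 2 * ‖v‖ ^ 2 ≤ V) :
    HasSubgaussianMGF (fun x => inner ℝ x v) V.toNNReal (gaussianPatch d σ) where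
  integrable_exp_mul t := by
    have hint := integrable_exp_mul_gaussianReal (μ := 0) (v := (σ ^ 2 * ‖v‖ ^ 2).toNNReal) t
    rw [← map_inner_gaussianPatch] at hint
    exact hint.comp_measurable (by fun_prop)
  mgf_le t := by
    rw [mgf_gaussianReal (map_inner_gaussianPatch σ v), zero_mul, zero_add]
    gcongr

lemma gaussianPatch_inner_tail {σ V s : ℝ} {v : Patch d} (hV : σ ^ 2 * ‖v‖ ^ 2 ≤ V)
    (hs : 0 ≤ s) :
    (gaussianPatch d σ).real {x | s ≤ |inner ℝ x v|} ≤ 2 * exp (-(s ^ 2 / (2 * V))) := by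
  have one_sided : ∀ u : Patch d, ‖u‖ = ‖v‖ →
      (gaussianPatch d σ).real {x | s ≤ inner ℝ x u} ≤ exp (-(s ^ 2 / (2 * V))) := by
    intro u hu
    have hu' : σ ^ 2 * ‖u‖ ^ 2 ≤ V := by rwa [hu]
    have htail := (hasSubgaussianMGF_inner_gaussianPatch hu').measure_ge_le hs
    rwa [Real.coe_toNNReal _ (hV.trans' (by positivity)), neg_div] at htail
  have hcover : {x : Patch d | s ≤ |inner ℝ x v|} ⊆
      {x | s ≤ inner ℝ x v} ∪ {x | s ≤ inner ℝ x (-v)} := fun x hx => by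
    simpa only [Set.mem_union, Set.mem_ofPred_eq, inner_neg_right] using le_abs.1 hx
  calc (gaussianPatch d σ).real {x | s ≤ |inner ℝ x v|}
      ≤ (gaussianPatch d σ).real {x | s ≤ inner ℝ x v} +
          (gaussianPatch d σ).real {x | s ≤ inner ℝ x (-v)} :=
        (measureReal_mono hcover).trans (measureReal_union_le _ _)
    _ ≤ 2 * exp (-(s ^ 2 / (2 * V))) := by
        linarith [one_sided v rfl, one_sided (-v) (norm_neg v)]

lemma half_le_gaussianPatch_inner_nonneg (σ : ℝ) (v : Patch d) :
    1 / 2 ≤ (gaussianPatch d σ).real {x | 0 ≤ inner ℝ x v} := by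
  set V := (σ ^ 2 * ‖v‖ ^ 2).toNNReal with hV
  have hmap : (gaussianPatch d σ).real {x | 0 ≤ inner ℝ x v} =
      (gaussianReal 0 V).real (Set.Ici 0) := by
    rw [hV, ← map_inner_gaussianPatch, map_measureReal_apply (by fun_prop) measurableSet_Ici]
    rfl
  have hsymm : (gaussianReal 0 V).real (Set.Ici 0) = (gaussianReal 0 V).real (Set.Iic 0) := by
    have hneg := gaussianReal_map_neg (μ := 0) (v := V)
    rw [neg_zero] at hneg
    nth_rewrite 1 [← hneg]
    rw [map_measureReal_apply (by fun_prop) measurableSet_Ici]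
    congr 1
    ext x
    simp
  have hcover : 1 ≤ (gaussianReal 0 V).real (Set.Ici 0) + (gaussianReal 0 V).real (Set.Iic 0) := by
    refine le_trans ?_ (measureReal_union_le _ _)
    rw [Set.union_comm, Set.Iic_union_Ici, probReal_univ]
  linarith

lemma integral_exp_mul_sq_gaussianReal {a : ℝ} (ha : a < 1 / 2) :
    ∫ x, exp (a * x ^ 2) ∂gaussianReal 0 1 = (√(1 - 2 * a))⁻¹ := by
  have hdensity : ∀ x : ℝ, gaussianPDFReal 0 1 x • exp (a * x ^ 2) =
      (√(2 * Real.pi))⁻¹ * exp (-(1 / 2 - a) * x ^ 2) := by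
    intro x
    simp only [gaussianPDFReal, smul_eq_mul, NNReal.coe_one, mul_one, sub_zero]
    rw [mul_assoc, ← Real.exp_add]
    congr 2
    ring
  have hratio : Real.pi / (1 / 2 - a) = 2 * Real.pi * (1 - 2 * a)⁻¹ := by
    have : 1 / 2 - a ≠ 0 := by linarith
    have : 1 - 2 * a ≠ 0 := by linarith
    field_simp
  rw [integral_gaussianReal_eq_integral_smul one_ne_zero]
  simp only [hdensity]
  rw [integral_const_mul, integral_gaussian, hratio,
    Real.sqrt_mul (x := 2 * Real.pi) (by positivity), Real.sqrt_inv, ← mul_assoc,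
    inv_mul_cancel₀ (by positivity), one_mul]

lemma integral_exp_mul_norm_sq_stdGaussian {a : ℝ} (ha : a < 1 / 2) :
    ∫ x, exp (a * ‖x‖ ^ 2) ∂stdGaussian (Patch d) = ((√(1 - 2 * a))⁻¹) ^ d := by
  have hprod : ∀ x : Fin d → ℝ, exp (a * ‖(WithLp.toLp 2 x : Patch d)‖ ^ 2) =
      ∏ i, exp (a * x i ^ 2) := by
    intro x
    rw [EuclideanSpace.norm_sq_eq, Finset.mul_sum, Real.exp_sum]
    simp
  rw [← map_pi_eq_stdGaussian, integral_map (by fun_prop) (by fun_prop)]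
  simp only [hprod]
  rw [integral_fintype_prod_eq_pow (fun x : ℝ => exp (a * x ^ 2)),
    integral_exp_mul_sq_gaussianReal ha, Fintype.card_fin]

lemma stdGaussian_exp_norm_sq_tail {a : ℝ} (ha : a < 1 / 2) (b : ℝ) :
    (stdGaussian (Patch d)).real {x | b * d ≤ a * ‖x‖ ^ 2} ≤
      (exp (-b) * (√(1 - 2 * a))⁻¹) ^ d := by
  have hmgf := integral_exp_mul_norm_sq_stdGaussian (d := d) ha
  have hpos : 0 < √(1 - 2 * a) := Real.sqrt_pos.2 (by linarith)
  have hint : Integrable (fun x : Patch d => exp (1 * (a * ‖x‖ ^ 2))) (stdGaussian (Patch d)) := by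
    simp only [one_mul]
    exact Integrable.of_integral_ne_zero (by rw [hmgf]; positivity)
  refine (measure_ge_le_exp_mul_mgf (b * d) zero_le_one hint).trans_eq ?_
  simp only [mgf, one_mul]
  rw [hmgf, mul_pow, ← Real.exp_nat_mul]
  ring_nf

lemma gaussianPatch_norm_sq_tail (σ : ℝ) :
    (gaussianPatch d σ).real {x | ¬ (σ ^ 2 * d / 2 ≤ ‖x‖ ^ 2 ∧ ‖x‖ ^ 2 ≤ 2 * (σ ^ 2 * d))} ≤
      2 * exp (-(d / 16 : ℝ)) := by
  have hcover : (fun v : Patch d => σ • v) ⁻¹'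
      {x | ¬ (σ ^ 2 * d / 2 ≤ ‖x‖ ^ 2 ∧ ‖x‖ ^ 2 ≤ 2 * (σ ^ 2 * d))} ⊆
      {x | (-(1 / 4)) * (d : ℝ) ≤ (-(1 / 2)) * ‖x‖ ^ 2} ∪
        {x | (1 / 2) * (d : ℝ) ≤ 1 / 4 * ‖x‖ ^ 2} := by
    intro x hx
    simp only [Set.mem_preimage, Set.mem_ofPred_eq, norm_smul, mul_pow, Real.norm_eq_abs, sq_abs,
      not_and_or, not_le] at hx
    simp only [Set.mem_union, Set.mem_ofPred_eq]
    rcases hx with hx | hx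
    · exact .inl (by nlinarith [sq_nonneg σ])
    · exact .inr (by nlinarith [sq_nonneg σ])
  have hsqrt : √(2 : ℝ) = exp (log 2 / 2) := by
    rw [Real.sqrt_eq_rpow, Real.rpow_def_of_pos (by norm_num), mul_one_div]
  have lower := stdGaussian_exp_norm_sq_tail (d := d) (a := -(1 / 2)) (by norm_num) (-(1 / 4))
  have upper := stdGaussian_exp_norm_sq_tail (d := d) (a := 1 / 4) (by norm_num) (1 / 2)
  have lower_base : exp (- -(1 / 4)) * (√(1 - 2 * -(1 / 2)))⁻¹ ≤ exp (-(1 / 16)) := by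
    rw [show (1 : ℝ) - 2 * -(1 / 2) = 2 by norm_num, hsqrt, ← Real.exp_neg, ← Real.exp_add]
    exact Real.exp_le_exp.2 (by linarith [Real.log_two_gt_d9])
  have upper_base : exp (-(1 / 2)) * (√(1 - 2 * (1 / 4)))⁻¹ ≤ exp (-(1 / 16)) := by
    rw [show (1 : ℝ) - 2 * (1 / 4) = 2⁻¹ by norm_num, Real.sqrt_inv, inv_inv, hsqrt,
      ← Real.exp_add]
    exact Real.exp_le_exp.2 (by linarith [Real.log_two_lt_d9])
  have hexp : exp (-(d / 16 : ℝ)) = exp (-(1 / 16)) ^ d := by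
    rw [← Real.exp_nat_mul]; congr 1; ring
  rw [gaussianPatch, map_measureReal_apply (by fun_prop) (by measurability), hexp]
  linarith [(measureReal_mono (μ := stdGaussian (Patch d)) hcover).trans
      (measureReal_union_le _ _),
    lower.trans (pow_le_pow_left₀ (by positivity) lower_base d),
    upper.trans (pow_le_pow_left₀ (by positivity) upper_base d)]

lemma pi_count_tail {Ω : Type*} [MeasurableSpace Ω] {P : Measure Ω} [IsProbabilityMeasure P]
    {A : Set Ω} [DecidablePred (· ∈ A)] (hA : MeasurableSet A) (hP : 1 / 2 ≤ P.real A) (m : ℕ) :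
    (Measure.pi fun _ : Fin m => P).real
      {w | (({r | w r ∈ A} : Finset (Fin m)).card : ℝ) < m / 4} ≤ exp (-(m / 8 : ℝ)) := by
  set X : Ω → ℝ := fun a => P.real A - A.indicator 1 a with hX
  have hXm : Measurable X := (measurable_one.indicator hA).const_sub _
  have hmean : P[X] = 0 := by
    rw [hX, integral_sub (integrable_const _) ((integrable_const _).indicator hA),
      integral_indicator_one hA, integral_const, probReal_univ, one_smul, sub_self]
  have hcentred : HasSubgaussianMGF X ((‖P.real A - (P.real A - 1)‖₊ / 2) ^ 2) P := by
    refine hasSubgaussianMGF_of_mem_Icc_of_integral_eq_zero hXm.aemeasurable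
      (ae_of_all _ fun a => ?_) hmean
    by_cases ha : a ∈ A <;> simp [hX, ha]
  have hcoord (r : Fin m) : HasSubgaussianMGF (fun w : Fin m → Ω => X (w r))
      ((‖P.real A - (P.real A - 1)‖₊ / 2) ^ 2) (Measure.pi fun _ => P) := by
    have heval := measurePreserving_eval (fun _ : Fin m => P) r
    exact HasSubgaussianMGF.of_map (X := X) heval.aemeasurable (by rwa [heval.map_eq])
  have hoeffding := HasSubgaussianMGF.measure_sum_ge_le_of_iIndepFun
    (iIndepFun_pi (μ := fun _ : Fin m => P) (X := fun _ => X) fun _ => hXm.aemeasurable)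
    (s := Finset.univ) (fun r _ => hcoord r) (ε := m / 4) (by positivity)
  have hcover : {w : Fin m → Ω | (({r | w r ∈ A} : Finset (Fin m)).card : ℝ) < m / 4} ⊆
      {w | (m / 4 : ℝ) ≤ ∑ r, X (w r)} := by
    intro w hw
    have hsum : ∑ r, X (w r) = m * P.real A - (({r | w r ∈ A} : Finset (Fin m)).card : ℝ) := by
      simp [hX, Set.indicator_apply]
    have hm : (m : ℝ) * (1 / 2) ≤ m * P.real A := by gcongr
    simp only [Set.mem_ofPred_eq, hsum] at hw ⊢
    linarith
  refine (measureReal_mono hcover).trans (hoeffding.trans_eq ?_)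
  rcases eq_or_ne m 0 with rfl | hm
  · simp
  · rw [sub_sub_cancel, nnnorm_one]
    congr 1
    push_cast [Finset.sum_const, Finset.card_univ, Fintype.card_fin, nsmul_eq_mul]
    field_simp
    norm_num

lemma prod_real_le_of_section_le {α β : Type*} [MeasurableSpace α] [MeasurableSpace β]
    {P : Measure α} {Q : Measure β} [IsProbabilityMeasure P] [IsProbabilityMeasure Q]
    {S : Set (α × β)} (hS : MeasurableSet S) {q : ℝ}
    (h : ∀ b, P.real {a | (a, b) ∈ S} ≤ q) : (P.prod Q).real S ≤ q := by
  have hq : 0 ≤ q := measureReal_nonneg.trans (h (Classical.choice Q.nonempty_of_neZero))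
  rw [measureReal_def, Measure.prod_apply_symm hS]
  refine ENNReal.toReal_le_of_le_ofReal hq ?_
  calc ∫⁻ b, P {a | (a, b) ∈ S} ∂Q ≤ ∫⁻ _ : β, ENNReal.ofReal q ∂Q := by
        refine lintegral_mono fun b => ?_
        rw [← ENNReal.ofReal_toReal (measure_ne_top P _)]
        exact ENNReal.ofReal_le_ofReal (h b)
    _ = ENNReal.ofReal q := by simp

lemma measurableSet_le_abs_inner_and_sq_norm_le (s N : ℝ) :
    MeasurableSet {p : Patch d × Patch d | s ≤ |inner ℝ p.1 p.2| ∧ ‖p.2‖ ^ 2 ≤ N} := by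
  have hinner : Measurable fun p : Patch d × Patch d => |inner ℝ p.1 p.2| := by fun_prop
  have hnorm : Measurable fun p : Patch d × Patch d => ‖p.2‖ ^ 2 := by fun_prop
  exact (measurableSet_le measurable_const hinner).inter (measurableSet_le hnorm measurable_const)

lemma gaussianPatch_prod_tail {σ σ' N s : ℝ} (hs : 0 ≤ s) :
    ((gaussianPatch d σ).prod (gaussianPatch d σ')).real
      {p | s ≤ |inner ℝ p.1 p.2| ∧ ‖p.2‖ ^ 2 ≤ N} ≤
      2 * exp (-(s ^ 2 / (2 * (σ ^ 2 * N)))) := by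
  refine prod_real_le_of_section_le (measurableSet_le_abs_inner_and_sq_norm_le s N) fun b => ?_
  by_cases hb : ‖b‖ ^ 2 ≤ N
  · simp only [Set.mem_ofPred_eq, hb, and_true]
    exact gaussianPatch_inner_tail (by gcongr) hs
  · simp only [Set.mem_ofPred_eq, hb, and_false, Set.ofPred_false, measureReal_empty]
    positivity

end Gaussian

/-! ### The typical training sample -/

section Typical

variable {n m d : ℕ} {μ : Patch d} {σ0 σξ b ν : ℝ} {yt : Fin n → ℤˣ}

/-- The high-probability event on which the dynamics are analysed: the norms of the noise patches
concentrate, the signal and the noise patches are correlated by at most `b`, the initialization is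
correlated with both by at most `ν`, and for each sample a quarter of the neurons of the branch of
its observed label is active at initialization. -/
structure IsTypical (yt : Fin n → ℤˣ) (μ : Patch d) (σ0 σξ b ν : ℝ) (W₀ : Weights m d)
    (ξ : Fin n → Patch d) : Prop where
  noise_norm : ∀ i, σξ ^ 2 * d / 2 ≤ ‖ξ i‖ ^ 2 ∧ ‖ξ i‖ ^ 2 ≤ 2 * (σξ ^ 2 * d)
  init_norm : ∀ j r, ‖W₀ j r‖ ^ 2 ≤ 2 * (σ0 ^ 2 * d)
  noise_noise : ∀ i k, i ≠ k → |inner ℝ (ξ i) (ξ k)| ≤ b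
  noise_signal : ∀ i, |inner ℝ (ξ i) μ| ≤ b
  init_noise : ∀ j r i, |inner ℝ (W₀ j r) (ξ i)| ≤ ν
  init_signal : ∀ j r, |inner ℝ (W₀ j r) μ| ≤ ν
  active : ∀ i, (m : ℝ) / 4 ≤ ({r | 0 ≤ inner ℝ (W₀ (yt i) r) (ξ i)} : Finset (Fin m)).card

/-- The union bound for the probability that `IsTypical` fails, one summand per field. -/
def failureBound (n m d : ℕ) (μ : Patch d) (σ0 σξ b ν : ℝ) : ℝ :=
  n * (2 * exp (-(d / 16))) + 2 * m * (2 * exp (-(d / 16))) +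
    n * n * (2 * exp (-(b ^ 2 / (2 * (σξ ^ 2 * (2 * (σξ ^ 2 * d))))))) +
    n * (2 * exp (-(b ^ 2 / (2 * (σξ ^ 2 * ‖μ‖ ^ 2))))) +
    2 * m * n * (2 * exp (-(ν ^ 2 / (2 * (σ0 ^ 2 * (2 * (σξ ^ 2 * d))))))) +
    2 * m * (2 * exp (-(ν ^ 2 / (2 * (σ0 ^ 2 * ‖μ‖ ^ 2))))) +
    n * exp (-(m / 8))

instance isProbabilityMeasure_trainLaw (n m d : ℕ) (σ0 σξ : ℝ) :
    IsProbabilityMeasure (trainLaw n m d σ0 σξ) := by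
  unfold trainLaw
  infer_instance

lemma measurePreserving_noise (i : Fin n) :
    MeasurePreserving (fun p : Weights m d × (Fin n → Patch d) => p.2 i)
      (trainLaw n m d σ0 σξ) (gaussianPatch d σξ) :=
  (measurePreserving_eval (fun _ => gaussianPatch d σξ) i).comp measurePreserving_snd

lemma measurePreserving_row (j : ℤˣ) (r : Fin m) :
    MeasurePreserving (fun W : Weights m d => W j r)
      (Measure.pi fun _ => Measure.pi fun _ => gaussianPatch d σ0) (gaussianPatch d σ0) :=
  (measurePreserving_eval (fun _ => gaussianPatch d σ0) r).comp
    (measurePreserving_eval (fun _ => Measure.pi fun _ => gaussianPatch d σ0) j)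

lemma measurePreserving_init (j : ℤˣ) (r : Fin m) :
    MeasurePreserving (fun p : Weights m d × (Fin n → Patch d) => p.1 j r)
      (trainLaw n m d σ0 σξ) (gaussianPatch d σ0) :=
  (measurePreserving_row j r).comp measurePreserving_fst

lemma measurePreserving_init_noise (j : ℤˣ) (r : Fin m) (i : Fin n) :
    MeasurePreserving (fun p : Weights m d × (Fin n → Patch d) => (p.1 j r, p.2 i))
      (trainLaw n m d σ0 σξ) ((gaussianPatch d σ0).prod (gaussianPatch d σξ)) :=
  (measurePreserving_row j r).prod (measurePreserving_eval (fun _ => gaussianPatch d σξ) i)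

lemma measurePreserving_branch_noise (j : ℤˣ) (i : Fin n) :
    MeasurePreserving (fun p : Weights m d × (Fin n → Patch d) => (p.1 j, p.2 i))
      (trainLaw n m d σ0 σξ)
      ((Measure.pi fun _ : Fin m => gaussianPatch d σ0).prod (gaussianPatch d σξ)) :=
  (measurePreserving_eval (fun _ => Measure.pi fun _ => gaussianPatch d σ0) j).prod
    (measurePreserving_eval (fun _ => gaussianPatch d σξ) i)

lemma measurePreserving_eval_pair {ι Ω : Type*} [Fintype ι] [MeasurableSpace Ω] (P : Measure Ω)
    [IsProbabilityMeasure P] {i k : ι} (h : i ≠ k) :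
    MeasurePreserving (fun ω : ι → Ω => (ω i, ω k)) (Measure.pi fun _ => P) (P.prod P) := by
  refine ⟨by fun_prop, ?_⟩
  have hindep := (iIndepFun_pi (μ := fun _ : ι => P) (X := fun _ x => x)
    fun _ => aemeasurable_id).indepFun h
  rw [indepFun_iff_map_prod_eq_prod_map_map (measurable_pi_apply i).aemeasurable
    (measurable_pi_apply k).aemeasurable] at hindep
  rw [hindep]
  congr 1
  · exact (measurePreserving_eval (fun _ => P) i).map_eq
  · exact (measurePreserving_eval (fun _ => P) k).map_eq

lemma measureReal_exists_mem_le {Ω Ω' β : Type*} [MeasurableSpace Ω] [MeasurableSpace Ω']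
    [Fintype β] {P : Measure Ω} {Q : Measure Ω'} {g : β → Ω → Ω'}
    (hg : ∀ b, MeasurePreserving (g b) P Q) {A : Set Ω'} (hA : MeasurableSet A) {q : ℝ}
    (hq : Q.real A ≤ q) : P.real {ω | ∃ b, g b ω ∈ A} ≤ Fintype.card β * q := by
  rw [Set.ofPred_exists]
  calc P.real (⋃ b, g b ⁻¹' A) ≤ ∑ b, P.real (g b ⁻¹' A) := measureReal_iUnion_fintype_le _
    _ ≤ ∑ _b : β, q := Finset.sum_le_sum fun b _ =>
        ((hg b).measureReal_preimage hA.nullMeasurableSet).le.trans hq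
    _ = Fintype.card β * q := by simp

lemma trainLaw_noise_norm_tail :
    (trainLaw n m d σ0 σξ).real
      {p | ∃ i, p.2 i ∈ {x | ¬ (σξ ^ 2 * d / 2 ≤ ‖x‖ ^ 2 ∧ ‖x‖ ^ 2 ≤ 2 * (σξ ^ 2 * d))}} ≤
      n * (2 * exp (-(d / 16))) := by
  simpa using measureReal_exists_mem_le (measurePreserving_noise (m := m) (σ0 := σ0))
    (by measurability) (gaussianPatch_norm_sq_tail σξ)

lemma trainLaw_init_norm_tail :
    (trainLaw n m d σ0 σξ).real
      {p | ∃ q : ℤˣ × Fin m, p.1 q.1 q.2 ∈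
        {x | ¬ (σ0 ^ 2 * d / 2 ≤ ‖x‖ ^ 2 ∧ ‖x‖ ^ 2 ≤ 2 * (σ0 ^ 2 * d))}} ≤
      2 * m * (2 * exp (-(d / 16))) := by
  simpa using measureReal_exists_mem_le
    (fun q : ℤˣ × Fin m => measurePreserving_init (n := n) (σξ := σξ) q.1 q.2)
    (by measurability) (gaussianPatch_norm_sq_tail σ0)

lemma trainLaw_noise_noise_tail (hb : 0 ≤ b) :
    (trainLaw n m d σ0 σξ).real
      {p | ∃ q : {q : Fin n × Fin n // q.1 ≠ q.2}, (p.2 q.1.1, p.2 q.1.2) ∈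
        {z | b ≤ |inner ℝ z.1 z.2| ∧ ‖z.2‖ ^ 2 ≤ 2 * (σξ ^ 2 * d)}} ≤
      n * n * (2 * exp (-(b ^ 2 / (2 * (σξ ^ 2 * (2 * (σξ ^ 2 * d))))))) := by
  refine (measureReal_exists_mem_le
    (fun q => (measurePreserving_eval_pair (gaussianPatch d σξ) q.2).comp measurePreserving_snd)
    (measurableSet_le_abs_inner_and_sq_norm_le _ _) (gaussianPatch_prod_tail hb)).trans ?_
  have hcard : (Fintype.card {q : Fin n × Fin n // q.1 ≠ q.2} : ℝ) ≤ n * n := by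
    exact_mod_cast (Fintype.card_subtype_le _).trans_eq (by simp)
  gcongr

lemma measurableSet_le_abs_inner (s : ℝ) (v : Patch d) :
    MeasurableSet {x : Patch d | s ≤ |inner ℝ x v|} := by
  have hinner : Measurable fun x : Patch d => |inner ℝ x v| := by fun_prop
  exact measurableSet_le measurable_const hinner

lemma trainLaw_noise_signal_tail (hb : 0 ≤ b) :
    (trainLaw n m d σ0 σξ).real {p | ∃ i, p.2 i ∈ {x | b ≤ |inner ℝ x μ|}} ≤
      n * (2 * exp (-(b ^ 2 / (2 * (σξ ^ 2 * ‖μ‖ ^ 2))))) := by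
  simpa using measureReal_exists_mem_le (measurePreserving_noise (m := m) (σ0 := σ0))
    (measurableSet_le_abs_inner b μ) (gaussianPatch_inner_tail le_rfl hb)

lemma trainLaw_init_noise_tail (hν : 0 ≤ ν) :
    (trainLaw n m d σ0 σξ).real
      {p | ∃ q : (ℤˣ × Fin m) × Fin n, (p.1 q.1.1 q.1.2, p.2 q.2) ∈
        {z | ν ≤ |inner ℝ z.1 z.2| ∧ ‖z.2‖ ^ 2 ≤ 2 * (σξ ^ 2 * d)}} ≤
      2 * m * n * (2 * exp (-(ν ^ 2 / (2 * (σ0 ^ 2 * (2 * (σξ ^ 2 * d))))))) := by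
  simpa using measureReal_exists_mem_le
    (fun q : (ℤˣ × Fin m) × Fin n => measurePreserving_init_noise q.1.1 q.1.2 q.2)
    (measurableSet_le_abs_inner_and_sq_norm_le _ _) (gaussianPatch_prod_tail hν)

lemma trainLaw_init_signal_tail (hν : 0 ≤ ν) :
    (trainLaw n m d σ0 σξ).real
      {p | ∃ q : ℤˣ × Fin m, p.1 q.1 q.2 ∈ {x | ν ≤ |inner ℝ x μ|}} ≤
      2 * m * (2 * exp (-(ν ^ 2 / (2 * (σ0 ^ 2 * ‖μ‖ ^ 2))))) := by
  simpa using measureReal_exists_mem_le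
    (fun q : ℤˣ × Fin m => measurePreserving_init (n := n) (σξ := σξ) q.1 q.2)
    (measurableSet_le_abs_inner ν μ) (gaussianPatch_inner_tail le_rfl hν)

lemma measurableSet_count_lt (m d : ℕ) : MeasurableSet {p : (Fin m → Patch d) × Patch d |
    (({r | 0 ≤ inner ℝ (p.1 r) p.2} : Finset (Fin m)).card : ℝ) < m / 4} := by
  refine measurableSet_lt ?_ measurable_const
  simp only [Finset.card_filter, Nat.cast_sum, Nat.cast_ite, Nat.cast_one, Nat.cast_zero]
  refine Finset.measurable_sum _ fun r _ => ?_
  have hinner : Measurable fun p : (Fin m → Patch d) × Patch d => (inner ℝ (p.1 r) p.2 : ℝ) := by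
    fun_prop
  exact Measurable.ite (measurableSet_le measurable_const hinner) measurable_const
    measurable_const

lemma trainLaw_inactive_tail (yt : Fin n → ℤˣ) :
    (trainLaw n m d σ0 σξ).real
      {p | ∃ i, (p.1 (yt i), p.2 i) ∈ {z : (Fin m → Patch d) × Patch d |
        (({r | 0 ≤ inner ℝ (z.1 r) z.2} : Finset (Fin m)).card : ℝ) < m / 4}} ≤
      n * exp (-(m / 8)) := by
  have hsection := prod_real_le_of_section_le (P := Measure.pi fun _ => gaussianPatch d σ0)
    (Q := gaussianPatch d σξ) (measurableSet_count_lt m d) fun v =>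
      pi_count_tail (A := {x | 0 ≤ inner ℝ x v}) (measurableSet_le measurable_const (by fun_prop))
        (half_le_gaussianPatch_inner_nonneg σ0 v) m
  simpa using measureReal_exists_mem_le (fun i => measurePreserving_branch_noise (yt i) i)
    (measurableSet_count_lt m d) hsection

lemma trainLaw_not_isTypical_le (hb : 0 ≤ b) (hν : 0 ≤ ν) :
    (trainLaw n m d σ0 σξ).real {p | ¬ IsTypical yt μ σ0 σξ b ν p.1 p.2} ≤
      failureBound n m d μ σ0 σξ b ν := by
  refine (measureReal_mono (fun p hp => ?_)).trans <|
    (measureReal_union_le _ _).trans <| add_le_add ((measureReal_union_le _ _).trans <|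
    add_le_add ((measureReal_union_le _ _).trans <| add_le_add ((measureReal_union_le _ _).trans <|
    add_le_add ((measureReal_union_le _ _).trans <| add_le_add ((measureReal_union_le _ _).trans <|
    add_le_add trainLaw_noise_norm_tail trainLaw_init_norm_tail)
    (trainLaw_noise_noise_tail hb)) (trainLaw_noise_signal_tail (μ := μ) hb))
    (trainLaw_init_noise_tail hν)) (trainLaw_init_signal_tail (μ := μ) hν))
    (trainLaw_inactive_tail yt)
  by_contra htypical
  simp only [Set.mem_union, Set.mem_ofPred_eq, not_or, not_exists, not_not] at htypical
  obtain ⟨⟨⟨⟨⟨⟨noise_norm, init_norm⟩, noise_noise⟩, noise_signal⟩, init_noise⟩, init_signal⟩,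
    active⟩ := htypical
  exact hp
    { noise_norm
      init_norm := fun j r => (init_norm (j, r)).2
      noise_noise := fun i k hik => not_lt.1 fun h =>
        noise_noise ⟨(i, k), hik⟩ ⟨h.le, (noise_norm k).2⟩
      noise_signal := fun i => (not_le.1 (noise_signal i)).le
      init_noise := fun j r i => not_lt.1 fun h =>
        init_noise ((j, r), i) ⟨h.le, (noise_norm i).2⟩
      init_signal := fun j r => (not_le.1 (init_signal (j, r))).le
      active := fun i => not_lt.1 (active i) }

lemma exists_measurableSet_isTypical (yt : Fin n → ℤˣ) (μ : Patch d) (hb : 0 ≤ b)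
    (hν : 0 ≤ ν) :
    ∃ E : Set (Weights m d × (Fin n → Patch d)), MeasurableSet E ∧
      1 - failureBound n m d μ σ0 σξ b ν ≤ (trainLaw n m d σ0 σξ).real E ∧
      ∀ W₀ ξ, (W₀, ξ) ∈ E → IsTypical yt μ σ0 σξ b ν W₀ ξ := by
  set P := trainLaw n m d σ0 σξ
  set bad := {p : Weights m d × (Fin n → Patch d) | ¬ IsTypical yt μ σ0 σξ b ν p.1 p.2}
  refine ⟨(toMeasurable P bad)ᶜ, (measurableSet_toMeasurable _ _).compl, ?_, fun W₀ ξ hE => ?_⟩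
  · rw [probReal_compl_eq_one_sub (measurableSet_toMeasurable _ _), measureReal_def P,
      measure_toMeasurable, ← measureReal_def]
    exact sub_le_sub_left (trainLaw_not_isTypical_le hb hν) 1
  · exact not_not.1 fun h => hE (subset_toMeasurable P bad h)

end Typical

/-! ### The test error -/

section Test

variable {n m d : ℕ}

lemma exp_average_le {ι : Type*} [Fintype ι] [Nonempty ι] (f : ι → ℝ) :
    exp ((Fintype.card ι : ℝ)⁻¹ * ∑ i, f i) ≤ (Fintype.card ι : ℝ)⁻¹ * ∑ i, exp (f i) := by
  have hjensen := convexOn_exp.map_sum_le (t := Finset.univ)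
    (w := fun _ : ι => (Fintype.card ι : ℝ)⁻¹) (p := f) (fun _ _ => by positivity) (by simp)
    (fun _ _ => Set.mem_univ _)
  simpa only [smul_eq_mul, ← Finset.mul_sum] using hjensen

section Subgaussian

open scoped NNReal

variable {Ω ι : Type*} [MeasurableSpace Ω] {P : Measure Ω} {c : ℝ≥0}

lemma integrable_exp_mul_abs_of_hasSubgaussianMGF {X : Ω → ℝ} (hX : HasSubgaussianMGF X c P)
    (t : ℝ) : Integrable (fun ω => exp (t * |X ω|)) P :=
  integrable_exp_mul_abs (hX.integrable_exp_mul t) (hX.integrable_exp_mul (-t))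

lemma integral_exp_mul_abs_le_of_hasSubgaussianMGF {X : Ω → ℝ} (hX : HasSubgaussianMGF X c P)
    (t : ℝ) : ∫ ω, exp (t * |X ω|) ∂P ≤ 2 * exp (c * t ^ 2 / 2) := by
  have hle : ∀ ω, exp (t * |X ω|) ≤ exp (t * X ω) + exp (-t * X ω) := by
    intro ω
    rcases abs_choice (X ω) with h | h <;> rw [h]
    · linarith [Real.exp_pos (-t * X ω)]
    · rw [mul_neg, ← neg_mul]
      linarith [Real.exp_pos (t * X ω)]
  calc ∫ ω, exp (t * |X ω|) ∂P ≤ ∫ ω, (exp (t * X ω) + exp (-t * X ω)) ∂P :=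
        integral_mono (integrable_exp_mul_abs_of_hasSubgaussianMGF hX t)
          ((hX.integrable_exp_mul t).add (hX.integrable_exp_mul (-t))) hle
    _ = mgf X P t + mgf X P (-t) :=
        integral_add (hX.integrable_exp_mul t) (hX.integrable_exp_mul (-t))
    _ ≤ exp (c * t ^ 2 / 2) + exp (c * (-t) ^ 2 / 2) := add_le_add (hX.mgf_le t) (hX.mgf_le (-t))
    _ = 2 * exp (c * t ^ 2 / 2) := by rw [neg_sq, two_mul]

lemma average_abs_tail_of_hasSubgaussianMGF [Fintype ι] [Nonempty ι] [IsFiniteMeasure P]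
    {X : ι → Ω → ℝ} (hX : ∀ i, HasSubgaussianMGF (X i) c P) (hc : 0 < c) {s : ℝ} (hs : 0 ≤ s) :
    P.real {ω | s ≤ (Fintype.card ι : ℝ)⁻¹ * ∑ i, |X i ω|} ≤ 2 * exp (-(s ^ 2 / (2 * c))) := by
  set N := (Fintype.card ι : ℝ)
  set t : ℝ := s / c with ht
  have ht0 : 0 ≤ t := by positivity
  have hpointwise : ∀ ω, exp (t * (N⁻¹ * ∑ i, |X i ω|)) ≤ N⁻¹ * ∑ i, exp (t * |X i ω|) := by
    intro ω
    rw [mul_left_comm, Finset.mul_sum]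
    exact exp_average_le _
  have hint : Integrable (fun ω => N⁻¹ * ∑ i, exp (t * |X i ω|)) P :=
    (integrable_finsetSum _ fun i _ =>
      integrable_exp_mul_abs_of_hasSubgaussianMGF (hX i) t).const_mul _
  have hmean : ∫ ω, N⁻¹ * ∑ i, exp (t * |X i ω|) ∂P ≤ 2 * exp (c * t ^ 2 / 2) := by
    rw [integral_const_mul, integral_finsetSum _ fun i _ =>
      integrable_exp_mul_abs_of_hasSubgaussianMGF (hX i) t]
    calc _ ≤ N⁻¹ * ∑ _i : ι, 2 * exp (c * t ^ 2 / 2) := by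
          gcongr with i
          exact integral_exp_mul_abs_le_of_hasSubgaussianMGF (hX i) t
      _ = 2 * exp (c * t ^ 2 / 2) := by simp [N]
  have hsubset : {ω | s ≤ N⁻¹ * ∑ i, |X i ω|} ⊆
      {ω | exp (t * s) ≤ N⁻¹ * ∑ i, exp (t * |X i ω|)} := fun ω hω =>
    (Real.exp_le_exp.2 (mul_le_mul_of_nonneg_left hω ht0)).trans (hpointwise ω)
  have hmarkov := mul_meas_ge_le_integral_of_nonneg
    (.of_forall fun ω => (Real.exp_pos _).le.trans (hpointwise ω)) hint (exp (t * s))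
  calc P.real {ω | s ≤ N⁻¹ * ∑ i, |X i ω|}
      ≤ P.real {ω | exp (t * s) ≤ N⁻¹ * ∑ i, exp (t * |X i ω|)} := measureReal_mono hsubset
    _ ≤ 2 * exp (c * t ^ 2 / 2) / exp (t * s) := by
        rw [le_div_iff₀' (Real.exp_pos _)]
        exact hmarkov.trans hmean
    _ = 2 * exp (-(s ^ 2 / (2 * c))) := by
        rw [mul_div_assoc, ← Real.exp_sub, ht]
        congr 2
        field_simp
        ring

end Subgaussian

/-- The averaged response of the neurons of both branches to a perturbation `ζ`, which bounds the
change of the network output. -/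
def response (W : Weights m d) (ζ : Patch d) : ℝ :=
  1 / m * ∑ j, ∑ r, |inner ℝ ζ (W j r)|

lemma abs_branch_sub_le (W : Weights m d) (j : ℤˣ) (u v ζ : Patch d) :
    |branch W j (u, v + ζ) - branch W j (u, v)| ≤ 1 / m * ∑ r, |inner ℝ ζ (W j r)| := by
  unfold branch
  rw [← mul_sub, ← Finset.sum_sub_distrib, abs_mul, abs_of_nonneg (by positivity)]
  gcongr
  refine (Finset.abs_sum_le_sum_abs _ _).trans (Finset.sum_le_sum fun r _ => ?_)
  rw [add_sub_add_left_eq_sub]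
  refine (abs_relu_sub_relu_le _ _).trans_eq ?_
  rw [inner_add_right, add_sub_cancel_left, real_inner_comm]

lemma abs_net_sub_le (W : Weights m d) (u v ζ : Patch d) :
    |net W (u, v + ζ) - net W (u, v)| ≤ response W ζ := by
  have hpos := abs_branch_sub_le W 1 u v ζ
  have hneg := abs_branch_sub_le W (-1) u v ζ
  have hsplit : response W ζ =
      1 / m * ∑ r, |inner ℝ ζ (W 1 r)| + 1 / m * ∑ r, |inner ℝ ζ (W (-1) r)| := by
    rw [response, UnitsInt.univ, Finset.sum_pair (by decide), mul_add]
  rw [hsplit, net, net, sub_sub_sub_comm]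
  exact (abs_sub _ _).trans (add_le_add hpos hneg)

lemma measurable_response (W : Weights m d) : Measurable (response W) := by
  unfold response
  fun_prop

lemma one_sub_exp_neg_le_gaussianPatch_response_lt (hn : 0 < n) (hm : 0 < m) {σ : ℝ}
    {W : Weights m d} (hW : ∀ j r, σ ^ 2 * ‖W j r‖ ^ 2 ≤ 1 / (16 * n)) :
    1 - exp (-n) ≤ (gaussianPatch d σ).real {ζ | response W ζ < 1} := by
  have : NeZero m := ⟨hm.ne'⟩
  have hn1 : (1 : ℝ) ≤ n := by exact_mod_cast hn
  have htail := average_abs_tail_of_hasSubgaussianMGF (ι := ℤˣ × Fin m)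
    (fun q => hasSubgaussianMGF_inner_gaussianPatch (hW q.1 q.2))
    (Real.toNNReal_pos.2 (by positivity)) (s := 1 / 2) (by norm_num)
  rw [Real.coe_toNNReal _ (by positivity)] at htail
  have hcompl : {ζ | response W ζ < 1}ᶜ =
      {ζ | 1 / 2 ≤ (Fintype.card (ℤˣ × Fin m) : ℝ)⁻¹ *
        ∑ q : ℤˣ × Fin m, |inner ℝ ζ (W q.1 q.2)|} := by
    ext ζ
    have hhalf : (Fintype.card (ℤˣ × Fin m) : ℝ)⁻¹ *
        ∑ q : ℤˣ × Fin m, |inner ℝ ζ (W q.1 q.2)| = response W ζ / 2 := by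
      rw [response, Fintype.sum_prod_type, Fintype.card_prod, Fintype.card_units_int,
        Fintype.card_fin]
      push_cast
      field_simp
    simp only [Set.mem_compl_iff, Set.mem_ofPred_eq, hhalf, not_lt]
    constructor <;> intro h <;> linarith
  have hexp : 2 * exp (-((1 / 2) ^ 2 / (2 * (1 / (16 * (n : ℝ)))))) ≤ exp (-n) := by
    have hexponent : -((1 / 2) ^ 2 / (2 * (1 / (16 * (n : ℝ))))) = -n + -n := by
      field_simp
      norm_num
    have htwo : 2 * exp (-n : ℝ) ≤ 1 := by
      rw [Real.exp_neg, ← div_eq_mul_inv, div_le_one (Real.exp_pos _)]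
      linarith [Real.add_one_le_exp (n : ℝ)]
    rw [hexponent, Real.exp_add, ← mul_assoc]
    exact mul_le_of_le_one_left (Real.exp_pos _).le htwo
  rw [← hcompl, probReal_compl_eq_one_sub
    (measurableSet_lt (measurable_response W) measurable_const)] at htail
  linarith

instance measurableSingletonClass_intUnits : MeasurableSingletonClass ℤˣ :=
  ⟨fun a => ⟨{(a : ℤ)}, measurableSet_singleton _, by ext b; simp [Units.ext_iff]⟩⟩

instance isProbabilityMeasure_testLaw [NeZero n] (σ : ℝ) :
    IsProbabilityMeasure (testLaw n d σ) := by
  have : IsProbabilityMeasure (uniformOn (Set.univ : Set ℤˣ)) :=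
    isProbabilityMeasure_uniformOn Set.finite_univ Set.univ_nonempty
  have : IsProbabilityMeasure (uniformOn (Set.univ : Set (Fin n))) :=
    isProbabilityMeasure_uniformOn Set.finite_univ Set.univ_nonempty
  unfold testLaw
  infer_instance

lemma testLaw_real_prod (σ : ℝ) (a : ℤˣ) (i : Fin n) (G : Set (Patch d)) :
    (testLaw n d σ).real ({a} ×ˢ {i} ×ˢ G) = 1 / 2 * (1 / n * (gaussianPatch d σ).real G) := by
  rw [testLaw, measureReal_prod_prod, measureReal_prod_prod, measureReal_def,
    measureReal_def (s := {i}), uniformOn_univ, uniformOn_univ, Measure.count_singleton,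
    Measure.count_singleton]
  simp

lemma lab_mul_net_add_neg {W : Weights m d} {a : ℤˣ} {u v ζ : Patch d}
    (hmargin : lab a * net W (u, v) ≤ -1) (hζ : response W ζ < 1) :
    lab a * net W (u, v + ζ) < 0 := by
  have hperturb : |lab a * (net W (u, v + ζ) - net W (u, v))| < 1 := by
    rw [abs_mul, abs_lab, one_mul]
    exact (abs_net_sub_le W u v ζ).trans_lt hζ
  linarith [(abs_lt.1 hperturb).2]

lemma card_mul_le_testError {σ : ℝ} {μ : Patch d} {ξ : Fin n → Patch d} {W : Weights m d}
    (y : Fin n → ℤˣ) (S : Finset (Fin n))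
    (hS : ∀ i ∈ S, lab (y i) * net W (lab (y i) • μ, ξ i) ≤ -1) :
    S.card * (1 / 2 * (1 / n * (gaussianPatch d σ).real {ζ | response W ζ < 1})) ≤
      testError μ σ ξ W := by
  rcases S.eq_empty_or_nonempty with rfl | ⟨i₀, -⟩
  · simp [testError]
  have : NeZero n := ⟨i₀.pos.ne'⟩
  let T : Fin n → Set (ℤˣ × Fin n × Patch d) := fun i => {y i} ×ˢ {i} ×ˢ {ζ | response W ζ < 1}
  have hdisjoint : (S : Set (Fin n)).PairwiseDisjoint T := by
    intro i _ k _ hik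
    rw [Function.onFun, Set.disjoint_left]
    rintro p ⟨-, hi, -⟩ ⟨-, hk, -⟩
    exact hik (hi.symm.trans hk)
  have hT : ∀ i ∈ S, MeasurableSet (T i) := fun i _ =>
    (measurableSet_singleton _).prod ((measurableSet_singleton _).prod
      (measurableSet_lt (measurable_response W) measurable_const))
  calc S.card * (1 / 2 * (1 / n * (gaussianPatch d σ).real {ζ | response W ζ < 1}))
      = ∑ i ∈ S, (testLaw n d σ).real (T i) := by simp [T, testLaw_real_prod]
    _ = (testLaw n d σ).real (⋃ i ∈ S, T i) := (measureReal_biUnion_finset hdisjoint hT).symm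
    _ ≤ testError μ σ ξ W := by
        refine measureReal_mono fun p hp => ?_
        obtain ⟨i, hi, hy, hindex, hζ⟩ := Set.mem_iUnion₂.1 hp
        rw [Set.mem_singleton_iff] at hy hindex
        rw [Set.mem_ofPred_eq, hy, hindex]
        exact lab_mul_net_add_neg (hS i hi) hζ

end Test

namespace LabelCounts

variable {n : ℕ} {y yt : Fin n → ℤˣ} {τp τm : ℝ}

lemma card_noisy (hL : LabelCounts y yt τp τm) :
    (({i | yt i ≠ y i} : Finset (Fin n)).card : ℝ) = (τp + τm) * n / 2 := by
  have hsplit : (({i | yt i ≠ y i} : Finset (Fin n)).card : ℝ) =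
      ({i | y i = 1 ∧ yt i ≠ y i} : Finset (Fin n)).card +
        ({i | y i = -1 ∧ yt i ≠ y i} : Finset (Fin n)).card := by
    simp only [Finset.card_filter, Nat.cast_sum, ← Finset.sum_add_distrib]
    refine Finset.sum_congr rfl fun i _ => ?_
    rcases Int.units_eq_one_or (y i) with h | h <;> simp [h]
  rw [hsplit, hL.pos_noisy, hL.neg_noisy]
  ring

lemma populated (hL : LabelCounts y yt τp τm) {p : ℝ} (hp0 : 0 < p)
    (hp : 2 * p ≤ min τp (1 - τp)) (hm : 2 * p ≤ min τm (1 - τm)) :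
    Populated y (fun i => yt i * y i) p := by
  have clean_iff (i : Fin n) : yt i * y i = 1 ↔ yt i = y i := by
    rcases Int.units_eq_one_or (y i) with h | h <;>
      rcases Int.units_eq_one_or (yt i) with h' | h' <;> simp [h, h']
  have noisy_iff (i : Fin n) : yt i * y i = -1 ↔ yt i ≠ y i := by
    rcases Int.units_eq_one_or (y i) with h | h <;>
      rcases Int.units_eq_one_or (yt i) with h' | h' <;> simp [h, h']
  have fraction_le {q : ℝ} (hq : 2 * p ≤ q) : p * n ≤ q * n / 2 := by
    linarith [mul_le_mul_of_nonneg_right hq (Nat.cast_nonneg n)]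
  rw [le_min_iff] at hp hm
  refine ⟨hp0, fun c σ => ?_⟩
  rw [Fintype.card_fin]
  rcases Int.units_eq_one_or c with rfl | rfl <;> rcases Int.units_eq_one_or σ with rfl | rfl
  · simpa only [clean_iff, hL.pos_clean] using fraction_le hp.2
  · simpa only [noisy_iff, hL.pos_noisy] using fraction_le hp.1
  · simpa only [clean_iff, hL.neg_clean] using fraction_le hm.2
  · simpa only [noisy_iff, hL.neg_noisy] using fraction_le hm.1

lemma four_le (hL : LabelCounts y yt τp τm) (hn : 0 < n) (hτ : τp ∈ Set.Ioo 0 1) :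
    (4 : ℝ) ≤ n := by
  have : (0 : ℝ) < n := Nat.cast_pos.2 hn
  have one_le {A : Finset (Fin n)} {q : ℝ} (hA : (A.card : ℝ) = q * n / 2) (hq : 0 < q) :
      1 ≤ q * n / 2 := by
    have hpos : (0 : ℝ) < A.card := by rw [hA]; positivity
    rw [← hA]
    exact_mod_cast Nat.cast_pos.1 hpos
  linarith [one_le hL.pos_noisy hτ.1, one_le hL.pos_clean (sub_pos.2 hτ.2)]

lemma two_div_le_abs_sub (hL : LabelCounts y yt τp τm) (hn : 0 < n) (hne : τp ≠ τm) :
    2 / n ≤ |τp - τm| := by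
  have : (0 : ℝ) < n := Nat.cast_pos.2 hn
  have hp := hL.pos_noisy
  have hm := hL.neg_noisy
  set a := ({i | y i = 1 ∧ yt i ≠ y i} : Finset (Fin n)).card
  set b := ({i | y i = -1 ∧ yt i ≠ y i} : Finset (Fin n)).card
  have hsub : τp - τm = 2 / n * ((a : ℤ) - (b : ℤ) : ℤ) := by
    push_cast
    rw [hp, hm]
    field_simp
  have hne' : (a : ℤ) - b ≠ 0 := fun h => hne <| sub_eq_zero.1 <| by rw [hsub, h]; simp
  have hone : (1 : ℝ) ≤ |(((a : ℤ) - (b : ℤ) : ℤ) : ℝ)| := by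
    exact_mod_cast Int.one_le_abs hne'
  rw [hsub, abs_mul, abs_of_pos (by positivity)]
  exact le_mul_of_one_le_right (by positivity) hone

lemma two_mul_min_add_le (hL : LabelCounts y yt τp τm) (hn : 0 < n) (hne : τp ≠ τm) :
    2 * min τp τm + 2 / n ≤ τp + τm := by
  linarith [hL.two_div_le_abs_sub hn hne, max_sub_min_eq_abs' τp τm, min_add_max τp τm]

end LabelCounts

lemma one_le_log_div {x δ : ℝ} (hx : 4 ≤ x) (hδ : 0 < δ) (hδ1 : δ < 1) : 1 ≤ log (x / δ) := by
  have hx4 : 4 ≤ x / δ := (le_div_iff₀ hδ).2 (by linarith)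
  rw [Real.le_log_iff_exp_le (by linarith)]
  linarith [Real.exp_one_lt_d9]

lemma exp_neg_le_div_pow {k : ℕ} {x δ e : ℝ} (hx : 0 < x) (hδ : 0 < δ)
    (he : k * log (x / δ) ≤ e) : exp (-e) ≤ (δ / x) ^ k := by
  have hdiv : δ / x = exp (-log (x / δ)) := by
    rw [Real.exp_neg, Real.exp_log (by positivity), inv_div]
  rw [hdiv, ← Real.exp_nat_mul, Real.exp_le_exp]
  linarith

lemma mul_div_pow_four_le {q δ a e : ℝ} (hq : 100 ≤ q) (hδ : 0 < δ) (hδ1 : δ < 1) (ha : 0 ≤ a)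
    (haq : a ≤ q ^ 2) (he : e ≤ (δ / q) ^ 4) : a * e ≤ δ / 100 := by
  have : 0 < q := by linarith
  have hδ4 : δ ^ 4 ≤ δ := pow_le_of_le_one hδ.le hδ1.le (by norm_num)
  have hq2 : 100 ≤ q ^ 2 := by nlinarith
  calc a * e ≤ a * (δ / q) ^ 4 := by gcongr
    _ ≤ q ^ 2 * (δ / q) ^ 4 := by gcongr
    _ = δ ^ 4 / q ^ 2 := by field_simp
    _ ≤ δ / 100 := by gcongr

lemma union_bound_le {n m δ e₁ e₂ e₃ e₄ e₅ e₆ : ℝ} (hn : 4 ≤ n) (hm : 100 ≤ m) (hδ : 0 < δ)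
    (hδ1 : δ < 1) (he₁ : e₁ ≤ (δ / (n * m)) ^ 4) (he₂ : e₂ ≤ (δ / (n * m)) ^ 4)
    (he₃ : e₃ ≤ (δ / (n * m)) ^ 4) (he₄ : e₄ ≤ (δ / (n * m)) ^ 4) (he₅ : e₅ ≤ (δ / m) ^ 2)
    (he₆ : e₆ ≤ (δ / n) ^ 4) :
    n * (2 * e₁) + 2 * m * (2 * e₁) + n * n * (2 * e₂) + n * (2 * e₃) + 2 * m * n * (2 * e₄) +
      2 * m * (2 * e₅) + n * e₆ ≤ δ := by
  have hn0 : 0 < n := by linarith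
  have hm0 : 0 < m := by linarith
  have hnq : n ≤ n * m := le_mul_of_one_le_right hn0.le (by linarith)
  have hmq : m ≤ n * m := le_mul_of_one_le_left hm0.le (by linarith)
  have hq : 100 ≤ n * m := hm.trans hmq
  have hqq : n * m ≤ (n * m) ^ 2 := by nlinarith
  have hnnq : n * n ≤ (n * m) ^ 2 := by nlinarith
  have small {a e : ℝ} := mul_div_pow_four_le (a := a) (e := e) hq hδ hδ1
  have hme₅ : m * e₅ ≤ δ / 100 := calc
    m * e₅ ≤ m * (δ / m) ^ 2 := by gcongr
    _ = δ ^ 2 / m := by field_simp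
    _ ≤ δ / 100 := by gcongr; exact pow_le_of_le_one hδ.le hδ1.le two_ne_zero
  have hne₆ : n * e₆ ≤ δ / 64 := calc
    n * e₆ ≤ n * (δ / n) ^ 4 := by gcongr
    _ = δ ^ 4 / n ^ 3 := by field_simp
    _ ≤ δ / 4 ^ 3 := by gcongr; exact pow_le_of_le_one hδ.le hδ1.le four_ne_zero
    _ = δ / 64 := by norm_num
  linarith [small hn0.le (hnq.trans hqq) he₁, small hm0.le (hmq.trans hqq) he₁,
    small (by positivity) hnnq he₂, small hn0.le (hnq.trans hqq) he₃,
    small (mul_pos hm0 hn0).le (by rwa [mul_comm m n]) he₄]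

/-- A weakening of `Condition` which asks neither for a large signal nor for a large sample, only
bounds the step size through `η σξ² d ≤ C⁻¹ n`, and keeps one of the two bounds on the dimension.
The parameter `T` plays the part of `Tstar`. -/
structure WeakCondition (C c₁ c₂ T : ℝ) (n m d : ℕ) (μ : Patch d) (σξ σ0 η δ : ℝ) : Prop where
  σξ_pos : 0 < σξ
  σ0_pos : 0 < σ0
  η_pos : 0 < η
  δ_pos : 0 < δ
  δ_lt : δ < 1
  snr_mem : n * snr μ σξ ^ 2 ∈ Set.Icc c₁ c₂
  dim_large : C * ((n : ℝ) ^ 2 * log (n * m / δ) * log T ^ 2) ≤ d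
  width_large : C * log (n / δ) ≤ m
  init_small : σ0 ≤ C⁻¹ * min (√(n : ℝ) * σξ⁻¹ * (d : ℝ)⁻¹) (‖μ‖⁻¹ * (√(log (m / δ)))⁻¹)
  step_small : η ≤ C⁻¹ * ((σξ ^ 2)⁻¹ * (d : ℝ)⁻¹ * n)

lemma Condition.weak {C c₁ c₂ τlo τhi T σξ σ0 η τp τm δ : ℝ} {n m d : ℕ} {μ : Patch d}
    (H : Condition C c₁ c₂ τlo τhi T n m d μ σξ σ0 η τp τm δ) (hC : 0 ≤ C) :
    WeakCondition C c₁ c₂ T n m d μ σξ σ0 η δ where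
  __ := H
  dim_large := (mul_le_mul_of_nonneg_left (le_max_left _ _) hC).trans H.dim_large
  step_small := H.step_small.trans (mul_le_mul_of_nonneg_left (min_le_right _ _) (inv_nonneg.2 hC))

namespace WeakCondition

variable {C c₁ c₂ T σξ σ0 η δ : ℝ} {n m d : ℕ} {μ : Patch d}
  (H : WeakCondition C c₁ c₂ T n m d μ σξ σ0 η δ) (hc₁ : 0 < c₁) (hn : (4 : ℝ) ≤ n)
  (hC : 100 ≤ C)

include H

lemma one_le_log_n (hn : (4 : ℝ) ≤ n) : 1 ≤ log (n / δ) := one_le_log_div hn H.δ_pos H.δ_lt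

lemma le_m (hn : (4 : ℝ) ≤ n) (hC : 0 ≤ C) : C ≤ m :=
  (le_mul_of_one_le_right hC (H.one_le_log_n hn)).trans H.width_large

section

include hn hC

lemma one_le_log_m : 1 ≤ log (m / δ) :=
  one_le_log_div (by linarith [H.le_m hn (by linarith)]) H.δ_pos H.δ_lt

lemma one_le_log_nm : 1 ≤ log (n * m / δ) :=
  one_le_log_div (by nlinarith [H.le_m hn (by linarith)]) H.δ_pos H.δ_lt

lemma mul_sq_mul_log_le (hT : 1 ≤ log T) : C * ((n : ℝ) ^ 2 * log (n * m / δ)) ≤ d := by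
  have hω := H.one_le_log_nm hn hC
  have hT2 : 1 ≤ log T ^ 2 := one_le_pow₀ hT
  exact le_trans (mul_le_mul_of_nonneg_left (le_mul_of_one_le_right (by positivity) hT2)
    (by linarith)) H.dim_large

end

section

include hc₁

lemma n_pos : 0 < n := by
  refine Nat.pos_of_ne_zero fun h => hc₁.not_ge ?_
  simpa [h] using H.snr_mem.1

lemma snr_ne_zero : snr μ σξ ≠ 0 := fun h => hc₁.not_ge <| by simpa [h] using H.snr_mem.1

lemma d_pos : (0 : ℝ) < d := by
  refine Nat.cast_pos.2 <| Nat.pos_of_ne_zero fun h => H.snr_ne_zero hc₁ ?_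
  simp [snr, h]

lemma norm_μ_pos : 0 < ‖μ‖ :=
  norm_pos_iff.2 fun h => H.snr_ne_zero hc₁ <| by simp [snr, h]

lemma signal_bounds :
    c₁ * (σξ ^ 2 * d) ≤ n * ‖μ‖ ^ 2 ∧ n * ‖μ‖ ^ 2 ≤ c₂ * (σξ ^ 2 * d) := by
  have hσ := H.σξ_pos
  have hd := H.d_pos hc₁
  have hsnr : n * snr μ σξ ^ 2 = n * ‖μ‖ ^ 2 / (σξ ^ 2 * d) := by
    rw [snr, div_pow, mul_pow, Real.sq_sqrt hd.le, mul_div_assoc]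
  have hmem := H.snr_mem
  rwa [hsnr, Set.mem_Icc, le_div_iff₀ (by positivity), div_le_iff₀ (by positivity)] at hmem

lemma mul_rate_le (hn : (4 : ℝ) ≤ n) (hC : 100 ≤ C) :
    C * (η * (σξ ^ 2 * d) / (n * m)) ≤ 1 := by
  have hσ := H.σξ_pos
  have hd := H.d_pos hc₁
  have hm := H.le_m hn (by linarith)
  have hm0 : (0 : ℝ) < m := by linarith
  have : 0 < C := by linarith
  calc C * (η * (σξ ^ 2 * d) / (n * m))
      ≤ C * (C⁻¹ * ((σξ ^ 2)⁻¹ * (d : ℝ)⁻¹ * n) * (σξ ^ 2 * d) / (n * m)) := by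
        gcongr
        exact H.step_small
    _ = 1 / (m : ℝ) := by field_simp
    _ ≤ 1 := by rw [div_le_one hm0]; linarith

lemma sq_mul_init_noise_le (hC : 100 ≤ C) : C ^ 2 * (σ0 ^ 2 * (σξ ^ 2 * d)) * d ≤ n := by
  have hσ := H.σξ_pos
  have hσ0 := H.σ0_pos
  have hd := H.d_pos hc₁
  have : 0 < C := by linarith
  have hinit : σ0 ≤ C⁻¹ * (√(n : ℝ) * σξ⁻¹ * (d : ℝ)⁻¹) :=
    H.init_small.trans (by gcongr; exact min_le_left _ _)
  calc C ^ 2 * (σ0 ^ 2 * (σξ ^ 2 * d)) * d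
      ≤ C ^ 2 * ((C⁻¹ * (√(n : ℝ) * σξ⁻¹ * (d : ℝ)⁻¹)) ^ 2 * (σξ ^ 2 * d)) * d := by gcongr
    _ = √(n : ℝ) ^ 2 := by field_simp
    _ = n := Real.sq_sqrt n.cast_nonneg

end

include hn hC

lemma mul_init_noise_le (hc₁ : 0 < c₁) (hT : 1 ≤ log T) :
    C * (σ0 ^ 2 * (σξ ^ 2 * d) * (n * log (n * m / δ))) ≤ 1 := by
  have hσ := H.σξ_pos
  have hσ0 := H.σ0_pos
  have hd := H.d_pos hc₁
  have hω := H.one_le_log_nm hn hC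
  have hn0 : (0 : ℝ) < n := by linarith
  refine le_of_mul_le_mul_right ?_ hn0
  calc C * (σ0 ^ 2 * (σξ ^ 2 * d) * (n * log (n * m / δ))) * n
      = 1 ^ 2 * (σ0 ^ 2 * (σξ ^ 2 * d)) * (C * ((n : ℝ) ^ 2 * log (n * m / δ))) := by ring
    _ ≤ C ^ 2 * (σ0 ^ 2 * (σξ ^ 2 * d)) * d := by
        gcongr
        · linarith
        · exact H.mul_sq_mul_log_le hn hC hT
    _ ≤ 1 * n := by linarith [H.sq_mul_init_noise_le hc₁ hC]

lemma mul_init_signal_le (hc₁ : 0 < c₁) : C * (σ0 ^ 2 * ‖μ‖ ^ 2 * log (m / δ)) ≤ 1 := by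
  have hσ0 := H.σ0_pos
  have hμ := H.norm_μ_pos hc₁
  have hl := H.one_le_log_m hn hC
  have hl0 : 0 < log (m / δ) := by linarith
  have : 0 < C := by linarith
  have hinit : σ0 ≤ C⁻¹ * (‖μ‖⁻¹ * (√(log (m / δ)))⁻¹) :=
    H.init_small.trans (by gcongr; exact min_le_right _ _)
  calc C * (σ0 ^ 2 * ‖μ‖ ^ 2 * log (m / δ))
      ≤ C * ((C⁻¹ * (‖μ‖⁻¹ * (√(log (m / δ)))⁻¹)) ^ 2 * ‖μ‖ ^ 2 * √(log (m / δ)) ^ 2) := by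
        rw [Real.sq_sqrt hl0.le]
        gcongr
    _ = C⁻¹ := by field_simp
    _ ≤ 1 := inv_le_one_of_one_le₀ (by linarith)

section Failure

variable {ν a : ℝ}

lemma noise_exponent (hc₁ : 0 < c₁) (ha : 0 < a) (hT : 1 ≤ log T) {N k : ℝ}
    (hN0 : 0 < N) (hN : N ≤ k * (σξ ^ 2 * d)) (hk : 8 * k * a ^ 2 ≤ C * ν ^ 2) :
    4 * log (n * m / δ) ≤
      (ν * (σξ ^ 2 * d) / (n * (a * log T))) ^ 2 / (2 * (σξ ^ 2 * N)) := by
  have hσ := H.σξ_pos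
  have hd := H.d_pos hc₁
  have hdim := H.dim_large
  have hω := H.one_le_log_nm hn hC
  have : (0 : ℝ) < n := by linarith
  set ω := log (n * m / δ)
  set L := log T
  have : 0 < L := by linarith
  set q := σξ ^ 2 * (σξ ^ 2 * d) / (n * (a * L)) ^ 2 with hq
  have : 0 ≤ q := by positivity
  rw [le_div_iff₀ (by positivity)]
  calc 4 * ω * (2 * (σξ ^ 2 * N)) ≤ 4 * ω * (2 * (σξ ^ 2 * (k * (σξ ^ 2 * d)))) := by gcongr
    _ = 8 * k * a ^ 2 * ((n : ℝ) ^ 2 * ω * L ^ 2) * q := by rw [hq]; field_simp; ring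
    _ ≤ C * ν ^ 2 * ((n : ℝ) ^ 2 * ω * L ^ 2) * q := by gcongr
    _ = ν ^ 2 * (C * ((n : ℝ) ^ 2 * ω * L ^ 2)) * q := by ring
    _ ≤ ν ^ 2 * d * q := by gcongr
    _ = (ν * (σξ ^ 2 * d) / (n * (a * L))) ^ 2 := by rw [hq]; ring

omit hn hC H in
lemma sixteen_mul_le_sq {x : ℝ} (hx0 : 0 ≤ x) (hx : C * x ≤ 1) (hν : 16 ≤ C * ν ^ 2) :
    16 * x ≤ ν ^ 2 := by
  linarith [mul_le_mul_of_nonneg_right hν hx0, mul_le_mul_of_nonneg_left hx (sq_nonneg ν)]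

lemma init_noise_exponent (hc₁ : 0 < c₁) (hT : 1 ≤ log T) (hν : 16 ≤ C * ν ^ 2) :
    4 * log (n * m / δ) ≤ ν ^ 2 / (2 * (σ0 ^ 2 * (2 * (σξ ^ 2 * d)))) := by
  have hσ := H.σξ_pos
  have hσ0 := H.σ0_pos
  have hd := H.d_pos hc₁
  have hω := H.one_le_log_nm hn hC
  have hsmall : 16 * (σ0 ^ 2 * (σξ ^ 2 * d) * (n * log (n * m / δ))) ≤ ν ^ 2 :=
    sixteen_mul_le_sq (by positivity) (H.mul_init_noise_le hn hC hc₁ hT) hν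
  rw [le_div_iff₀ (by positivity)]
  calc 4 * log (n * m / δ) * (2 * (σ0 ^ 2 * (2 * (σξ ^ 2 * d))))
      = 16 * (σ0 ^ 2 * (σξ ^ 2 * d) * (1 * log (n * m / δ))) := by ring
    _ ≤ 16 * (σ0 ^ 2 * (σξ ^ 2 * d) * (n * log (n * m / δ))) := by gcongr; linarith
    _ ≤ ν ^ 2 := hsmall

lemma init_signal_exponent (hc₁ : 0 < c₁) (hν : 16 ≤ C * ν ^ 2) :
    2 * log (m / δ) ≤ ν ^ 2 / (2 * (σ0 ^ 2 * ‖μ‖ ^ 2)) := by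
  have hσ0 := H.σ0_pos
  have hμ := H.norm_μ_pos hc₁
  have hl := H.one_le_log_m hn hC
  have hx0 : 0 ≤ σ0 ^ 2 * ‖μ‖ ^ 2 * log (m / δ) := by positivity
  rw [le_div_iff₀ (by positivity)]
  linarith [sixteen_mul_le_sq hx0 (H.mul_init_signal_le hn hC hc₁) hν]

lemma failureBound_le (hc₁ : 0 < c₁) (ha : 0 < a) (hT : 1 ≤ log T)
    (hνa : 16 * a ^ 2 ≤ C * ν ^ 2) (hνc : 8 * c₂ * a ^ 2 ≤ C * ν ^ 2) (hν : 16 ≤ C * ν ^ 2) :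
    failureBound n m d μ σ0 σξ (ν * (σξ ^ 2 * d) / (n * (a * log T))) ν ≤ δ := by
  have hσ := H.σξ_pos
  have hd := H.d_pos hc₁
  have hμ := H.norm_μ_pos hc₁
  have hm := H.le_m hn (by linarith)
  have hω := H.one_le_log_nm hn hC
  have hn0 : (0 : ℝ) < n := by linarith
  have hm0 : (0 : ℝ) < m := by linarith
  have hsignal : ‖μ‖ ^ 2 ≤ c₂ * (σξ ^ 2 * d) :=
    (le_mul_of_one_le_left (by positivity) (by linarith)).trans (H.signal_bounds hc₁).2
  have hdim : 4 * log (n * m / δ) ≤ d / 16 := by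
    have hn2 : log (n * m / δ) ≤ (n : ℝ) ^ 2 * log (n * m / δ) :=
      le_mul_of_one_le_left (by linarith) (one_le_pow₀ (by linarith))
    have hC100 : 100 * ((n : ℝ) ^ 2 * log (n * m / δ)) ≤ C * ((n : ℝ) ^ 2 * log (n * m / δ)) := by
      gcongr
    linarith [H.mul_sq_mul_log_le hn hC hT]
  have hwidth : 4 * log (n / δ) ≤ m / 8 := by
    have hC100 : 100 * log (n / δ) ≤ C * log (n / δ) := by
      have := H.one_le_log_n hn
      gcongr
    linarith [H.width_large, H.one_le_log_n hn]
  have tail_nm {e : ℝ} (he : 4 * log (n * m / δ) ≤ e) : exp (-e) ≤ (δ / (n * m)) ^ 4 :=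
    exp_neg_le_div_pow (mul_pos hn0 hm0) H.δ_pos (mod_cast he)
  exact union_bound_le hn (hC.trans hm) H.δ_pos H.δ_lt (tail_nm hdim)
    (tail_nm (H.noise_exponent hn hC hc₁ ha hT (by positivity) le_rfl (by linarith)))
    (tail_nm (H.noise_exponent hn hC hc₁ ha hT (by positivity) hsignal hνc))
    (tail_nm (H.init_noise_exponent hn hC hc₁ hT hν))
    (exp_neg_le_div_pow hm0 H.δ_pos (mod_cast H.init_signal_exponent hn hC hc₁ hν))
    (exp_neg_le_div_pow hn0 H.δ_pos (mod_cast hwidth))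

end Failure

end WeakCondition

/-- The size `ν` of the negligible terms. -/
def noiseLevel (c₁ c₂ p : ℝ) : ℝ := 1 / (16 * (3 + 1 / c₁) + 4 * exp (Run.gap c₂ p + 1))

/-- The constant in front of `log T*` in the bound on the coefficients. -/
def coeffConst (c₂ p : ℝ) : ℝ :=
  (16 + 8 * c₂ * exp (Run.gap c₂ p + 1)) * (2 * (1 + log (1 + 4 * exp (Run.gap c₂ p + 1 / 2))))

/-- A choice of the constant `κ` in `T*`: gradient descent reaches loss `ε` and outlasts the first
stage, whose length is governed by `κ₁`. -/
def timeConst (κ₁ c₂ p : ℝ) : ℝ := 4 * (16 * exp (2 * Run.gap c₂ p + 3) + κ₁ + 1)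

/-- The requirements on the large constant `C` of the standing condition. -/
structure LargeConst (C c₁ c₂ p : ℝ) : Prop where
  hundred_le : 100 ≤ C
  signal_step : c₂ ≤ C * Run.patchError (noiseLevel c₁ c₂ p) c₁
  small_step : 4 * (2 + 4 * c₂) ≤ C
  noise_noise : 16 * coeffConst c₂ p ^ 2 ≤ C * noiseLevel c₁ c₂ p ^ 2
  signal_noise : 8 * c₂ * coeffConst c₂ p ^ 2 ≤ C * noiseLevel c₁ c₂ p ^ 2
  init : 16 ≤ C * noiseLevel c₁ c₂ p ^ 2
  weight : 16 * (4 + (4 / c₁ + 8) * coeffConst c₂ p ^ 2) ≤ C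

section Constants

variable {c₁ c₂ p : ℝ}

lemma noiseLevel_pos (hc₁ : 0 < c₁) : 0 < noiseLevel c₁ c₂ p := by
  unfold noiseLevel
  positivity

lemma patchError_noiseLevel_le (hc₁ : 0 < c₁) :
    Run.patchError (noiseLevel c₁ c₂ p) c₁ ≤ 1 / 16 := by
  rw [Run.patchError, noiseLevel, one_div_mul_eq_div, div_le_div_iff₀ (by positivity) (by norm_num)]
  linarith [Real.exp_pos (Run.gap c₂ p + 1)]

lemma four_mul_exp_mul_noiseLevel_le (hc₁ : 0 < c₁) :
    4 * exp (Run.gap c₂ p + 1) * noiseLevel c₁ c₂ p ≤ 1 := by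
  rw [noiseLevel, mul_one_div, div_le_one (by positivity)]
  exact le_add_of_nonneg_left (by positivity)

lemma one_le_coeffConst (hc₂ : 0 ≤ c₂) : 1 ≤ coeffConst c₂ p := by
  have hlog : 0 ≤ log (1 + 4 * exp (Run.gap c₂ p + 1 / 2)) :=
    Real.log_nonneg (le_add_of_nonneg_right (by positivity))
  have hexp : 0 ≤ 8 * c₂ * exp (Run.gap c₂ p + 1) := by positivity
  exact one_le_mul_of_one_le_of_one_le (by linarith) (by linarith)

lemma mul_log_le_coeffConst_mul {s T : ℝ} (hc₂ : 0 ≤ c₂) (hs : 0 ≤ s) (hsT : s ≤ T)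
    (hT : 1 ≤ T) (hlogT : 1 ≤ log T) :
    (16 + 8 * c₂ * exp (Run.gap c₂ p + 1)) *
        (2 * log (1 + 4 * exp (Run.gap c₂ p + 1 / 2) * s)) ≤ coeffConst c₂ p * log T := by
  set A := 4 * exp (Run.gap c₂ p + 1 / 2)
  have hA : 0 < A := by positivity
  have hlogA : 0 ≤ log (1 + A) := Real.log_nonneg (by linarith)
  have hlog : log (1 + A * s) ≤ (1 + log (1 + A)) * log T := calc
    log (1 + A * s) ≤ log ((1 + A) * T) := by
      refine Real.log_le_log (by positivity) ?_
      linarith [mul_le_mul_of_nonneg_left hsT hA.le]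
    _ = log T + log (1 + A) * 1 := by rw [Real.log_mul (by positivity) (by positivity)]; ring
    _ ≤ log T + log (1 + A) * log T := by gcongr
    _ = (1 + log (1 + A)) * log T := by ring
  calc (16 + 8 * c₂ * exp (Run.gap c₂ p + 1)) * (2 * log (1 + A * s))
      ≤ (16 + 8 * c₂ * exp (Run.gap c₂ p + 1)) * (2 * ((1 + log (1 + A)) * log T)) := by gcongr
    _ = coeffConst c₂ p * log T := by rw [coeffConst]; ring

lemma exists_largeConst (hc₁ : 0 < c₁) : ∃ C, LargeConst C c₁ c₂ p := by
  have hν : 0 < noiseLevel c₁ c₂ p := noiseLevel_pos hc₁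
  have hpatch : 0 < Run.patchError (noiseLevel c₁ c₂ p) c₁ := by
    unfold Run.patchError
    positivity
  have h : ∀ᶠ C in Filter.atTop, LargeConst C c₁ c₂ p := by
    have large {x y : ℝ} (hy : 0 < y) : ∀ᶠ C in Filter.atTop, x ≤ C * y := by
      filter_upwards [Filter.eventually_ge_atTop (x / y)] with C hC
      exact (div_le_iff₀ hy).1 hC
    filter_upwards [Filter.eventually_ge_atTop 100, large hpatch, Filter.eventually_ge_atTop _,
      large (pow_pos hν 2), large (pow_pos hν 2), large (pow_pos hν 2),
      Filter.eventually_ge_atTop _] with C h₁ h₂ h₃ h₄ h₅ h₆ h₇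
    exact ⟨h₁, h₂, h₃, h₄, h₅, h₆, h₇⟩
  exact h.exists

end Constants

section TimeScale

lemma stageOneScale_eq (n m d : ℕ) (σξ η : ℝ) :
    stageOneScale n m d σξ η = (η * (σξ ^ 2 * d) / (n * m))⁻¹ := by
  rw [stageOneScale, inv_div, div_eq_mul_inv, mul_inv, mul_inv]
  ring

lemma mul_stageOneScale_le_maxIter {κ ε : ℝ} (hκ : 0 ≤ κ) (hε : 0 < ε) {n m d : ℕ} {σξ η : ℝ}
    (hS : 0 ≤ stageOneScale n m d σξ η) :
    κ / 4 * ((min ε 1)⁻¹ * stageOneScale n m d σξ η) ≤ maxIter κ ε n m d σξ η := by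
  have hε₁ : 0 < min ε 1 := lt_min hε one_pos
  have htwo : 2 ≤ 2 / min ε 1 := (le_div_iff₀ hε₁).2 (by linarith [min_le_right ε 1])
  have hlog : 1 / 2 ≤ log (2 / min ε 1) := by
    linarith [Real.log_le_log (by norm_num) htwo, Real.log_two_gt_d9]
  calc κ / 4 * ((min ε 1)⁻¹ * stageOneScale n m d σξ η)
      = κ * ((min ε 1)⁻¹ * stageOneScale n m d σξ η) * (1 / 2) ^ 2 := by ring
    _ ≤ maxIter κ ε n m d σξ η := by unfold maxIter; gcongr

variable {A κ₁ e h T : ℝ}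

lemma mul_inv_le_of_scale_le (hA : 0 ≤ A) (hκ₁ : 0 ≤ κ₁) (he : 0 < e) (he1 : e ≤ 1) (hh : 0 < h)
    (hT : (A + κ₁ + 1) * (e⁻¹ * h⁻¹) ≤ T) : (κ₁ + 1) * h⁻¹ ≤ T := by
  refine le_trans ?_ hT
  gcongr
  · linarith
  · exact le_mul_of_one_le_left (by positivity) ((one_le_inv₀ he).2 he1)

lemma le_mul_floor_of_scale_le (hκ₁ : 0 ≤ κ₁) (he : 0 < e) (he1 : e ≤ 1) (hh : 0 < h)
    (hh1 : h ≤ 1) (hT : (A + κ₁ + 1) * (e⁻¹ * h⁻¹) ≤ T) : A * e⁻¹ ≤ h * ⌊T⌋₊ := by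
  have hinv : 1 ≤ e⁻¹ := (one_le_inv₀ he).2 he1
  have hκe : 0 ≤ κ₁ * e⁻¹ := by positivity
  have hscale : (A + κ₁ + 1) * e⁻¹ ≤ h * (⌊T⌋₊ + 1) := calc
    (A + κ₁ + 1) * e⁻¹ = h * ((A + κ₁ + 1) * (e⁻¹ * h⁻¹)) := by field_simp
    _ ≤ h * (⌊T⌋₊ + 1) := by
      gcongr
      exact hT.trans (Nat.lt_floor_add_one T).le
  linarith

end TimeScale

/-! ### Gradient descent at the time `⌊T*⌋` -/

namespace WeakCondition

variable {C c₁ c₂ T σξ σ0 η δ : ℝ} {n m d : ℕ} {μ : Patch d}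

lemma rate_pos (H : WeakCondition C c₁ c₂ T n m d μ σξ σ0 η δ) (hc₁ : 0 < c₁)
    (hn : (4 : ℝ) ≤ n) (hC : 100 ≤ C) : 0 < η * (σξ ^ 2 * d) / (n * m) := by
  have hσ := H.σξ_pos
  have hη := H.η_pos
  have hd := H.d_pos hc₁
  have : (0 : ℝ) < n := by linarith
  have : (0 : ℝ) < m := by linarith [H.le_m hn (by linarith)]
  positivity

lemma rate_mul_le (H : WeakCondition C c₁ c₂ T n m d μ σξ σ0 η δ) (hc₁ : 0 < c₁)
    (hn : (4 : ℝ) ≤ n) (hC : 100 ≤ C) {x y : ℝ} (hy : 0 ≤ y) (hx : x ≤ C * y) :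
    η * (σξ ^ 2 * d) / (n * m) * x ≤ y := by
  have hrate := (H.rate_pos hc₁ hn hC).le
  calc η * (σξ ^ 2 * d) / (n * m) * x ≤ η * (σξ ^ 2 * d) / (n * m) * (C * y) := by gcongr
    _ = C * (η * (σξ ^ 2 * d) / (n * m)) * y := by ring
    _ ≤ y := mul_le_of_le_one_left hy (H.mul_rate_le hc₁ hn hC)

lemma le_maxIter (H : WeakCondition C c₁ c₂ T n m d μ σξ σ0 η δ) (hc₁ : 0 < c₁)
    (hn : (4 : ℝ) ≤ n) (hC : 100 ≤ C) {κ₁ p ε : ℝ} (hκ₁ : 0 ≤ κ₁) (hε : 0 < ε) :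
    κ₁ * stageOneScale n m d σξ η ≤ maxIter (timeConst κ₁ c₂ p) ε n m d σξ η ∧
      100 ≤ maxIter (timeConst κ₁ c₂ p) ε n m d σξ η ∧
      16 * exp (2 * Run.gap c₂ p + 3) * (min ε 1)⁻¹ ≤
        η * (σξ ^ 2 * d) / (n * m) * ⌊maxIter (timeConst κ₁ c₂ p) ε n m d σξ η⌋₊ := by
  have hrate := H.rate_pos hc₁ hn hC
  have hmul_rate := H.mul_rate_le hc₁ hn hC
  have hscale := stageOneScale_eq n m d σξ η
  set h := η * (σξ ^ 2 * d) / (n * m)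
  set T₀ := maxIter (timeConst κ₁ c₂ p) ε n m d σξ η
  have hε₁ : 0 < min ε 1 := lt_min hε one_pos
  have hT₀ : (16 * exp (2 * Run.gap c₂ p + 3) + κ₁ + 1) * ((min ε 1)⁻¹ * h⁻¹) ≤ T₀ := by
    rw [← hscale]
    convert mul_stageOneScale_le_maxIter (κ := timeConst κ₁ c₂ p) ?_ hε ?_ using 2
    · rw [timeConst, mul_div_cancel_left₀ _ four_ne_zero]
    · unfold timeConst; positivity
    · rw [hscale]; positivity
  have hinv : C ≤ h⁻¹ := by
    rwa [← one_div, le_div_iff₀ hrate]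
  have hmul := mul_inv_le_of_scale_le (by positivity) hκ₁ hε₁ (min_le_right ε 1) hrate hT₀
  have hκh : 0 ≤ κ₁ * h⁻¹ := by positivity
  rw [hscale]
  have hrate1 : h ≤ 1 := (le_mul_of_one_le_left hrate.le (by linarith)).trans hmul_rate
  exact ⟨by linarith, by linarith,
    le_mul_floor_of_scale_le hκ₁ hε₁ (min_le_right ε 1) hrate hrate1 hT₀⟩

lemma sq_mul_weight_le (H : WeakCondition C c₁ c₂ T n m d μ σξ σ0 η δ) (hc₁ : 0 < c₁)
    (hn : (4 : ℝ) ≤ n) (hC : 100 ≤ C) (hT : 1 ≤ log T) {a : ℝ}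
    (ha : 16 * (4 + (4 / c₁ + 8) * a ^ 2) ≤ C) :
    σξ ^ 2 * (2 * (2 * (σ0 ^ 2 * d)) + (4 / c₁ + 8) * (n * (a * log T) ^ 2 / (σξ ^ 2 * d))) ≤
      1 / (16 * n) := by
  have hσ := H.σξ_pos
  have hd := H.d_pos hc₁
  have hω := H.one_le_log_nm hn hC
  have hn0 : (0 : ℝ) < n := by linarith
  have : 0 < C := by linarith
  have hinit : σ0 ^ 2 * (σξ ^ 2 * d) ≤ 1 / (C * n) := by
    rw [le_div_iff₀ (by positivity)]
    calc σ0 ^ 2 * (σξ ^ 2 * d) * (C * n) = C * (σ0 ^ 2 * (σξ ^ 2 * d) * (n * 1)) := by ring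
      _ ≤ C * (σ0 ^ 2 * (σξ ^ 2 * d) * (n * log (n * m / δ))) := by gcongr
      _ ≤ 1 := H.mul_init_noise_le hn hC hc₁ hT
  have hcoeff : n * (a * log T) ^ 2 / d ≤ a ^ 2 / (C * n) := by
    rw [div_le_div_iff₀ hd (by positivity)]
    calc n * (a * log T) ^ 2 * (C * n) = a ^ 2 * (C * ((n : ℝ) ^ 2 * 1 * log T ^ 2)) := by ring
      _ ≤ a ^ 2 * (C * ((n : ℝ) ^ 2 * log (n * m / δ) * log T ^ 2)) := by gcongr
      _ ≤ a ^ 2 * d := by gcongr; exact H.dim_large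
  calc σξ ^ 2 * (2 * (2 * (σ0 ^ 2 * d)) + (4 / c₁ + 8) * (n * (a * log T) ^ 2 / (σξ ^ 2 * d)))
      = 4 * (σ0 ^ 2 * (σξ ^ 2 * d)) + (4 / c₁ + 8) * (n * (a * log T) ^ 2 / d) := by
        field_simp
        ring
    _ ≤ 4 * (1 / (C * n)) + (4 / c₁ + 8) * (a ^ 2 / (C * n)) := by gcongr
    _ = (4 + (4 / c₁ + 8) * a ^ 2) / (C * n) := by ring
    _ ≤ 1 / (16 * n) := by
        rw [div_le_div_iff₀ (by positivity) (by positivity)]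
        linarith [mul_le_mul_of_nonneg_right ha hn0.le]

/-- The level below which the inner products of distinct noise patches and those of the noise with
the signal have to stay. -/
def crossLevel (c₁ c₂ p T : ℝ) (n d : ℕ) (σξ : ℝ) : ℝ :=
  noiseLevel c₁ c₂ p * (σξ ^ 2 * d) / (n * (coeffConst c₂ p * log T))

lemma exists_measurableSet_isTypical {p : ℝ} (H : WeakCondition C c₁ c₂ T n m d μ σξ σ0 η δ)
    (hC : LargeConst C c₁ c₂ p) (hc₁ : 0 < c₁) (hc₂ : 0 ≤ c₂) (hn : (4 : ℝ) ≤ n)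
    (hT : 1 ≤ log T) (yt : Fin n → ℤˣ) :
    ∃ E : Set (Weights m d × (Fin n → Patch d)), MeasurableSet E ∧
      1 - δ ≤ (trainLaw n m d σ0 σξ).real E ∧ ∀ W₀ ξ, (W₀, ξ) ∈ E →
        IsTypical yt μ σ0 σξ (crossLevel c₁ c₂ p T n d σξ) (noiseLevel c₁ c₂ p) W₀ ξ := by
  have hν : 0 < noiseLevel c₁ c₂ p := noiseLevel_pos hc₁
  have ha : 0 < coeffConst c₂ p := one_pos.trans_le (one_le_coeffConst hc₂)
  have hσ := H.σξ_pos
  have hlevel : 0 ≤ crossLevel c₁ c₂ p T n d σξ := by unfold crossLevel; positivity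
  obtain ⟨E, hE, hprob, htypical⟩ := LabelNoise.exists_measurableSet_isTypical (m := m) (σ0 := σ0)
    (σξ := σξ) yt μ hlevel hν.le
  have hfail := H.failureBound_le hn hC.hundred_le hc₁ ha hT hC.noise_noise hC.signal_noise hC.init
  exact ⟨E, hE, by unfold crossLevel at hprob; linarith, htypical⟩

section Run

variable {R : Run n m d} {p : ℝ} (H : WeakCondition C c₁ c₂ T n m d R.μ σξ σ0 R.η δ)
  (hC : LargeConst C c₁ c₂ p) (hc₁ : 0 < c₁) (hc₂ : 0 ≤ c₂) (hn : (4 : ℝ) ≤ n) (hT : 1 ≤ log T)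
  (hR : IsTypical R.yt R.μ σ0 σξ (crossLevel c₁ c₂ p T n d σξ) (noiseLevel c₁ c₂ p) R.W₀ R.ξ)

include H hC hc₁ hc₂ hn hT hR

lemma regular :
    R.Regular (σξ ^ 2 * d) (noiseLevel c₁ c₂ p) (coeffConst c₂ p * log T) c₁ c₂ where
  n_pos := H.n_pos hc₁
  m_pos := by
    have hC0 : 0 < C := by linarith [hC.hundred_le]
    exact_mod_cast hC0.trans_le (H.le_m hn hC0.le)
  η_pos := H.η_pos
  D_pos := mul_pos (pow_pos H.σξ_pos 2) (H.d_pos hc₁)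
  ν_nonneg := (noiseLevel_pos hc₁).le
  Λ_ge := one_le_mul_of_one_le_of_one_le (one_le_coeffConst hc₂) hT
  c₁_pos := hc₁
  patchError_le := patchError_noiseLevel_le hc₁
  signal_lower := (H.signal_bounds hc₁).1
  signal_upper := (H.signal_bounds hc₁).2
  noise_lower i := (hR.noise_norm i).1
  noise_upper i := (hR.noise_norm i).2
  noise_noise := hR.noise_noise
  signal_noise i := by
    rw [real_inner_comm]
    exact hR.noise_signal i
  init_noise := hR.init_noise
  init_signal := hR.init_signal
  active := hR.active

lemma admissible (hT1 : 1 ≤ T) (hpop : Populated R.y R.clean p) :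
    R.Admissible (σξ ^ 2 * d) (noiseLevel c₁ c₂ p) (coeffConst c₂ p * log T) c₁ c₂ p ⌊T⌋₊ where
  toRegular := H.regular hC hc₁ hc₂ hn hT hR
  populated := hpop
  signal_step_le := H.rate_mul_le hc₁ hn hC.hundred_le
    (H.regular hC hc₁ hc₂ hn hT hR).patchError_nonneg hC.signal_step
  step_small := H.rate_mul_le hc₁ hn hC.hundred_le (by norm_num) (by linarith [hC.small_step])
  activity := four_mul_exp_mul_noiseLevel_le hc₁
  coeff_le := by
    have hrate := H.rate_pos hc₁ hn hC.hundred_le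
    have hfloor : (⌊T⌋₊ : ℝ) ≤ C * T := (Nat.floor_le (by linarith)).trans
      (le_mul_of_one_le_left (by linarith) (by linarith [hC.hundred_le]))
    exact mul_log_le_coeffConst_mul hc₂ (mul_nonneg hrate.le (Nat.cast_nonneg _))
      (H.rate_mul_le hc₁ hn hC.hundred_le (by linarith) hfloor) hT1 hT

lemma sq_mul_sq_norm_W_le {t : ℕ} (hctrl : R.Controlled (coeffConst c₂ p * log T) t)
    (j : ℤˣ) (r : Fin m) : σξ ^ 2 * ‖R.W t j r‖ ^ 2 ≤ 1 / (16 * n) := by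
  have hreg := H.regular hC hc₁ hc₂ hn hT hR
  refine le_trans ?_ (H.sq_mul_weight_le hc₁ hn hC.hundred_le hT hC.weight)
  gcongr
  exact (hreg.sq_norm_W_le hctrl j r).trans (by gcongr; exact hR.init_norm j r)

end Run

end WeakCondition

lemma LabelCounts.ncard_memorized_le {n m d : ℕ} {y yt : Fin n → ℤˣ}
    {x : Fin n → Input d} {W : Weights m d} {γ : ℤˣ → Fin m → ℝ} {ρ : ℤˣ → Fin m → Fin n → ℝ}
    {τp τm : ℝ} (hL : LabelCounts y yt τp τm) :
    ((memorized x y yt W γ ρ).ncard : ℝ) ≤ (τp + τm) * n / 2 := by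
  have hsub : memorized x y yt W γ ρ ⊆ ({i | yt i ≠ y i} : Finset (Fin n)) := fun i hi => by
    simpa using (show _ ∧ _ from hi).1
  rw [← hL.card_noisy, ← Set.ncard_coe_finset]
  exact_mod_cast Set.ncard_le_ncard hsub

namespace Run

variable {n m d : ℕ}

lemma net_x (R : Run n m d) (W : Weights m d) (i : Fin n) :
    net W (R.x i) = net W (lab (R.y i) • R.μ, R.ξ i) := by
  unfold x trainInput
  split_ifs
  · rfl
  · simp only [net, branch, add_comm]

section Margin

variable {R : Run n m d} {D ν Λ c₁ c₂ p ε : ℝ} {t : ℕ}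

lemma Admissible.exp_neg_margin_le_of_time_le (H : R.Admissible D ν Λ c₁ c₂ p t) (hε : 0 < ε)
    (ht : 16 * exp (2 * gap c₂ p + 3) * ε⁻¹ ≤ R.rate D * t) (i : Fin n) :
    exp (-R.margin t i) ≤ exp (-2) * ε := by
  have hexp : exp (2 * gap c₂ p + 1) = exp (2 * gap c₂ p + 3) * exp (-2) := by
    rw [← Real.exp_add]
    ring_nf
  have hdecay : 16 * exp (2 * gap c₂ p + 3) * (ε⁻¹ * exp (-R.margin t i)) ≤
      16 * exp (2 * gap c₂ p + 3) * exp (-2) := calc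
    _ = 16 * exp (2 * gap c₂ p + 3) * ε⁻¹ * exp (-R.margin t i) := by ring
    _ ≤ R.rate D * t * exp (-R.margin t i) := by gcongr
    _ ≤ 16 * exp (2 * gap c₂ p + 1) := H.exp_neg_margin_le le_rfl i
    _ = _ := by rw [hexp]; ring
  have hcancel := le_of_mul_le_mul_left hdecay (by positivity)
  rwa [inv_mul_le_iff₀ hε, mul_comm] at hcancel

lemma Admissible.one_le_margin_and_exp_neg_le (H : R.Admissible D ν Λ c₁ c₂ p t) (hε : 0 < ε)
    (ht : 16 * exp (2 * gap c₂ p + 3) * (min ε 1)⁻¹ ≤ R.rate D * t) (i : Fin n) :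
    1 ≤ R.margin t i ∧ exp (-R.margin t i) ≤ ε := by
  have hε₁ : 0 < min ε 1 := lt_min hε one_pos
  have hexp := H.exp_neg_margin_le_of_time_le hε₁ ht i
  refine ⟨?_, hexp.trans <| (mul_le_of_le_one_left hε₁.le ?_).trans (min_le_left _ _)⟩
  · have hexp2 := hexp.trans (mul_le_of_le_one_right (Real.exp_pos _).le (min_le_right ε 1))
    linarith [Real.exp_le_exp.1 hexp2]
  · exact Real.exp_le_one_iff.2 (by norm_num)

end Margin

lemma Regular.le_ncard_memorized {R : Run n m d} {D ν Λ c₁ c₂ τp τm : ℝ} {t : ℕ}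
    (H : R.Regular D ν Λ c₁ c₂) (hC : R.Controlled Λ t) (hM : ∀ i, 1 ≤ R.margin t i)
    (hL : LabelCounts R.y R.yt τp τm) :
    min τp τm * n / 2 ≤ (memorized R.x R.y R.yt (R.W t) (R.γ t) (R.ρ t)).ncard := by
  set S := memorized R.x R.y R.yt (R.W t) (R.γ t) (R.ρ t)
  have card_le {A : Finset (Fin n)} {τ : ℝ} (hA : (A.card : ℝ) = τ * n / 2) (hτ : min τp τm ≤ τ)
      (hAS : ↑A ⊆ S) : min τp τm * n / 2 ≤ S.ncard := by
    have hcard : A.card ≤ S.ncard := Set.ncard_coe_finset A ▸ Set.ncard_le_ncard hAS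
    have hcard' : (A.card : ℝ) ≤ S.ncard := by exact_mod_cast hcard
    linarith [mul_le_mul_of_nonneg_right hτ (Nat.cast_nonneg (α := ℝ) n)]
  have hfit (i : Fin n) : 0 ≤ lab (R.yt i) * net (R.W t) (R.x i) := zero_le_one.trans (hM i)
  by_cases hpos : ∀ i, R.y i = 1 → R.yt i ≠ R.y i → i ∈ S
  · exact card_le hL.pos_noisy (min_le_left _ _) fun i hi => by
      simp only [Finset.coe_filter, Finset.mem_univ, true_and, Set.mem_ofPred_eq] at hi
      exact hpos i hi.1 hi.2
  · push Not at hpos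
    obtain ⟨i, hyi, hi, hiS⟩ := hpos
    refine card_le hL.neg_noisy (min_le_right _ _) fun k hk => ?_
    simp only [Finset.coe_filter, Finset.mem_univ, true_and, Set.mem_ofPred_eq] at hk
    refine ⟨hk.2, ?_, hfit k⟩
    refine (H.noise_dominates_or hC hi hk.2 (by rw [hk.1, hyi]) (hM i) (hM k)).resolve_left ?_
    exact fun h => hiS ⟨hi, h, hfit i⟩

theorem Regular.exists_memorized {R : Run n m d} {D ν Λ c₁ c₂ τ τp τm : ℝ} {t : ℕ}
    (H : R.Regular D ν Λ c₁ c₂) (hC : R.Controlled Λ t) (hM : ∀ i, 1 ≤ R.margin t i)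
    (hL : LabelCounts R.y R.yt τp τm) (hτ : τ ≤ min τp τm) :
    ∃ τ' : ℝ, τ / 2 ≤ τ' ∧ τ' ≤ (τp + τm) / 2 ∧
      ((memorized R.x R.y R.yt (R.W t) (R.γ t) (R.ρ t)).ncard : ℝ) = τ' * n := by
  have hn := H.n_pos'
  have hlower := H.le_ncard_memorized hC hM hL
  have hupper := hL.ncard_memorized_le (x := R.x) (W := R.W t) (γ := R.γ t) (ρ := R.ρ t)
  refine ⟨_ / n, ?_, ?_, (div_mul_cancel₀ _ hn.ne').symm⟩
  · rw [le_div_iff₀ hn]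
    linarith [mul_le_mul_of_nonneg_right hτ hn.le]
  · rw [div_le_iff₀ hn]
    linarith

lemma le_testError {R : Run n m d} {τp τm σ : ℝ} {t : ℕ} (hn : 0 < n) (hm : 0 < m)
    (hM : ∀ i, 1 ≤ R.margin t i) (hL : LabelCounts R.y R.yt τp τm)
    (hW : ∀ j r, σ ^ 2 * ‖R.W t j r‖ ^ 2 ≤ 1 / (16 * n)) :
    (τp + τm) / 4 * (1 - exp (-n)) ≤ testError R.μ σ R.ξ (R.W t) := by
  have : (0 : ℝ) < n := Nat.cast_pos.2 hn
  have hwrong (i : Fin n) (hi : i ∈ ({i | R.yt i ≠ R.y i} : Finset (Fin n))) :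
      lab (R.y i) * net (R.W t) (lab (R.y i) • R.μ, R.ξ i) ≤ -1 := by
    have hMi := hM i
    rw [margin, net_x, R.yt_eq_neg_of_ne (Finset.mem_filter.1 hi).2, lab_neg] at hMi
    linarith
  calc (τp + τm) / 4 * (1 - exp (-n))
      = (τp + τm) * n / 2 * (1 / 2 * (1 / n * (1 - exp (-n)))) := by field_simp; ring
    _ = ({i | R.yt i ≠ R.y i} : Finset (Fin n)).card * (1 / 2 * (1 / n * (1 - exp (-n)))) := by
      rw [hL.card_noisy]
    _ ≤ ({i | R.yt i ≠ R.y i} : Finset (Fin n)).card *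
        (1 / 2 * (1 / n * (gaussianPatch d σ).real {ζ | response (R.W t) ζ < 1})) := by
      gcongr
      exact one_sub_exp_neg_le_gaussianPatch_response_lt hn hm hW
    _ ≤ testError R.μ σ R.ξ (R.W t) := card_mul_le_testError R.y _ hwrong

end Run

namespace LabelCounts

variable {n : ℕ} {y yt : Fin n → ℤˣ} {τp τm : ℝ}

lemma half_mul_min_le (hL : LabelCounts y yt τp τm) (hn : 0 < n) (hne : τp ≠ τm)
    (hτ : min τp τm ≤ 1) : 1 / 2 * min τp τm ≤ (τp + τm) / 4 * (1 - exp (-n)) := by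
  have hn0 : (0 : ℝ) < n := Nat.cast_pos.2 hn
  have hq0 : 0 < exp (-(n : ℝ)) := Real.exp_pos _
  have hsum := hL.two_mul_min_add_le hn hne
  set M := min τp τm
  set q := exp (-(n : ℝ)) with hq
  have hqn : q * (n + 1) ≤ 1 := by
    rw [hq, Real.exp_neg, inv_mul_le_iff₀ (Real.exp_pos _), mul_one]
    exact Real.add_one_le_exp _
  have hqM : q * n * M ≤ q * n := mul_le_of_le_one_right (by positivity) hτ
  have hloss : q * M ≤ 1 / n * (1 - q) := by
    rw [one_div_mul_eq_div, le_div_iff₀ hn0]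
    linarith
  calc 1 / 2 * M ≤ 1 / 2 * (M - q * M + 1 / n * (1 - q)) := by linarith
    _ = (2 * M + 2 / n) / 4 * (1 - q) := by ring
    _ ≤ (τp + τm) / 4 * (1 - q) := by
      have : 0 ≤ 1 - q := by nlinarith
      gcongr

end LabelCounts

lemma half_mul_one_sub_exp_mul_min_le (n : ℕ) (τp τm : ℝ) :
    1 / 2 * (1 - exp (-n)) * min τp τm ≤ (τp + τm) / 4 * (1 - exp (-n)) := by
  have hq : 0 ≤ 1 - exp (-(n : ℝ)) := by simp
  have hmin : min τp τm ≤ (τp + τm) / 2 := by linarith [min_le_left τp τm, min_le_right τp τm]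
  linarith [mul_le_mul_of_nonneg_left hmin hq]

end LabelNoise

end

open LabelNoise in
theorem theorem4p2_general (c₁ c₂ τlo τhi κ₁ : ℝ) (hc₁ : 0 < c₁) (hc : c₁ ≤ c₂)
    (hτlo : 0 < τlo) (hτhi : τhi < 1) (hκ₁ : 0 < κ₁) :
    ∃ C κ τ₀ : ℝ, 0 < C ∧ 0 < κ ∧ 0 < τ₀ ∧
      ∀ (ε : ℝ), 0 < ε →
      ∀ (n m d : ℕ) (μ : Patch d) (σξ σ0 η τp τm δ : ℝ),
        WeakCondition C c₁ c₂ (maxIter κ ε n m d σξ η) n m d μ σξ σ0 η δ →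
        τp ∈ Set.Icc τlo τhi → τm ∈ Set.Icc τlo τhi →
      ∀ (y yt : Fin n → ℤˣ) (pos : Fin n → Bool), LabelCounts y yt τp τm →
      ∃ E : Set (Weights m d × (Fin n → Patch d)), MeasurableSet E ∧
        1 - δ ≤ (trainLaw n m d σ0 σξ).real E ∧
        ∀ W₀ ξ, (W₀, ξ) ∈ E →
        ∀ T₁ : ℕ, (T₁ : ℝ) ≤ κ₁ * stageOneScale n m d σξ η →
        ∃ t : ℕ, T₁ ≤ t ∧ (t : ℝ) ≤ maxIter κ ε n m d σξ η ∧
          let x := trainInput μ y pos ξ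
          let W := gd η x yt W₀ t
          trainLoss x yt W ≤ ε ∧
          (∀ i, yt i = y i → 0 ≤ lab (yt i) * net W (x i)) ∧
          (∃ γ ρ, IsUniqueDecomposition μ ξ W₀ W γ ρ ∧
            ∃ τ' : ℝ, τ₀ ≤ τ' ∧ τ' ≤ (τp + τm) / 2 ∧
              ((memorized x y yt W γ ρ).ncard : ℝ) = τ' * n) ∧
          (1 / 2) * (1 - Real.exp (-(n : ℝ))) * min τp τm ≤ testError μ σξ ξ W ∧
          (τp ≠ τm → (1 / 2) * min τp τm ≤ testError μ σξ ξ W) := by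
  have hc₂ : 0 < c₂ := hc₁.trans_le hc
  set p := min τlo (1 - τhi) / 2
  have hp0 : 0 < p := half_pos (lt_min hτlo (sub_pos.2 hτhi))
  obtain ⟨C, hC⟩ := exists_largeConst (c₂ := c₂) (p := p) hc₁
  have hC100 := hC.hundred_le
  refine ⟨C, timeConst κ₁ c₂ p, τlo / 2, by linarith, by unfold timeConst; positivity,
    half_pos hτlo, fun ε hε n m d μ σξ σ0 η τp τm δ H hτp hτm y yt pos hL => ?_⟩
  have hn := hL.four_le (H.n_pos hc₁) ⟨hτlo.trans_le hτp.1, hτp.2.trans_lt hτhi⟩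
  obtain ⟨hstage, hT, htime⟩ := H.le_maxIter hc₁ hn hC100 (p := p) hκ₁.le hε
  set T := maxIter (timeConst κ₁ c₂ p) ε n m d σξ η
  have hlog : 1 ≤ Real.log T := by
    rw [Real.le_log_iff_exp_le (by linarith)]
    linarith [Real.exp_one_lt_d9]
  obtain ⟨E, hE, hprob, htypical⟩ := H.exists_measurableSet_isTypical hC hc₁ hc₂.le hn hlog yt
  refine ⟨E, hE, hprob, fun W₀ ξ hmem T₁ hT₁ =>
    ⟨⌊T⌋₊, Nat.le_floor (hT₁.trans hstage), Nat.floor_le (by linarith), ?_⟩⟩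
  let R : Run n m d := ⟨μ, y, yt, pos, ξ, η, W₀⟩
  have hpop : Populated R.y R.clean p := hL.populated hp0
    ((mul_div_cancel₀ _ two_ne_zero).trans_le (min_le_min hτp.1 (sub_le_sub_left hτp.2 1)))
    ((mul_div_cancel₀ _ two_ne_zero).trans_le (min_le_min hτm.1 (sub_le_sub_left hτm.2 1)))
  have hadm := H.admissible (R := R) hC hc₁ hc₂.le hn hlog (htypical W₀ ξ hmem) (by linarith) hpop
  have hctrl := hadm.controlled _ le_rfl
  have hM := hadm.one_le_margin_and_exp_neg_le hε htime
  have htest := R.le_testError hadm.n_pos hadm.m_pos (fun i => (hM i).1) hL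
    (H.sq_mul_sq_norm_W_le (R := R) hC hc₁ hc₂.le hn hlog (htypical W₀ ξ hmem) hctrl)
  exact ⟨R.trainLoss_le hadm.n_pos fun i => (hM i).2, fun i _ => zero_le_one.trans (hM i).1,
    ⟨R.γ _, R.ρ _, hadm.isUniqueDecomposition _,
      hadm.exists_memorized hctrl (fun i => (hM i).1) hL (le_min hτp.1 hτm.1)⟩,
    (half_mul_one_sub_exp_mul_min_le n τp τm).trans htest,
    fun hne => (hL.half_mul_min_le hadm.n_pos hne
      ((min_le_left _ _).trans (hτp.2.trans hτhi.le))).trans htest⟩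

open LabelNoise in
theorem theorem4p2 (c₁ c₂ τlo τhi κ₁ : ℝ) (hc₁ : 0 < c₁) (hc : c₁ ≤ c₂)
    (hτlo : 0 < τlo) (hτ : τlo ≤ τhi) (hτhi : τhi < 1 / 2) (hκ₁ : 0 < κ₁) :
    ∃ C κ τ₀ : ℝ, 0 < C ∧ 0 < κ ∧ 0 < τ₀ ∧
      ∀ (ε : ℝ), 0 < ε →
      ∀ (n m d : ℕ) (μ : Patch d) (σξ σ0 η τp τm δ : ℝ),
        Condition C c₁ c₂ τlo τhi (maxIter κ ε n m d σξ η) n m d μ σξ σ0 η τp τm δ →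
      ∀ (y yt : Fin n → ℤˣ) (pos : Fin n → Bool), LabelCounts y yt τp τm →
      ∃ E : Set (Weights m d × (Fin n → Patch d)), MeasurableSet E ∧
        1 - δ ≤ (trainLaw n m d σ0 σξ).real E ∧
        ∀ W₀ ξ, (W₀, ξ) ∈ E →
        ∀ T₁ : ℕ, (T₁ : ℝ) ≤ κ₁ * stageOneScale n m d σξ η →
        ∃ t : ℕ, T₁ ≤ t ∧ (t : ℝ) ≤ maxIter κ ε n m d σξ η ∧
          let x := trainInput μ y pos ξ
          let W := gd η x yt W₀ t
          trainLoss x yt W ≤ ε ∧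
          (∀ i, yt i = y i → 0 ≤ lab (yt i) * net W (x i)) ∧
          (∃ γ ρ, IsUniqueDecomposition μ ξ W₀ W γ ρ ∧
            ∃ τ' : ℝ, τ₀ ≤ τ' ∧ τ' ≤ (τp + τm) / 2 ∧
              ((memorized x y yt W γ ρ).ncard : ℝ) = τ' * n) ∧
          (1 / 2) * (1 - Real.exp (-(n : ℝ))) * min τp τm ≤ testError μ σξ ξ W ∧
          (τp ≠ τm → (1 / 2) * min τp τm ≤ testError μ σξ ξ W) := by
  obtain ⟨C, κ, τ₀, hC, hκ, hτ₀, h⟩ :=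
    theorem4p2_general c₁ c₂ τlo τhi κ₁ hc₁ hc hτlo (by linarith) hκ₁
  exact ⟨C, κ, τ₀, hC, hκ, hτ₀, fun ε hε n m d μ σξ σ0 η τp τm δ H =>
    h ε hε n m d μ σξ σ0 η τp τm δ (H.weak hC.le) H.τp_mem H.τm_mem⟩
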